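/- **Setting.** Let $\mathcal S,\mathcal A$ be finite sets with $S,A\ge 1$ elements and $H\ge 1$. Consider an episodic tabular MDP $M$ with transition probabilities $P(\cdot\mid s,a)$, mean rewards $r(s,a)$ and horizon $H$. In episode $k=1,2,\dots$ an initial state $s_1^k\in\mathcal S_{\mathrm{init}}\subseteq\mathcal S$ is chosen, possibly adaptively; at step $h\in[H]$ the agent plays $a_h^k=\pi_h^k(s_h^k)$, receives a random reward $R_h^k$ with $\mathbb E[R_h^k\mid\mathcal F_h^k]=r(s_h^k,a_h^k)$, and $s_{h+1}^k$ has conditional law $P(\cdot\mid s_h^k,a_h^k)$ given $\mathcal F_h^k$, where $(\mathcal F^k_h)$ is a filtration (e.g. the one generated by the observations) containing the information available once $s_h^k,a_h^k$ are known; $\pi^k$ is determined by the information before episode $k$. Let $\Pi$ be the set of deterministic policies $\pi=(\pi_h)_{h\in[H]}$, $\pi_h:\mathcal S\to\mathcal A$, let $V_h^\pi,Q_h^\pi$ be the value functions ($V_{H+1}^\pi=0$), $V_h^*=\max_\pi V_h^\pi$, $Q_h^*=\max_\pi Q_h^\pi$, $\mathrm{gap}_h(s,a)=V_h^*(s)-Q_h^*(s,a)$,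 $\mathrm{gap}(s,a)=\min_h\mathrm{gap}_h(s,a)$, and let $\mathrm{gap}_{\min}$ be the smallest non-zero $\mathrm{gap}_h(s,a)$. Write $x\wedge y$, $x\vee y$ for minimum and maximum. *Assumptions.* (1) $0\le V_h^\pi(s)\le V_{\max}$ for all $h,s,\pi$. (2) There are $\sigma_{\exp}:[H]\times\mathcal S\times\mathcal A\to\mathbb R_{\ge0}$ and $V_\alpha\ge 0$ such that for all $k$, all $h,j\in[H]$ and all real $t$ with $|t|V_\alpha\le 1$, almost surely $$\mathbb E\big[\exp\big(t(R_h^k+V_{j+1}^*(s_{h+1}^k)-Q_j^*(s_h^k,a_h^k))\big)\,\big|\,\mathcal F_h^k\big]\le\exp\big(\tfrac12t^2\sigma_{\exp}(j,s_h^k,a_h^k)^2\big).$$ *Algorithm.* EQO+ has as input positive non-decreasing real sequences $(c_{1,k})_{k\ge1},(c_{2,k})_{k\ge1}$. Let $N^k(s,a)$ be the number of visits to $(s,a)$ before episode $k$, $\hat r^k,\hat P^k$ the empirical mean rewards and transition frequencies, and $b^k=\frac{c_{1,k}}{N^k}\wedge\frac{c_{2,k}}{\sqrt{N^k}}$. Set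 $V^k_{H+1}=0$ and, backwards in $h$, $Q_h^k(s,a)=\big((\hat r^k+\hat P^kV_{h+1}^k)(s,a)\vee0+b^k(s,a)\big)\wedge V_{\max}$ if $N^k(s,a)>0$ and $Q_h^k(s,a)=V_{\max}$ otherwise, $V_h^k(s)=\max_aQ_h^k(s,a)$; $\pi_h^k(s)$ is a maximizer of $Q_h^k(s,\cdot)$. *Regret.* $\mathrm{Reg}(K)=\sum_{k=1}^K(V_1^*(s_1^k)-V_1^{\pi^k}(s_1^k))$ and, for $\delta\in(0,1]$, the distributional regret is $\mathrm{Reg}(K,\delta)=\inf\{x\in\mathbb R:\mathbb P(\mathrm{Reg}(K)>x)\le\delta\}$. *Notation.* $W_h^\pi(s)=\mathbb E_\pi[\sum_{j=h}^H\frac12\sigma_{\exp}^2(j,s_j,a_j)\mid s_h=s]$, $\mathbb W^*=\max_{h,s,\pi}W_h^\pi(s)$, $\mathbb W^*_{\mathrm{diff}}=\max_{h,s,\pi}(W_h^\pi(s)-\min_{s'}W_h^\pi(s'))$, $\sigma_{\max}=\max_{h,s,a}2\sigma_{\exp}(h,s,a)\vee\sqrt{2V_\alpha V_{\max}}$, $\ell_1(i,\delta)=\log\frac{32HSAi^2}{\delta}$,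 $\ell_2(k,\delta)=\log\frac{32HSA(\log(e^2kH))^2}{\delta}$, $\theta=(2\sqrt{13\mathbb W^*_{\mathrm{diff}}}\vee2V_\alpha)\,\ell_1(1,\delta)$. *Auxiliary sequences* for $\delta$ are $(\lambda_i)_{i\ge1}$ in $(0,\infty)$ with $\lambda_iV_\alpha\le1$ and $(\iota_k)_{k\ge1}$ in $\{1,2,\dots\}$ such that $\frac{\ell_1(\iota_k,\delta)}{\lambda_{\iota_k}}+13\lambda_{\iota_k}\mathbb W^*_{\mathrm{diff}}\ell_1(1,\delta)\le c_{1,k}\le\frac{4\ell_1(\iota_k,\delta)}{\lambda_{\iota_k}}$ whenever $c_{1,k}\ge\theta$, and $\iota_k=1$ otherwise. Given these, set $$\kappa(\delta)=\max\Big\{k\ge1:c_{1,k}<\theta\ \text{ or }\ c_{2,k}<\Big(\sigma_{\max}+\frac{6\mathbb W^*_{\mathrm{diff}}\ell_1(\iota_k,\delta)}{c_{1,k}}\Big)\sqrt{\ell_2(k,\delta)}\Big\},$$ $$\kappa_{\mathrm{gap}}(g,\delta)=\max\Big\{k\ge1:c_{1,k}<\frac{36\,\mathbb W^*\ell_1(\iota_k,\delta)}{g}\Big\}$$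 ($0$ for an empty set, $\infty$ for an infinite one). *Effective gaps.* For a policy $\pi$ and a trajectory let $B$ be the first step $h$ with $\mathrm{gap}_h(s_h,a_h)>0$ ($B=H+1$ if there is none). Functions $\overline{\mathrm{gap}}_h:\mathcal S\times\mathcal A\to(0,\infty)$, $h\in[H]$, are effective gaps if $\mathbb E_\pi[\sum_{h=B}^H\overline{\mathrm{gap}}_h(s_h,a_h)\mid s_1=s]\le V_1^*(s)-V_1^\pi(s)$ for all $s\in\mathcal S_{\mathrm{init}}$, $\pi\in\Pi$; put $\overline{\mathrm{gap}}(s,a)=\min_h\overline{\mathrm{gap}}_h(s,a)$. Let $v_{\mathrm{gap}}$ be the minimum of $\mathrm{gap}_B(s_B,a_B)$ over all $\pi\in\Pi$, $s_1\in\mathcal S_{\mathrm{init}}$ and trajectories of positive probability with $B\le H$ (if there are none, all regrets are zero and the value of $v_{\mathrm{gap}}$ is immaterial). **Theorem.** Let $\delta\in(0,1]$. Auxiliary sequences exist, and can be chosen with $\iota_k\le k\wedge(3+\log_2(c_{1,k}/c_{1,1}))$ for all $k\ge1$. For any auxiliary sequences and every $K\ge1$: (a) for all effective gaps, $$\mathrm{Reg}(K,\delta)\le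 V_{\max}(\kappa(\delta)\wedge K)+\sum_{(s,a)}\Big(\frac{2048c_{2,K}^2}{\overline{\mathrm{gap}}(s,a)}\wedge64c_{1,K}\log\Big(1\vee\frac{32c_{1,K}}{\overline{\mathrm{gap}}(s,a)}\Big)\Big)+\sum_{k=\kappa(\delta)+1}^{\kappa_{\mathrm{gap}}(v_{\mathrm{gap}},\delta)\wedge K}\frac{144\,\mathbb W^*\ell_1(\iota_k,\delta)}{c_{1,k}}+288V_{\max}S^2A\,\ell_2(K,\delta)\log(2KH),$$ and, if $\overline{\mathrm{gap}}(s,a)\le V_{\max}$ for all $(s,a)$, the same bound holds with $\log\frac{32c_{1,K}}{\overline{\mathrm{gap}}(s,a)}$ in place of $\log\big(1\vee\frac{32c_{1,K}}{\overline{\mathrm{gap}}(s,a)}\big)$; (b) if some $\mathrm{gap}_h(s,a)$ is positive, then $$\mathrm{Reg}(K,\delta)\le V_{\max}(\kappa(\delta)\wedge K)+\sum_{(s,a)}\Big(\frac{4096c_{2,K}^2}{\mathrm{gap}(s,a)\vee\frac{\mathrm{gap}_{\min}}H}\wedge64c_{1,K}\log\frac{64c_{1,K}}{\mathrm{gap}(s,a)\vee\frac{\mathrm{gap}_{\min}}H}\Big)+\sum_{k=\kappa(\delta)+1}^{\kappa_{\mathrm{gap}}(\mathrm{gap}_{\min},\delta)\wedge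 K}\frac{144\,\mathbb W^*\ell_1(\iota_k,\delta)}{c_{1,k}}+288V_{\max}S^2A\,\ell_2(K,\delta)\log(2KH).$$ -/

import Mathlib

open MeasureTheory
open scoped ENNReal

noncomputable section

/-! ## Finite-horizon tabular MDPs

Steps are numbered `0, …, H - 1` (the usual steps `1, …, H`); a state is also observed at step `H`,
after the last action.  Episodes are numbered `1, 2, …`. -/

/-- A tabular MDP with horizon `H`, time-homogeneous transition probabilities `P s a s'` and mean
rewards `r s a`. -/
structure TabularMDP (S A : Type*) [Fintype S] (H : ℕ) where
  P : S → A → S → ℝ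
  P_nonneg : ∀ s a s', 0 ≤ P s a s'
  P_sum : ∀ s a, ∑ s', P s a s' = 1
  r : S → A → ℝ

/-- Deterministic, step-dependent policies. -/
abbrev Policy (S A : Type*) (H : ℕ) := Fin H → S → A

/-- The minimum over the steps of a function of step, state and action. -/
def minOverSteps {S A : Type*} {H : ℕ} (g : Fin H → S → A → ℝ) (s : S) (a : A) : ℝ :=
  ⨅ h : Fin H, g h s a

namespace TabularMDP

variable {S A : Type*} [Fintype S] {H : ℕ} (M : TabularMDP S A H)

/-- Probability of the state sequence `x` under policy `π`, started at step `h` in state `s`.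
The irrelevant coordinates before step `h` are pinned to `s`. -/
def trajProb (π : Policy S A H) (h : ℕ) (s : S) (x : Fin H → S) : ℝ :=
  open Classical in
  (if ∀ j : Fin H, (j : ℕ) ≤ h → x j = s then 1 else 0) *
    ∏ j : Fin H, if hj : h ≤ (j : ℕ) ∧ (j : ℕ) + 1 < H then
      M.P (x j) (π j (x j)) (x ⟨(j : ℕ) + 1, hj.2⟩) else 1

/-- Expectation of a function of the trajectory under `π`, started at step `h` in state `s`. -/
def trajExp (π : Policy S A H) (h : ℕ) (s : S) (f : (Fin H → S) → ℝ) : ℝ :=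
  ∑ x : Fin H → S, M.trajProb π h s x * f x

/-- Expected sum of `g j (s_j, a_j)` over the steps `j ≥ h` under `π`, started at step `h` in `s`. -/
def cumulative (g : Fin H → S → A → ℝ) (π : Policy S A H) (h : ℕ) (s : S) : ℝ :=
  M.trajExp π h s fun x => ∑ j : Fin H, if h ≤ (j : ℕ) then g j (x j) (π j (x j)) else 0

/-- Value function of a policy; it vanishes at step `H`. -/
def V (π : Policy S A H) (h : ℕ) (s : S) : ℝ :=
  M.cumulative (fun _ => M.r) π h s

/-- Action-value function of a policy: play `a` in `s` at step `h`, then follow `π`. -/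
def Q (π : Policy S A H) (h : ℕ) (s : S) (a : A) : ℝ :=
  M.r s a + ∑ s', M.P s a s' * M.V π (h + 1) s'

/-- Optimal value function (a maximum over the finitely many policies). -/
def Vstar (h : ℕ) (s : S) : ℝ := ⨆ π : Policy S A H, M.V π h s

/-- Optimal action-value function. -/
def Qstar (h : ℕ) (s : S) (a : A) : ℝ := ⨆ π : Policy S A H, M.Q π h s a

/-- Sub-optimality gap of `(s, a)` at step `h`. -/
def gapAt (h : ℕ) (s : S) (a : A) : ℝ := M.Vstar h s - M.Qstar h s a

/-- `gap(s, a)`: the minimum of the gaps over the steps. -/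
def gap (s : S) (a : A) : ℝ := minOverSteps (fun h : Fin H => M.gapAt h) s a

/-- Minimum non-zero gap. -/
def gapMin : ℝ := sInf {g | 0 < g ∧ ∃ (h : Fin H) (s : S) (a : A), g = M.gapAt h s a}

/-- The first step at which `π` takes a sub-optimal action along `x`, or `H` if there is none. -/
def firstSubopt (π : Policy S A H) (x : Fin H → S) : ℕ :=
  sInf ({h | ∃ hh : h < H, 0 < M.gapAt h (x ⟨h, hh⟩) (π ⟨h, hh⟩ (x ⟨h, hh⟩))} ∪ {H})

/-- Effective gaps: positive functions whose expected sum, from the first sub-optimal action on, is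
at most the regret of the policy, for every policy and every possible initial state. -/
def IsEffectiveGap (Sinit : Set S) (g : Fin H → S → A → ℝ) : Prop :=
  (∀ h s a, 0 < g h s a) ∧
    ∀ s ∈ Sinit, ∀ π : Policy S A H,
      M.trajExp π 0 s (fun x => ∑ h : Fin H,
        if M.firstSubopt π x ≤ (h : ℕ) then g h (x h) (π h (x h)) else 0)
      ≤ M.Vstar 0 s - M.V π 0 s

/-- `v_gap`: the least gap of a first sub-optimal selection, over all policies, possible initial
states and trajectories of positive probability.  If no sub-optimal selection can occur, the value
is `0`; all regrets are then zero. -/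
def vGap (Sinit : Set S) : ℝ :=
  sInf {g | ∃ π : Policy S A H, ∃ s ∈ Sinit, ∃ x : Fin H → S, 0 < M.trajProb π 0 s x ∧
    ∃ hB : M.firstSubopt π x < H,
      g = M.gapAt (M.firstSubopt π x) (x ⟨_, hB⟩) (π ⟨_, hB⟩ (x ⟨_, hB⟩))}

/-! ### Variance proxies -/

/-- Total variance proxy function. -/
def W (sig : Fin H → S → A → ℝ) (π : Policy S A H) (h : ℕ) (s : S) : ℝ :=
  M.cumulative (fun j s a => sig j s a ^ 2 / 2) π h s

/-- Maximum of the total variance proxy function. -/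
def WStar (sig : Fin H → S → A → ℝ) : ℝ :=
  ⨆ p : Fin H × S × Policy S A H, M.W sig p.2.2 p.1 p.2.1

/-- Maximum range of the total variance proxy function. -/
def WDiffStar (sig : Fin H → S → A → ℝ) : ℝ :=
  ⨆ p : Fin H × S × Policy S A H,
    (M.W sig p.2.2 p.1 p.2.1 - ⨅ s : S, M.W sig p.2.2 p.1 s)

end TabularMDP

/-- The threshold constant `σ_max`. -/
def sigmaMax {S A : Type*} {H : ℕ} (sig : Fin H → S → A → ℝ) (Valpha Vmax : ℝ) : ℝ :=
  ⨆ p : Fin H × S × A, max (2 * sig p.1 p.2.1 p.2.2) (√(2 * Valpha * Vmax))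

/-- `X` is conditionally `(σ, α)`-sub-exponential given the `σ`-algebra `m`.  For `α = 0` the
condition is required for all real `t`. -/
def CondSubExp {Ω : Type*} (m : MeasurableSpace Ω) {mΩ : MeasurableSpace Ω} (μ : Measure Ω)
    (X σ : Ω → ℝ) (α : ℝ) : Prop :=
  ∀ t : ℝ, |t| * α ≤ 1 →
    Integrable (fun ω => Real.exp (t * X ω)) μ ∧
    μ[fun ω => Real.exp (t * X ω) | m] ≤ᵐ[μ] fun ω => Real.exp (σ ω ^ 2 * t ^ 2 / 2)

/-! ## The interaction and the algorithm -/

/-- The random quantities of an interaction: states `s k h` (`k ≥ 1`, `h ≤ H`), rewards `R k h`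
(`h < H`), and the policies `pol k` executed in episode `k`. -/
structure Interaction (S A : Type*) (H : ℕ) (Ω : Type*) where
  s : ℕ → ℕ → Ω → S
  R : ℕ → ℕ → Ω → ℝ
  pol : ℕ → Ω → Policy S A H

namespace Interaction

variable {S A : Type*} [Fintype S] {H : ℕ} {Ω : Type*} (I : Interaction S A H Ω)

/-- The action at step `h` of episode `k`. -/
def a (k : ℕ) (h : Fin H) (ω : Ω) : A := I.pol k ω h (I.s k h ω)

/-- The interaction takes place in the MDP `M`, with initial states in `Sinit`.
`ℱ (k, 0)` is the information before episode `k`, and `ℱ (k, h + 1)` the information once the state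
and the action at step `h` of episode `k` are known (or the last state, if `h = H`).  Initial states
may be chosen adaptively, and the law of a reward may depend on the past. -/
structure InMDP [mΩ : MeasurableSpace Ω] (M : TabularMDP S A H) (Sinit : Set S) (μ : Measure Ω)
    (ℱ : Filtration (ℕ ×ₗ ℕ) mΩ) : Prop where
  pol_meas : ∀ k, 1 ≤ k → ∀ (h : Fin H) (x : S) (b : A),
    MeasurableSet[ℱ (toLex (k, 0))] {ω | I.pol k ω h x = b}
  s_meas : ∀ k, 1 ≤ k → ∀ h ≤ H, ∀ x : S,
    MeasurableSet[ℱ (toLex (k, h + 1))] {ω | I.s k h ω = x}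
  R_meas : ∀ k, 1 ≤ k → ∀ h < H, Measurable[ℱ (toLex (k, h + 2))] (I.R k h)
  init : ∀ k, 1 ≤ k → ∀ ω, I.s k 0 ω ∈ Sinit
  transition : ∀ k, 1 ≤ k → ∀ (h : Fin H) (x : S),
    μ[{ω | I.s k (h + 1) ω = x}.indicator (fun _ => (1 : ℝ)) | ℱ (toLex (k, (h : ℕ) + 1))]
      =ᵐ[μ] fun ω => M.P (I.s k h ω) (I.a k h ω) x
  R_integrable : ∀ k, 1 ≤ k → ∀ h < H, Integrable (I.R k h) μ
  R_mean : ∀ k, 1 ≤ k → ∀ h : Fin H,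
    μ[I.R k h | ℱ (toLex (k, (h : ℕ) + 1))] =ᵐ[μ] fun ω => M.r (I.s k h ω) (I.a k h ω)

/-- Conditional sub-exponentiality: `sig j x b` is a variance proxy, attached to the pair `(x, b)`,
for reward plus optimal value at step `j + 1` of the next state.  As the MDP is time-homogeneous,
it is a proxy at whatever step `h` the pair is visited. -/
def SubExp [mΩ : MeasurableSpace Ω] (M : TabularMDP S A H) (μ : Measure Ω)
    (ℱ : Filtration (ℕ ×ₗ ℕ) mΩ) (sig : Fin H → S → A → ℝ) (Valpha : ℝ) : Prop :=
  ∀ k, 1 ≤ k → ∀ h j : Fin H,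
    CondSubExp (ℱ (toLex (k, (h : ℕ) + 1))) μ
      (fun ω => I.R k h ω + M.Vstar ((j : ℕ) + 1) (I.s k (h + 1) ω)
        - M.Qstar j (I.s k h ω) (I.a k h ω))
      (fun ω => sig j (I.s k h ω) (I.a k h ω)) Valpha

open Classical in
/-- Number of visits of `(x, b)` before episode `k`. -/
def N (k : ℕ) (ω : Ω) (x : S) (b : A) : ℕ :=
  ∑ i ∈ Finset.Ico 1 k, ∑ h : Fin H, if I.s i h ω = x ∧ I.a i h ω = b then 1 else 0

open Classical in
/-- Empirical mean reward. -/
def rHat (k : ℕ) (ω : Ω) (x : S) (b : A) : ℝ :=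
  (∑ i ∈ Finset.Ico 1 k, ∑ h : Fin H, if I.s i h ω = x ∧ I.a i h ω = b then I.R i h ω else 0)
    / (I.N k ω x b : ℝ)

open Classical in
/-- Empirical transition probabilities. -/
def PHat (k : ℕ) (ω : Ω) (x : S) (b : A) (y : S) : ℝ :=
  (∑ i ∈ Finset.Ico 1 k, ∑ h : Fin H,
    if I.s i h ω = x ∧ I.a i h ω = b ∧ I.s i (h + 1) ω = y then (1 : ℝ) else 0)
    / (I.N k ω x b : ℝ)

/-- Exploration bonus. -/
def bonus (c₁ c₂ : ℕ → ℝ) (k : ℕ) (ω : Ω) (x : S) (b : A) : ℝ :=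
  min (c₁ k / (I.N k ω x b : ℝ)) (c₂ k / √(I.N k ω x b : ℝ))

/-- One backward step of the algorithm: estimated action values from estimated next values. -/
def backup (c₁ c₂ : ℕ → ℝ) (Vmax : ℝ) (k : ℕ) (ω : Ω) (v : S → ℝ) (x : S) (b : A) : ℝ :=
  if 0 < I.N k ω x b then
    min (max (I.rHat k ω x b + ∑ y, I.PHat k ω x b y * v y) 0 + I.bonus c₁ c₂ k ω x b) Vmax
  else Vmax

/-- Estimated values with `n` steps to go. -/
def estToGo (c₁ c₂ : ℕ → ℝ) (Vmax : ℝ) (k : ℕ) (ω : Ω) : ℕ → S → ℝ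
  | 0, _ => 0
  | n + 1, x => ⨆ b : A, I.backup c₁ c₂ Vmax k ω (estToGo c₁ c₂ Vmax k ω n) x b

/-- Estimated action values at step `h` in episode `k`. -/
def QEst (c₁ c₂ : ℕ → ℝ) (Vmax : ℝ) (k : ℕ) (ω : Ω) (h : Fin H) (x : S) (b : A) : ℝ :=
  I.backup c₁ c₂ Vmax k ω (I.estToGo c₁ c₂ Vmax k ω (H - 1 - (h : ℕ))) x b

/-- The policies are those of EQO+ with parameters `c₁, c₂`: greedy for the estimated action
values, ties being broken arbitrarily. -/
def FollowsEQO (c₁ c₂ : ℕ → ℝ) (Vmax : ℝ) : Prop :=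
  ∀ k, 1 ≤ k → ∀ ω (h : Fin H) (x : S) (b : A),
    I.QEst c₁ c₂ Vmax k ω h x b ≤ I.QEst c₁ c₂ Vmax k ω h x (I.pol k ω h x)

/-- Cumulative regret over `K` episodes. -/
def regret (M : TabularMDP S A H) (K : ℕ) (ω : Ω) : ℝ :=
  ∑ k ∈ Finset.Icc 1 K, (M.Vstar 0 (I.s k 0 ω) - M.V (I.pol k ω) 0 (I.s k 0 ω))

/-- Distributional regret: `inf {x ∈ ℝ | ℙ(regret > x) ≤ δ}` (equal to `-∞` if `δ = 1`). -/
def distRegret [MeasurableSpace Ω] (M : TabularMDP S A H) (μ : Measure Ω) (K : ℕ) (δ : ℝ) : EReal :=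
  sInf ((fun x : ℝ => (x : EReal)) '' {x | μ {ω | x < I.regret M K ω} ≤ ENNReal.ofReal δ})

end Interaction

/-! ## Quantities in the bound -/

/-- `ℓ₁(i, δ) = log (32 H S A i² / δ)`. -/
def ell1 (H nS nA : ℕ) (i : ℕ) (δ : ℝ) : ℝ :=
  Real.log (32 * H * nS * nA * (i : ℝ) ^ 2 / δ)

/-- `ℓ₂(k, δ) = log (32 H S A (log (e² k H))² / δ)`. -/
def ell2 (H nS nA : ℕ) (k : ℕ) (δ : ℝ) : ℝ :=
  Real.log (32 * H * nS * nA * Real.log (Real.exp 2 * k * H) ^ 2 / δ)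

/-- The threshold for `c₁` below which no guarantee is given. -/
def c1Threshold (Wd Valpha l11 : ℝ) : ℝ := max (2 * √(13 * Wd)) (2 * Valpha) * l11

/-- The auxiliary sequences `(λ_i)` and `(ι_k)` attached to `c₁` and `δ`; here `l1 i = ℓ₁(i, δ)`
and `Wd` is the maximum range of the total variance proxy. -/
structure IsAuxSeq (l1 : ℕ → ℝ) (Wd Valpha : ℝ) (c₁ : ℕ → ℝ) (lam : ℕ → ℝ) (ι : ℕ → ℕ) : Prop where
  lam_pos : ∀ i, 1 ≤ i → 0 < lam i
  lam_le : ∀ i, 1 ≤ i → lam i * Valpha ≤ 1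
  iota_pos : ∀ k, 1 ≤ k → 1 ≤ ι k
  lower : ∀ k, 1 ≤ k → c1Threshold Wd Valpha (l1 1) ≤ c₁ k →
    l1 (ι k) / lam (ι k) + 13 * lam (ι k) * Wd * l1 1 ≤ c₁ k
  upper : ∀ k, 1 ≤ k → c1Threshold Wd Valpha (l1 1) ≤ c₁ k → c₁ k ≤ 4 * l1 (ι k) / lam (ι k)
  iota_eq_one : ∀ k, 1 ≤ k → c₁ k < c1Threshold Wd Valpha (l1 1) → ι k = 1

/-- `κ(δ)`: the last episode at which `c₁` or `c₂` is too small (`0` if there is none, `∞` if there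
are infinitely many). -/
def kappa (l1 l2 : ℕ → ℝ) (Wd Valpha sMax : ℝ) (c₁ c₂ : ℕ → ℝ) (ι : ℕ → ℕ) : ℕ∞ :=
  ⨆ k ∈ {k : ℕ | 1 ≤ k ∧ (c₁ k < c1Threshold Wd Valpha (l1 1) ∨
    c₂ k < (sMax + 6 * Wd * l1 (ι k) / c₁ k) * √(l2 k))}, (k : ℕ∞)

/-- `κ_gap(g, δ)`, with the same conventions. -/
def kappaGap (l1 : ℕ → ℝ) (Ws : ℝ) (c₁ : ℕ → ℝ) (ι : ℕ → ℕ) (g : ℝ) : ℕ∞ :=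
  ⨆ k ∈ {k : ℕ | 1 ≤ k ∧ c₁ k < 36 * Ws * l1 (ι k) / g}, (k : ℕ∞)

open Classical in
/-- The regret bound
`Vmax (κ ∧ K) + G + ∑_{k = κ + 1}^{κ_gap ∧ K} 144 W* ℓ₁(ι_k, δ) / c_{1,k}
  + 288 Vmax S² A ℓ₂(K, δ) log (2 K H)`,
where `G` is the gap-dependent sum over the state-action pairs. -/
def regretBound (H nS nA K : ℕ) (Vmax Ws : ℝ) (l1 l2 : ℕ → ℝ) (c₁ : ℕ → ℝ) (ι : ℕ → ℕ)
    (κ κg : ℕ∞) (G : ℝ) : ℝ :=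
  Vmax * ((min κ (K : ℕ∞)).toNat : ℝ) + G
    + ∑ k ∈ (Finset.Icc 1 K).filter (fun k : ℕ => κ < (k : ℕ∞) ∧ (k : ℕ∞) ≤ κg),
        144 * Ws * l1 (ι k) / c₁ k
    + 288 * Vmax * (nS : ℝ) ^ 2 * nA * l2 K * Real.log (2 * K * H)

end

/-! The bonus of EQO+ is too small for optimism, but it yields quasi-optimism: the optimal value
exceeds the estimate by at most λ times a potential of order `WStar`, where λ is of order ℓ₁/c₁.
Concentration at a fixed exponent λ costs λσ²/2 + ℓ₁/(λN) per backup. The bonus pays the second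
term; the first accumulates along the trajectory to λ times the total variance proxy W. This slack
must itself pass through the empirical kernel, whose error on W is of Bernstein type and contains
the variance of W at the next state. Subtracting a square from 2W makes a potential whose expected
drop pays for that variance as well (`potential_step`, `Concentrated.quasi_optimism`).

In the other direction, the over-estimation with respect to the executed policy satisfies a backward
recursion with the width 2·bonus + O(Vmax S L/N). The empirical error on V^k − V* leaves a variance
term Var/(12 Vmax), because V^k is random and only entrywise bounds on the kernel are available. A
convex quadratic of V^k − V* absorbs it (`Concentrated.errorPotential_step`). The resulting quantity
T is bounded by 3/2·Vmax and satisfies T_h ≤ X_h + P T_{h+1}. Boundedness allows the expected path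
sum of X to be replaced by the expectation of its saturation (1 − e^{−ty})/t, at the price of a
factor 6/5 (`le_trajExp_saturate`).

Gaps enter through the first sub-optimal action. Before it nothing is lost; at it the regret to go
is at least `vGap`, so once c₁ is large the quasi-optimism error is a fixed fraction of that regret
and is absorbed. Writing R = 2R − R and bounding the subtracted R below by the effective gaps clips
the widths: only their excess over the gap is paid (`regret_le_of_effectiveGap`).

Expectations become counts through Laplace transforms. The expected saturated cost is at most a
constant times −log E e^{−tY}/t, and the products of the normalized variables e^{−tY}/E e^{−tY} over
the episodes have mean at most one. Markov's inequality then bounds the sum of the compensators by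
the realized costs plus 12 Vmax log(32/δ), with no variance term (`InMDP.measure_path_sum_ge_le`).
Realized costs are summed over visit counts. Episodes that raise some count by more than a quarter
are charged a constant, and each pair has only logarithmically many of them. The other visits
contribute ∑ₙ (18 min(c₁/n, c₂/√n) − gap)₊ up to constants, which is of order c₁ log(c₁/gap) or
c₂²/gap. -/

open scoped ENNReal

set_option linter.unusedSectionVars false

/-! ## Expectations along trajectories -/

namespace TabularMDP

section Trajectories

variable {S A : Type*} [Fintype S] {H : ℕ} (M : TabularMDP S A H)

/-- The path `x` with its coordinates up to step `h` replaced by `s`. -/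
def pin (h : ℕ) (s : S) (x : Fin H → S) : Fin H → S := fun j => if (j : ℕ) ≤ h then s else x j

theorem trajProb_nonneg (π : Policy S A H) (h : ℕ) (s : S) (x : Fin H → S) :
    0 ≤ M.trajProb π h s x := by
  unfold trajProb
  refine mul_nonneg (by split_ifs <;> norm_num) (Finset.prod_nonneg fun j _ => ?_)
  split_ifs
  · exact M.P_nonneg _ _ _
  · exact zero_le_one

theorem trajExp_of_le (π : Policy S A H) {h : ℕ} (hh : H ≤ h + 1) (s : S)
    (f : (Fin H → S) → ℝ) : M.trajExp π h s f = f fun _ => s := by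
  classical
  unfold trajExp
  rw [Finset.sum_eq_single (fun _ => s)]
  · have : M.trajProb π h s (fun _ => s) = 1 := by
      unfold trajProb
      rw [if_pos (fun _ _ => rfl), one_mul]
      refine Finset.prod_eq_one fun j _ => ?_
      rw [dif_neg]
      rintro ⟨h1, h2⟩
      omega
    rw [this, one_mul]
  · intro x _ hx
    have : M.trajProb π h s x = 0 := by
      unfold trajProb
      rw [if_neg, zero_mul]
      intro hall
      exact hx (funext fun j => hall j (by have := j.2; omega))
    rw [this, zero_mul]
  · intro hx
    exact absurd (Finset.mem_univ _) hx

/-- The path is re-pinned because a trajectory started at step h + 1 must carry its new initial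
state in all coordinates up to h + 1, while `x` still carries `s` in the earlier ones. -/
theorem trajProb_step (π : Policy S A H) {h : ℕ} (hh : h + 1 < H) (s : S) (x : Fin H → S)
    (hx : ∀ j : Fin H, (j : ℕ) ≤ h → x j = s) :
    M.trajProb π h s x =
      M.P s (π ⟨h, by omega⟩ s) (x ⟨h + 1, hh⟩) *
        M.trajProb π (h + 1) (x ⟨h + 1, hh⟩) (pin h (x ⟨h + 1, hh⟩) x) := by
  classical
  unfold trajProb
  rw [if_pos hx, if_pos, one_mul, one_mul]
  · have key : ∀ j : Fin H,
        (if hj : h ≤ (j : ℕ) ∧ (j : ℕ) + 1 < H then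
          M.P (x j) (π j (x j)) (x ⟨(j : ℕ) + 1, hj.2⟩) else 1) =
        (if j = ⟨h, by omega⟩ then M.P s (π ⟨h, by omega⟩ s) (x ⟨h + 1, hh⟩) else 1) *
        (if hj : h + 1 ≤ (j : ℕ) ∧ (j : ℕ) + 1 < H then
          M.P (pin h (x ⟨h + 1, hh⟩) x j) (π j (pin h (x ⟨h + 1, hh⟩) x j))
            (pin h (x ⟨h + 1, hh⟩) x ⟨(j : ℕ) + 1, hj.2⟩) else 1) := by
      intro j
      by_cases hjh : (j : ℕ) = h
      · obtain rfl : h = (j : ℕ) := hjh.symm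
        rw [dif_pos ⟨le_rfl, hh⟩, if_pos rfl, dif_neg (by simp), mul_one, hx _ le_rfl]
      · rw [if_neg (fun e => hjh (by rw [e])), one_mul]
        by_cases hj1 : h + 1 ≤ (j : ℕ) ∧ (j : ℕ) + 1 < H
        · rw [dif_pos ⟨by omega, hj1.2⟩, dif_pos hj1]
          have e1 : pin h (x ⟨h + 1, hh⟩) x j = x j := if_neg (by omega)
          have e2 : pin h (x ⟨h + 1, hh⟩) x ⟨(j : ℕ) + 1, hj1.2⟩ = x ⟨(j : ℕ) + 1, hj1.2⟩ :=
            if_neg (by simp only; omega)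
          rw [e1, e2]
        · rw [dif_neg hj1, dif_neg]
          omega
    rw [Finset.prod_congr rfl fun j _ => key j, Finset.prod_mul_distrib]
    congr 1
    rw [Finset.prod_ite_eq' Finset.univ, if_pos (Finset.mem_univ _)]
  · intro j hj
    unfold pin
    split_ifs with h1
    · rfl
    · have : j = ⟨h + 1, hh⟩ := Fin.ext (by simp only; omega)
      rw [this]

/-- One-step expansion of a trajectory expectation. -/
theorem trajExp_step (π : Policy S A H) {h : ℕ} (hh : h + 1 < H) (s : S)
    (f : (Fin H → S) → ℝ) :
    M.trajExp π h s f =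
      ∑ y, M.P s (π ⟨h, by omega⟩ s) y * M.trajExp π (h + 1) y fun x => f (pin h s x) := by
  classical
  unfold trajExp
  simp_rw [Finset.mul_sum]
  rw [← Finset.sum_product (Finset.univ : Finset S) (Finset.univ : Finset (Fin H → S))
    (fun p => M.P s (π ⟨h, by omega⟩ s) p.1 *
      (M.trajProb π (h + 1) p.1 p.2 * f (pin h s p.2)))]
  -- Both sums are restricted to their supports, the correctly pinned paths. There a path from step
  -- h corresponds to its next state together with a path from step h + 1, and re-pinning gives both
  -- directions.
  rw [← Finset.sum_filter_of_ne (p := fun x : Fin H → S => ∀ j : Fin H, (j : ℕ) ≤ h → x j = s)]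
  · rw [← Finset.sum_filter_of_ne (s := Finset.univ ×ˢ Finset.univ)
      (p := fun p : S × (Fin H → S) => ∀ j : Fin H, (j : ℕ) ≤ h + 1 → p.2 j = p.1)]
    · refine Finset.sum_nbij' (fun x => (x ⟨h + 1, hh⟩, pin h (x ⟨h + 1, hh⟩) x))
        (fun p => pin h s p.2) ?_ ?_ ?_ ?_ ?_
      · intro x _
        simp only [Finset.mem_filter, Finset.mem_product, Finset.mem_univ, true_and]
        intro j hj
        unfold pin
        split_ifs with h1
        · rfl
        · have : j = ⟨h + 1, hh⟩ := Fin.ext (by simp only; omega)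
          rw [this]
      · intro p _
        simp only [Finset.mem_filter, Finset.mem_univ, true_and]
        intro j hj
        exact if_pos hj
      · intro x hx
        simp only [Finset.mem_filter, Finset.mem_univ, true_and] at hx
        funext j
        simp only [pin]
        split_ifs with h1
        · exact (hx j h1).symm
        · rfl
      · rintro ⟨y, x⟩ hp
        simp only [Finset.mem_filter, Finset.mem_product, Finset.mem_univ, true_and] at hp
        have hy : pin h s x ⟨h + 1, hh⟩ = y := by
          rw [pin, if_neg (by simp)]
          exact hp _ le_rfl
        refine Prod.ext hy (funext fun j => ?_)
        change pin h (pin h s x ⟨h + 1, hh⟩) (pin h s x) j = x j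
        rw [hy, pin]
        split_ifs with h1
        · exact (hp j (by omega)).symm
        · exact if_neg h1
      · intro x hx
        simp only [Finset.mem_filter, Finset.mem_univ, true_and] at hx
        have hpin : pin h s (pin h (x ⟨h + 1, hh⟩) x) = x := by
          funext j
          simp only [pin]
          split_ifs with h1
          · exact (hx j h1).symm
          · rfl
        simp only [hpin]
        rw [M.trajProb_step π hh s x hx, mul_assoc]
    · rintro ⟨y, x⟩ _ hne
      by_contra hcon
      apply hne
      simp only
      unfold trajProb
      rw [if_neg hcon]
      ring
  · intro x _ hne
    by_contra hcon
    apply hne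
    unfold trajProb
    rw [if_neg hcon]
    ring

theorem trajExp_mono (π : Policy S A H) (h : ℕ) (s : S) {f g : (Fin H → S) → ℝ}
    (hfg : ∀ x, 0 < M.trajProb π h s x → f x ≤ g x) :
    M.trajExp π h s f ≤ M.trajExp π h s g := by
  refine Finset.sum_le_sum fun x _ => ?_
  rcases (M.trajProb_nonneg π h s x).eq_or_lt with h0 | h0
  · rw [← h0, zero_mul, zero_mul]
  · exact mul_le_mul_of_nonneg_left (hfg x h0) h0.le

theorem trajExp_add (π : Policy S A H) (h : ℕ) (s : S) (f g : (Fin H → S) → ℝ) :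
    M.trajExp π h s (fun x => f x + g x) = M.trajExp π h s f + M.trajExp π h s g := by
  simp only [trajExp, mul_add, Finset.sum_add_distrib]

theorem trajExp_sub (π : Policy S A H) (h : ℕ) (s : S) (f g : (Fin H → S) → ℝ) :
    M.trajExp π h s (fun x => f x - g x) = M.trajExp π h s f - M.trajExp π h s g := by
  simp only [trajExp, mul_sub, Finset.sum_sub_distrib]

theorem trajExp_const_mul (π : Policy S A H) (h : ℕ) (s : S) (c : ℝ) (f : (Fin H → S) → ℝ) :
    M.trajExp π h s (fun x => c * f x) = c * M.trajExp π h s f := by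
  simp only [trajExp, Finset.mul_sum]
  exact Finset.sum_congr rfl fun x _ => by ring

theorem trajExp_const (π : Policy S A H) (h : ℕ) (s : S) (c : ℝ) :
    M.trajExp π h s (fun _ => c) = c := by
  induction hn : H - h generalizing h s with
  | zero => rw [M.trajExp_of_le π (by omega)]
  | succ n ih =>
    by_cases hh : h + 1 < H
    · rw [M.trajExp_step π hh]
      simp only [ih (h + 1) _ (by omega), ← Finset.sum_mul, M.P_sum, one_mul]
    · rw [M.trajExp_of_le π (by omega)]

theorem trajExp_nonneg (π : Policy S A H) (h : ℕ) (s : S) {f : (Fin H → S) → ℝ}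
    (hf : ∀ x, 0 ≤ f x) : 0 ≤ M.trajExp π h s f :=
  Finset.sum_nonneg fun x _ => mul_nonneg (M.trajProb_nonneg π h s x) (hf x)

/-- A trajectory expectation depends only on the coordinates after the start, once those up to
the start are pinned. -/
theorem trajExp_congr (π : Policy S A H) (h : ℕ) (s : S) {f g : (Fin H → S) → ℝ}
    (hfg : ∀ x : Fin H → S, (∀ j : Fin H, (j : ℕ) ≤ h → x j = s) → f x = g x) :
    M.trajExp π h s f = M.trajExp π h s g := by
  classical
  refine Finset.sum_congr rfl fun x _ => ?_
  by_cases hx : ∀ j : Fin H, (j : ℕ) ≤ h → x j = s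
  · rw [hfg x hx]
  · unfold trajProb
    rw [if_neg hx]
    ring

/-! ### Cumulative sums -/

theorem cumulative_of_le (g : Fin H → S → A → ℝ) (π : Policy S A H) {h : ℕ} (hh : H ≤ h) (s : S) :
    M.cumulative g π h s = 0 := by
  unfold cumulative
  rw [M.trajExp_of_le π (by omega)]
  exact Finset.sum_eq_zero fun j _ => if_neg (by have := j.2; omega)

theorem cumulative_step (g : Fin H → S → A → ℝ) (π : Policy S A H) (h : Fin H) (s : S) :
    M.cumulative g π h s =
      g h s (π h s) + ∑ y, M.P s (π h s) y * M.cumulative g π (h + 1) y := by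
  by_cases hh : (h : ℕ) + 1 < H
  · unfold cumulative
    rw [M.trajExp_step π hh]
    have : ∀ y, (M.trajExp π ((h : ℕ) + 1) y fun x => ∑ j : Fin H, if (h : ℕ) ≤ (j : ℕ) then
        g j (pin (h : ℕ) s x j) (π j (pin (h : ℕ) s x j)) else 0) =
        g h s (π h s) + M.trajExp π ((h : ℕ) + 1) y fun x => ∑ j : Fin H,
          if (h : ℕ) + 1 ≤ (j : ℕ) then g j (x j) (π j (x j)) else 0 := by
      intro y
      rw [← M.trajExp_const π ((h : ℕ) + 1) y (g h s (π h s)), ← M.trajExp_add]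
      congr 1
      funext x
      rw [← Finset.add_sum_erase _ _ (Finset.mem_univ h),
        ← Finset.add_sum_erase (a := h) Finset.univ (fun j : Fin H => if (h : ℕ) + 1 ≤ (j : ℕ) then
          g j (x j) (π j (x j)) else 0) (Finset.mem_univ h)]
      simp only [le_refl, if_true, pin, add_le_iff_nonpos_right, nonpos_iff_eq_zero, one_ne_zero,
        if_false, zero_add]
      congr 1
      refine Finset.sum_congr rfl fun j hj => ?_
      have hne : (j : ℕ) ≠ h := fun e => (Finset.ne_of_mem_erase hj) (Fin.ext e)
      by_cases h1 : (h : ℕ) ≤ (j : ℕ)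
      · rw [if_pos h1, if_pos (show (h : ℕ) + 1 ≤ j by omega), if_neg (by omega)]
      · rw [if_neg h1, if_neg (by omega)]
    simp only [Fin.eta, this, mul_add, Finset.sum_add_distrib, ← Finset.sum_mul, M.P_sum, one_mul]
  · have hH : (h : ℕ) + 1 = H := by have := h.2; omega
    simp only [M.cumulative_of_le g π (show H ≤ (h : ℕ) + 1 by omega), mul_zero,
      Finset.sum_const_zero, add_zero]
    unfold cumulative
    rw [M.trajExp_of_le π (by omega), Finset.sum_eq_single h]
    · simp
    · intro j _ hj
      have hne : (j : ℕ) ≠ h := fun e => hj (Fin.ext e)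
      have := j.2
      rw [if_neg]
      omega
    · simp

theorem cumulative_nonneg {g : Fin H → S → A → ℝ} (hg : ∀ h s a, 0 ≤ g h s a)
    (π : Policy S A H) (h : ℕ) (s : S) : 0 ≤ M.cumulative g π h s :=
  M.trajExp_nonneg π h s fun x => Finset.sum_nonneg fun j _ => by
    split_ifs
    · exact hg _ _ _
    · exact le_rfl

theorem V_of_le (π : Policy S A H) {h : ℕ} (hh : H ≤ h) (s : S) : M.V π h s = 0 :=
  M.cumulative_of_le _ π hh s

theorem V_step (π : Policy S A H) (h : Fin H) (s : S) :
    M.V π h s = M.r s (π h s) + ∑ y, M.P s (π h s) y * M.V π (h + 1) y :=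
  M.cumulative_step _ π h s

theorem P_expect_mono (s : S) (a : A) {f g : S → ℝ} (hfg : ∀ y, 0 < M.P s a y → f y ≤ g y) :
    ∑ y, M.P s a y * f y ≤ ∑ y, M.P s a y * g y := by
  refine Finset.sum_le_sum fun y _ => ?_
  rcases (M.P_nonneg s a y).eq_or_lt with h0 | h0
  · rw [← h0, zero_mul, zero_mul]
  · exact mul_le_mul_of_nonneg_left (hfg y h0) h0.le

theorem P_expect_const (s : S) (a : A) (c : ℝ) : ∑ y, M.P s a y * c = c := by
  rw [← Finset.sum_mul, M.P_sum, one_mul]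

end Trajectories

/-! ### Optimal values -/

section Optimal

variable {S A : Type*} [Fintype S] [Fintype A] {H : ℕ} (M : TabularMDP S A H)

/-- Optimal value with `n` steps to go, by dynamic programming. -/
noncomputable def optToGo : ℕ → S → ℝ
  | 0, _ => 0
  | n + 1, s => ⨆ a : A, (M.r s a + ∑ y, M.P s a y * optToGo n y)

theorem V_le_Vstar (π : Policy S A H) (h : ℕ) (s : S) : M.V π h s ≤ M.Vstar h s :=
  le_ciSup (f := fun π => M.V π h s) (Set.finite_range _).bddAbove π

theorem V_le_optToGo (π : Policy S A H) (h : ℕ) (s : S) : M.V π h s ≤ M.optToGo (H - h) s := by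
  induction hn : H - h generalizing h s with
  | zero => rw [M.V_of_le π (by omega)]; exact le_rfl
  | succ n ih =>
    have hh : h < H := by omega
    rw [M.V_step π ⟨h, hh⟩ s]
    refine le_trans ?_ (le_ciSup (f := fun a : A => M.r s a + ∑ y, M.P s a y * M.optToGo n y)
      (Set.finite_range _).bddAbove (π ⟨h, hh⟩ s))
    gcongr
    · exact M.P_nonneg _ _ _
    · exact ih (h + 1) _ (by omega)

variable [Nonempty A]

/-- A policy that is greedy for the optimal values. -/
noncomputable def optPolicy : Policy S A H := fun h s =>
  (Finite.exists_max fun a : A => M.r s a + ∑ y, M.P s a y * M.optToGo (H - 1 - h) y).choose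

theorem V_optPolicy_eq (h : ℕ) (s : S) : M.V M.optPolicy h s = M.optToGo (H - h) s := by
  induction hn : H - h generalizing h s with
  | zero => rw [M.V_of_le _ (by omega)]; rfl
  | succ n ih =>
    have hh : h < H := by omega
    rw [M.V_step _ ⟨h, hh⟩ s]
    simp only [ih (h + 1) _ (show H - (h + 1) = n by omega)]
    have hspec := (Finite.exists_max fun a : A =>
      M.r s a + ∑ y, M.P s a y * M.optToGo (H - 1 - h) y).choose_spec
    have hn' : H - 1 - h = n := by omega
    refine le_antisymm (le_ciSup (f := fun a : A => M.r s a + ∑ y, M.P s a y * M.optToGo n y)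
      (Set.finite_range _).bddAbove _) (ciSup_le fun a => ?_)
    have := hspec a
    simp only [hn'] at this
    unfold optPolicy
    simp only [hn']
    exact this

theorem Vstar_eq (h : ℕ) (s : S) : M.Vstar h s = M.V M.optPolicy h s := by
  refine le_antisymm (ciSup_le fun π => ?_) (le_ciSup (f := fun π => M.V π h s)
    (Set.finite_range _).bddAbove M.optPolicy)
  rw [M.V_optPolicy_eq]
  exact M.V_le_optToGo π h s

theorem Vstar_of_le {h : ℕ} (hh : H ≤ h) (s : S) : M.Vstar h s = 0 := by
  rw [M.Vstar_eq, M.V_of_le _ hh]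

/-- A single policy, `optPolicy`, is optimal at all steps and states at once, so the maximum over
policies passes through the expectation over the next state. -/
theorem Qstar_eq (h : ℕ) (s : S) (a : A) :
    M.Qstar h s a = M.r s a + ∑ y, M.P s a y * M.Vstar (h + 1) y := by
  refine le_antisymm (ciSup_le fun π => ?_) ?_
  · unfold Q
    gcongr
    · exact M.P_nonneg _ _ _
    · exact M.V_le_Vstar π _ _
  · simp only [M.Vstar_eq]
    exact le_ciSup (f := fun π => M.Q π h s a) (Set.finite_range _).bddAbove M.optPolicy

theorem Vstar_eq_Qstar (h : Fin H) (s : S) : M.Vstar h s = M.Qstar h s (M.optPolicy h s) := by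
  rw [M.Vstar_eq, M.V_step, M.Qstar_eq]
  simp only [M.Vstar_eq]

theorem Qstar_le_Vstar (h : Fin H) (s : S) (a : A) : M.Qstar h s a ≤ M.Vstar h s := by
  rw [M.Qstar_eq, M.Vstar_eq, M.V_optPolicy_eq]
  obtain ⟨n, hn⟩ : ∃ n, H - h = n + 1 := ⟨H - h - 1, by have := h.2; omega⟩
  rw [hn]
  simp only [M.Vstar_eq, M.V_optPolicy_eq, show H - ((h : ℕ) + 1) = n by omega]
  exact le_ciSup (f := fun a : A => M.r s a + ∑ y, M.P s a y * M.optToGo n y)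
      (Set.finite_range _).bddAbove a

theorem gapAt_nonneg (h : Fin H) (s : S) (a : A) : 0 ≤ M.gapAt h s a :=
  sub_nonneg.2 (M.Qstar_le_Vstar h s a)

/-- Recursion for the regret to go of a policy. -/
theorem Vstar_sub_V_step (π : Policy S A H) (h : Fin H) (s : S) :
    M.Vstar h s - M.V π h s = M.gapAt h s (π h s) +
      ∑ y, M.P s (π h s) y * (M.Vstar (h + 1) y - M.V π (h + 1) y) := by
  simp only [gapAt, M.Qstar_eq, M.V_step π h s, mul_sub, Finset.sum_sub_distrib]
  ring

/-- The performance-difference identity, by unrolling `Vstar_sub_V_step`. It is what makes the gaps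
themselves a source of effective gaps. -/
theorem Vstar_sub_V_eq_cumulative (π : Policy S A H) (h : ℕ) (s : S) :
    M.Vstar h s - M.V π h s = M.cumulative (fun j => M.gapAt j) π h s := by
  induction hn : H - h generalizing h s with
  | zero => rw [M.V_of_le _ (by omega), M.Vstar_of_le (by omega), M.cumulative_of_le _ _ (by omega),
      sub_zero]
  | succ n ih =>
    have hh : h < H := by omega
    have e1 := M.Vstar_sub_V_step π ⟨h, hh⟩ s
    have e2 := M.cumulative_step (fun j => M.gapAt j) π ⟨h, hh⟩ s
    simp only at e1 e2
    rw [e1, e2]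
    simp only [ih (h + 1) _ (show H - (h + 1) = n by omega)]

end Optimal

end TabularMDP

/-! ## Conditional domination and Ville's inequality -/

section Domination

variable {Ω : Type*} {m mΩ : MeasurableSpace Ω} {μ : Measure Ω}

/-- The hypothesis compares the measures with densities Y and Z on the sub-σ-algebra `m`; an
`m`-measurable integrand sees nothing else. Working in `ℝ≥0∞` avoids integrability of the products,
which matters for the exponential supermartingales below. -/
theorem lintegral_mul_le_of_setLIntegral_le (hm : m ≤ mΩ) {Y Z : Ω → ℝ≥0∞} (hY : Measurable Y)
    (hZ : Measurable Z)
    (h : ∀ B, MeasurableSet[m] B → ∫⁻ ω in B, Y ω ∂μ ≤ ∫⁻ ω in B, Z ω ∂μ) {g : Ω → ℝ≥0∞}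
    (hg : Measurable[m] g) : ∫⁻ ω, g ω * Y ω ∂μ ≤ ∫⁻ ω, g ω * Z ω ∂μ := by
  have key : ∀ X : Ω → ℝ≥0∞, Measurable X →
      ∫⁻ ω, g ω * X ω ∂μ = ∫⁻ ω, g ω ∂((μ.withDensity X).trim hm) := by
    intro X hX
    rw [lintegral_trim hm hg, lintegral_withDensity_eq_lintegral_mul _ hX (hg.mono hm le_rfl)]
    simp only [Pi.mul_apply, mul_comm]
  rw [key Y hY, key Z hZ]
  refine lintegral_mono' (Measure.le_iff.2 fun B hB => ?_) le_rfl
  rw [trim_measurableSet_eq hm hB, trim_measurableSet_eq hm hB, withDensity_apply _ (hm _ hB),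
    withDensity_apply _ (hm _ hB)]
  exact h B hB

theorem setLIntegral_ofReal_eq_condExp (hm : m ≤ mΩ) [SigmaFinite (μ.trim hm)] {Y : Ω → ℝ}
    (hY : Integrable Y μ) (h0 : 0 ≤ Y) {B : Set Ω} (hB : MeasurableSet[m] B) :
    ∫⁻ ω in B, ENNReal.ofReal (Y ω) ∂μ = ∫⁻ ω in B, ENNReal.ofReal ((μ[Y | m]) ω) ∂μ := by
  rw [← ofReal_integral_eq_lintegral_ofReal hY.integrableOn (ae_of_all _ h0),
    ← ofReal_integral_eq_lintegral_ofReal integrable_condExp.integrableOn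
      (ae_restrict_of_ae (condExp_nonneg (ae_of_all _ h0))), setIntegral_condExp hm hY hB]

/-- Ville's inequality over a finite horizon. -/
theorem ville_inequality (𝒢 : Filtration ℕ mΩ) (Z : ℕ → Ω → ℝ≥0∞)
    (hZ : ∀ n, Measurable[𝒢 n] (Z n))
    (hsup : ∀ n B, MeasurableSet[𝒢 n] B → ∫⁻ ω in B, Z (n + 1) ω ∂μ ≤ ∫⁻ ω in B, Z n ω ∂μ)
    (h0 : ∫⁻ ω, Z 0 ω ∂μ ≤ 1) (c : ℝ≥0∞) (n : ℕ) :
    c * μ {ω | ∃ k < n, c ≤ Z k ω} ≤ 1 := by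
  -- The induction follows the stopped process: mass not yet stopped, plus `c` times the probability
  -- of having been stopped. On first reaching the level, at least `c` per unit of probability
  -- leaves the first term and exactly `c` enters the second.
  suffices h : ∫⁻ ω in {ω | ∃ k < n, c ≤ Z k ω}ᶜ, Z n ω ∂μ + c * μ {ω | ∃ k < n, c ≤ Z k ω} ≤ 1 from
    le_trans le_add_self h
  have hmeas : ∀ n k, k ≤ n → MeasurableSet[𝒢 n] {ω | c ≤ Z k ω} := fun n k hk =>
    (𝒢.mono hk) _ (measurableSet_le measurable_const (hZ k))
  have hhit : ∀ n, MeasurableSet[𝒢 n] {ω | ∃ k < n + 1, c ≤ Z k ω} := by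
    intro n
    have : {ω | ∃ k < n + 1, c ≤ Z k ω} = ⋃ k ∈ Finset.range (n + 1), {ω | c ≤ Z k ω} := by
      ext ω; simp
    rw [this]
    exact Finset.measurableSet_biUnion _ fun k hk => hmeas n k (by simp at hk; omega)
  induction n with
  | zero => simpa using h0
  | succ n ih =>
    have hA := hhit n
    have hA' := (𝒢.le n) _ hA
    have hD : MeasurableSet ({ω | c ≤ Z n ω} \ {ω | ∃ k < n, c ≤ Z k ω}) := by
      refine ((𝒢.le n) _ (hmeas n n le_rfl)).diff ?_
      rcases n with _ | n
      · simp
      · exact (𝒢.le n) _ (hhit n)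
    have hset : {ω | ∃ k < n + 1, c ≤ Z k ω} =
        {ω | ∃ k < n, c ≤ Z k ω} ∪ ({ω | c ≤ Z n ω} \ {ω | ∃ k < n, c ≤ Z k ω}) := by
      ext ω
      simp only [Set.union_sdiff_self, Set.mem_union, Set.mem_ofPred_eq]
      constructor
      · rintro ⟨k, hk, h⟩
        rcases Nat.lt_succ_iff_lt_or_eq.1 hk with h' | rfl
        · exact Or.inl ⟨k, h', h⟩
        · exact Or.inr h
      · rintro (⟨k, hk, h⟩ | h)
        · exact ⟨k, by omega, h⟩
        · exact ⟨n, by omega, h⟩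
    have hcompl : {ω | ∃ k < n, c ≤ Z k ω}ᶜ =
        {ω | ∃ k < n + 1, c ≤ Z k ω}ᶜ ∪ ({ω | c ≤ Z n ω} \ {ω | ∃ k < n, c ≤ Z k ω}) := by
      rw [hset]; ext ω
      simp only [Set.mem_compl_iff, Set.mem_union, Set.mem_sdiff]
      tauto
    have hdis : Disjoint {ω | ∃ k < n + 1, c ≤ Z k ω}ᶜ
        ({ω | c ≤ Z n ω} \ {ω | ∃ k < n, c ≤ Z k ω}) := by
      rw [hset, Set.disjoint_left]
      intro ω h1 h2
      exact h1 (Or.inr h2)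
    rw [hcompl, lintegral_union hD hdis] at ih
    calc ∫⁻ ω in {ω | ∃ k < n + 1, c ≤ Z k ω}ᶜ, Z (n + 1) ω ∂μ
          + c * μ {ω | ∃ k < n + 1, c ≤ Z k ω}
        ≤ ∫⁻ ω in {ω | ∃ k < n + 1, c ≤ Z k ω}ᶜ, Z n ω ∂μ +
          c * (μ {ω | ∃ k < n, c ≤ Z k ω} + μ ({ω | c ≤ Z n ω} \ {ω | ∃ k < n, c ≤ Z k ω})) := by
          refine add_le_add (hsup n _ hA.compl) (mul_le_mul_right ?_ c)
          conv_lhs => rw [hset]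
          exact measure_union_le _ _
      _ ≤ ∫⁻ ω in {ω | ∃ k < n + 1, c ≤ Z k ω}ᶜ, Z n ω ∂μ +
          (c * μ {ω | ∃ k < n, c ≤ Z k ω} +
            ∫⁻ ω in ({ω | c ≤ Z n ω} \ {ω | ∃ k < n, c ≤ Z k ω}), Z n ω ∂μ) := by
          rw [mul_add]
          gcongr
          calc c * μ ({ω | c ≤ Z n ω} \ {ω | ∃ k < n, c ≤ Z k ω})
              = ∫⁻ _ in ({ω | c ≤ Z n ω} \ {ω | ∃ k < n, c ≤ Z k ω}), c ∂μ := by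
                rw [setLIntegral_const]
            _ ≤ _ := setLIntegral_mono' hD fun ω hω => hω.1
      _ ≤ 1 := by
          rw [add_comm (c * _), ← add_assoc]
          exact ih

end Domination

/-! ## Measurability and conditional laws in an interaction -/

namespace Interaction

section Laws

variable {S A : Type*} [Fintype S] {H : ℕ} {Ω : Type*} [mΩ : MeasurableSpace Ω]
  {I : Interaction S A H Ω} {M : TabularMDP S A H} {Sinit : Set S} {μ : Measure Ω}
  {ℱ : Filtration (ℕ ×ₗ ℕ) mΩ}

theorem filtration_mono_of_lt (ℱ : Filtration (ℕ ×ₗ ℕ) mΩ) {i k : ℕ} (h : i < k) (n l : ℕ) :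
    ℱ (toLex (i, n)) ≤ ℱ (toLex (k, l)) :=
  ℱ.mono (Prod.Lex.toLex_le_toLex.2 (Or.inl h))

theorem filtration_mono_of_le (ℱ : Filtration (ℕ ×ₗ ℕ) mΩ) (k : ℕ) {n l : ℕ} (h : n ≤ l) :
    ℱ (toLex (k, n)) ≤ ℱ (toLex (k, l)) :=
  ℱ.mono (Prod.Lex.toLex_le_toLex.2 (Or.inr ⟨rfl, h⟩))

namespace InMDP

theorem measurable_s (hI : I.InMDP M Sinit μ ℱ) [MeasurableSpace S]
    [DiscreteMeasurableSpace S] {k : ℕ} (hk : 1 ≤ k) {h : ℕ} (hh : h ≤ H) : Measurable[ℱ (toLex (k, h + 1))] (I.s k h) :=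
  @measurable_to_countable' S Ω _ _ (ℱ (toLex (k, h + 1))) _ fun x => hI.s_meas k hk h hh x

theorem measurable_pol (hI : I.InMDP M Sinit μ ℱ) [Fintype A] [MeasurableSpace A]
    [DiscreteMeasurableSpace A] {k : ℕ} (hk : 1 ≤ k) : Measurable[ℱ (toLex (k, 0))] (I.pol k) :=
  @measurable_pi_lambda _ _ _ (ℱ (toLex (k, 0))) _ _ fun h =>
    @measurable_pi_lambda _ _ _ (ℱ (toLex (k, 0))) _ _ fun x =>
    @measurable_to_countable' A Ω _ _ (ℱ (toLex (k, 0))) _ fun b => hI.pol_meas k hk h x b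

theorem measurableSet_visit (hI : I.InMDP M Sinit μ ℱ) {k : ℕ} (hk : 1 ≤ k)
    (h : Fin H) (x : S) (b : A) :
    MeasurableSet[ℱ (toLex (k, (h : ℕ) + 1))] {ω | I.s k h ω = x ∧ I.a k h ω = b} := by
  have : {ω | I.s k h ω = x ∧ I.a k h ω = b} =
      {ω | I.s k h ω = x} ∩ {ω | I.pol k ω h x = b} := by
    ext ω
    simp only [Set.mem_ofPred_eq, Set.mem_inter_iff, Interaction.a]
    constructor
    · rintro ⟨h1, h2⟩; exact ⟨h1, by rwa [h1] at h2⟩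
    · rintro ⟨h1, h2⟩; exact ⟨h1, by rwa [h1]⟩
  rw [this]
  exact (hI.s_meas k hk h h.2.le x).inter
    (filtration_mono_of_le ℱ k (Nat.zero_le _) _ (hI.pol_meas k hk h x b))

theorem measurable_N (hI : I.InMDP M Sinit μ ℱ) {k : ℕ} (x : S) (b : A) :
    Measurable[ℱ (toLex (k, 0))] fun ω => I.N k ω x b := by
  classical
  unfold N
  refine Finset.measurable_sum _ fun i hi => Finset.measurable_sum _ fun h _ => ?_
  rw [Finset.mem_Ico] at hi
  refine Measurable.ite ?_ measurable_const measurable_const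
  exact filtration_mono_of_lt ℱ hi.2 _ _ _ (hI.measurableSet_visit hi.1 h x b)

/-- The transition law in a form that allows integrands depending on the past. For indicators of the
next state it is the conditional expectation in `InMDP`; the domination lemma, applied in both
directions, inserts the factor known at the current step. -/
theorem lintegral_mul_transition (hI : I.InMDP M Sinit μ ℱ) [Finite A]
    [IsFiniteMeasure μ] {k : ℕ} (hk : 1 ≤ k) (h : Fin H) (G : S → Ω → ℝ≥0∞) (hG : ∀ y, Measurable[ℱ (toLex (k, (h : ℕ) + 1))] (G y)) :
    ∫⁻ ω, G (I.s k (h + 1) ω) ω ∂μ =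
      ∫⁻ ω, ∑ y, G y ω * ENNReal.ofReal (M.P (I.s k h ω) (I.a k h ω) y) ∂μ := by
  classical
  have := Fintype.ofFinite A
  let _ : MeasurableSpace S := ⊤
  let _ : MeasurableSpace A := ⊤
  have hle := ℱ.le (toLex (k, (h : ℕ) + 1))
  have hGm : ∀ y, Measurable (G y) := fun y => (hG y).mono hle le_rfl
  have hsy : ∀ y, MeasurableSet {ω | I.s k (h + 1) ω = y} := fun y =>
    ℱ.le _ _ (hI.s_meas k hk (h + 1) h.2 y)
  have hPm : ∀ y, Measurable fun ω => ENNReal.ofReal (M.P (I.s k h ω) (I.a k h ω) y) := by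
    intro y
    have h1 : Measurable (I.s k h) := (hI.measurable_s hk h.2.le).mono (ℱ.le _) le_rfl
    have h2 : Measurable (I.pol k) := (hI.measurable_pol hk).mono (ℱ.le _) le_rfl
    exact (Measurable.of_discrete (f := fun p : S × Policy S A H =>
      ENNReal.ofReal (M.P p.1 (p.2 h p.1) y))).comp (h1.prodMk h2)
  have e1 : ∀ ω, G (I.s k (h + 1) ω) ω = ∑ y, G y ω *
      ENNReal.ofReal ({ω | I.s k (h + 1) ω = y}.indicator (fun _ => (1 : ℝ)) ω) := by
    intro ω
    rw [Finset.sum_eq_single (I.s k (h + 1) ω)]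
    · simp
    · intro y _ hy
      rw [Set.indicator_of_notMem (by simpa using hy.symm)]
      simp
    · simp
  have hind : ∀ y, Measurable fun ω =>
      ENNReal.ofReal ({ω | I.s k (h + 1) ω = y}.indicator (fun _ => (1 : ℝ)) ω) := fun y =>
    (measurable_const.indicator (hsy y)).ennreal_ofReal
  simp_rw [e1]
  rw [lintegral_finsetSum Finset.univ
      (f := fun y ω => G y ω *
        ENNReal.ofReal ({ω | I.s k (h + 1) ω = y}.indicator (fun _ => (1 : ℝ)) ω))
      fun y _ => (hGm y).mul (hind y),
    lintegral_finsetSum Finset.univ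
      (f := fun y ω => G y ω * ENNReal.ofReal (M.P (I.s k h ω) (I.a k h ω) y))
      fun y _ => (hGm y).mul (hPm y)]
  refine Finset.sum_congr rfl fun y _ => ?_
  have key : ∀ B, MeasurableSet[ℱ (toLex (k, (h : ℕ) + 1))] B →
      ∫⁻ ω in B, ENNReal.ofReal ({ω | I.s k (h + 1) ω = y}.indicator (fun _ => (1 : ℝ)) ω) ∂μ =
      ∫⁻ ω in B, ENNReal.ofReal (M.P (I.s k h ω) (I.a k h ω) y) ∂μ := by
    intro B hB
    rw [setLIntegral_ofReal_eq_condExp hle ((integrable_const (1 : ℝ)).indicator (hsy y))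
      (fun ω => Set.indicator_nonneg (fun _ _ => zero_le_one) ω) hB]
    refine setLIntegral_congr_fun_ae (hle _ hB) ?_
    filter_upwards [hI.transition k hk h y] with ω hω _
    rw [hω]
  exact le_antisymm
    (lintegral_mul_le_of_setLIntegral_le hle (hind y) (hPm y) (fun B hB => (key B hB).le) (hG y))
    (lintegral_mul_le_of_setLIntegral_le hle (hPm y) (hind y) (fun B hB => (key B hB).ge) (hG y))

end InMDP

open Classical in
/-- Sum of `Y i h` over the visits of `(x, b)` before episode `k`. -/
noncomputable def visitSum (I : Interaction S A H Ω) (x : S) (b : A) (Y : ℕ → Fin H → Ω → ℝ)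
    (k : ℕ) (ω : Ω) : ℝ :=
  ∑ i ∈ Finset.Ico 1 k, ∑ h : Fin H, if I.s i h ω = x ∧ I.a i h ω = b then Y i h ω else 0

/-- Time-uniform exponential deviation bound for sums over the visits of a state-action pair. -/
theorem InMDP.measure_visitSum_ge_le [IsProbabilityMeasure μ] (hI : I.InMDP M Sinit μ ℱ)
    (x : S) (b : A)
    (Y : ℕ → Fin H → Ω → ℝ) (ν l : ℝ)
    (hYm : ∀ k, 1 ≤ k → ∀ h : Fin H, Measurable[ℱ (toLex (k, (h : ℕ) + 2))] (Y k h))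
    (hY : ∀ k, 1 ≤ k → ∀ h : Fin H, ∀ B, MeasurableSet[ℱ (toLex (k, (h : ℕ) + 1))] B →
      (∀ ω ∈ B, I.s k h ω = x ∧ I.a k h ω = b) →
      ∫⁻ ω in B, ENNReal.ofReal (Real.exp (Y k h ω)) ∂μ ≤ ENNReal.ofReal (Real.exp ν) * μ B)
    (K : ℕ) :
    μ {ω | ∃ k, 1 ≤ k ∧ k ≤ K ∧ ν * I.N k ω x b + l ≤ I.visitSum x b Y k ω} ≤
      ENNReal.ofReal (Real.exp (-l)) := by
  classical
  -- One multiplicative increment per step, equal to 1 unless the pair is visited. Visits thus need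
  -- no enumeration by stopping times.
  let X : ℕ → Fin H → Ω → ℝ≥0∞ := fun k h ω =>
    if I.s k h ω = x ∧ I.a k h ω = b then ENNReal.ofReal (Real.exp (Y k h ω - ν)) else 1
  have hXm : ∀ k, 1 ≤ k → ∀ h : Fin H, Measurable[ℱ (toLex (k, (h : ℕ) + 2))] (X k h) := by
    intro k hk h
    refine Measurable.ite (filtration_mono_of_le ℱ k (Nat.le_succ _) _
      (hI.measurableSet_visit hk h x b)) ?_ measurable_const
    exact (Real.measurable_exp.comp ((hYm k hk h).sub_const ν)).ennreal_ofReal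
  have hX : ∀ k, 1 ≤ k → ∀ h : Fin H, ∀ B, MeasurableSet[ℱ (toLex (k, (h : ℕ) + 1))] B →
      ∫⁻ ω in B, X k h ω ∂μ ≤ μ B := by
    intro k hk h B hB
    have hV := hI.measurableSet_visit hk h x b
    have hle := ℱ.le (toLex (k, (h : ℕ) + 1))
    rw [← lintegral_inter_add_sdiff _ B (hle _ hV), ← measure_inter_add_sdiff B (hle _ hV)]
    refine add_le_add ?_ ?_
    · have : ∫⁻ ω in B ∩ {ω | I.s k h ω = x ∧ I.a k h ω = b}, X k h ω ∂μ =
          ENNReal.ofReal (Real.exp (-ν)) *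
            ∫⁻ ω in B ∩ {ω | I.s k h ω = x ∧ I.a k h ω = b}, ENNReal.ofReal (Real.exp (Y k h ω)) ∂μ := by
        rw [← lintegral_const_mul' _ _ ENNReal.ofReal_ne_top]
        refine setLIntegral_congr_fun (hle _ (hB.inter hV)) fun ω hω => ?_
        simp only [X]
        rw [if_pos (show I.s k h ω = x ∧ I.a k h ω = b from hω.2), sub_eq_add_neg, Real.exp_add, ENNReal.ofReal_mul (Real.exp_nonneg _),
          mul_comm]
      rw [this]
      calc _ ≤ ENNReal.ofReal (Real.exp (-ν)) * (ENNReal.ofReal (Real.exp ν) *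
            μ (B ∩ {ω | I.s k h ω = x ∧ I.a k h ω = b})) := by
              gcongr
              exact hY k hk h _ (hB.inter hV) fun ω hω => hω.2
        _ = _ := by
              rw [← mul_assoc, ← ENNReal.ofReal_mul (Real.exp_nonneg _), ← Real.exp_add]
              simp
    · have : ∫⁻ ω in B \ {ω | I.s k h ω = x ∧ I.a k h ω = b}, X k h ω ∂μ =
          ∫⁻ _ in B \ {ω | I.s k h ω = x ∧ I.a k h ω = b}, 1 ∂μ :=
        setLIntegral_congr_fun (hle _ (hB.diff hV)) fun ω hω => if_neg hω.2
      rw [this, setLIntegral_one]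
  -- The supermartingale is indexed by completed episodes, since counts are only read at episode
  -- boundaries; `hstep` removes the factors within an episode from the last step backwards.
  let Z : ℕ → Ω → ℝ≥0∞ := fun n ω => ∏ i ∈ Finset.Ico 1 (n + 1), ∏ h : Fin H, X i h ω
  let 𝒢 : Filtration ℕ mΩ := ⟨fun n => ℱ (toLex (n + 1, 0)), fun i j hij => by
    rcases hij.eq_or_lt with rfl | h
    · exact le_rfl
    · exact filtration_mono_of_lt ℱ (by omega) _ _, fun n => ℱ.le _⟩
  have hZm : ∀ n, Measurable[𝒢 n] (Z n) := by
    intro n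
    refine Finset.measurable_fun_prod _ fun i hi => Finset.measurable_fun_prod _ fun h _ => ?_
    rw [Finset.mem_Ico] at hi
    exact (hXm i hi.1 h).mono (filtration_mono_of_lt ℱ hi.2 _ _) le_rfl
  have hstep : ∀ k, 1 ≤ k → ∀ g : Ω → ℝ≥0∞, Measurable[ℱ (toLex (k, 0))] g → ∀ n ≤ H,
      ∫⁻ ω, g ω * ∏ h ∈ Finset.univ.filter (fun h : Fin H => (h : ℕ) < n), X k h ω ∂μ ≤
        ∫⁻ ω, g ω ∂μ := by
    intro k hk g hg n
    induction n with
    | zero => intro _; simp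
    | succ n ih =>
      intro hn
      have hset : Finset.univ.filter (fun h : Fin H => (h : ℕ) < n + 1) =
          insert ⟨n, by omega⟩ (Finset.univ.filter (fun h : Fin H => (h : ℕ) < n)) := by
        ext h
        simp only [Finset.mem_filter, Finset.mem_univ, true_and, Finset.mem_insert, Fin.ext_iff]
        omega
      refine le_trans ?_ (ih (by omega))
      have hle := ℱ.le (toLex (k, n + 1))
      have h1 := lintegral_mul_le_of_setLIntegral_le (μ := μ) (m := ℱ (toLex (k, n + 1))) hle
        (Y := X k ⟨n, by omega⟩) (Z := fun _ => 1)
        ((hXm k hk ⟨n, by omega⟩).mono (ℱ.le _) le_rfl) measurable_const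
        (fun B hB => by simpa using hX k hk ⟨n, by omega⟩ B hB)
        (g := fun ω => g ω * ∏ h ∈ Finset.univ.filter (fun h : Fin H => (h : ℕ) < n), X k h ω)
        ((hg.mono (filtration_mono_of_le ℱ k (Nat.zero_le _)) le_rfl).mul
          (Finset.measurable_fun_prod _ fun h hh => (hXm k hk h).mono
            (filtration_mono_of_le ℱ k (by simp at hh; omega)) le_rfl))
      rw [hset]
      simp only [mul_one] at h1
      refine le_trans (le_of_eq (lintegral_congr fun ω => ?_)) h1
      rw [Finset.prod_insert (by simp)]
      ring
  have hsup : ∀ n B, MeasurableSet[𝒢 n] B → ∫⁻ ω in B, Z (n + 1) ω ∂μ ≤ ∫⁻ ω in B, Z n ω ∂μ := by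
    intro n B hB
    have h1 := hstep (n + 1) (by omega) (B.indicator (Z n)) ((hZm n).indicator hB) H le_rfl
    rw [lintegral_indicator ((𝒢.le n) _ hB)] at h1
    refine le_trans (le_of_eq ?_) h1
    rw [← lintegral_indicator ((𝒢.le n) _ hB)]
    refine lintegral_congr fun ω => ?_
    by_cases hω : ω ∈ B
    · rw [Set.indicator_of_mem hω, Set.indicator_of_mem hω]
      simp only [Z]
      rw [Finset.prod_Ico_succ_top (by omega)]
      simp
    · rw [Set.indicator_of_notMem hω, Set.indicator_of_notMem hω, zero_mul]
  have hv := ville_inequality 𝒢 Z hZm hsup (by simp [Z]) (ENNReal.ofReal (Real.exp l)) K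
  have hZ : ∀ n ω, Z n ω =
      ENNReal.ofReal (Real.exp (I.visitSum x b Y (n + 1) ω - ν * I.N (n + 1) ω x b)) := by
    intro n ω
    have hN : I.visitSum x b Y (n + 1) ω - ν * I.N (n + 1) ω x b =
        ∑ i ∈ Finset.Ico 1 (n + 1), ∑ h : Fin H,
          if I.s i h ω = x ∧ I.a i h ω = b then Y i h ω - ν else 0 := by
      unfold visitSum N
      push_cast
      rw [Finset.mul_sum, ← Finset.sum_sub_distrib]
      refine Finset.sum_congr rfl fun i _ => ?_
      rw [Finset.mul_sum, ← Finset.sum_sub_distrib]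
      refine Finset.sum_congr rfl fun h _ => ?_
      split_ifs <;> simp
    rw [hN, Real.exp_sum, ENNReal.ofReal_prod_of_nonneg fun _ _ => Real.exp_nonneg _]
    refine Finset.prod_congr rfl fun i _ => ?_
    rw [Real.exp_sum, ENNReal.ofReal_prod_of_nonneg fun _ _ => Real.exp_nonneg _]
    refine Finset.prod_congr rfl fun h _ => ?_
    simp only [X]
    split_ifs <;> simp
  calc μ {ω | ∃ k, 1 ≤ k ∧ k ≤ K ∧ ν * I.N k ω x b + l ≤ I.visitSum x b Y k ω}
      ≤ μ {ω | ∃ k < K, ENNReal.ofReal (Real.exp l) ≤ Z k ω} := by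
        refine measure_mono ?_
        rintro ω ⟨k, hk1, hk2, h⟩
        -- The count `N k` covers the episodes before `k`, which are the factors of `Z (k - 1)`.
        refine ⟨k - 1, by omega, ?_⟩
        rw [hZ, show k - 1 + 1 = k by omega]
        exact ENNReal.ofReal_le_ofReal (Real.exp_le_exp.2 (by linarith))
    _ = ENNReal.ofReal (Real.exp (-l)) * (ENNReal.ofReal (Real.exp l) *
          μ {ω | ∃ k < K, ENNReal.ofReal (Real.exp l) ≤ Z k ω}) := by
        rw [← mul_assoc, ← ENNReal.ofReal_mul (Real.exp_nonneg _), ← Real.exp_add]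
        simp
    _ ≤ ENNReal.ofReal (Real.exp (-l)) * 1 := by gcongr
    _ = _ := mul_one _

end Laws

end Interaction

/-! ## Deviations of the empirical model -/

namespace Interaction

section Deviations

variable {S A : Type*} [Fintype S] {H : ℕ} {Ω : Type*} (I : Interaction S A H Ω)

/-- Turns the sum controlled by the supermartingale into the visit count times the error of the
empirical backup. -/
theorem visitSum_affine (x : S) (b : A) (k : ℕ) (ω : Ω) (hN : 0 < I.N k ω x b) (t : ℝ) (f : S → ℝ)
    (q : S → A → ℝ) :
    I.visitSum x b (fun i h ω => t * (I.R i h ω + f (I.s i (h + 1) ω)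
        - q (I.s i h ω) (I.a i h ω))) k ω =
      t * (I.N k ω x b * (I.rHat k ω x b + ∑ y, I.PHat k ω x b y * f y - q x b)) := by
  classical
  have hN' : (I.N k ω x b : ℝ) ≠ 0 := by positivity
  have h1 : (I.N k ω x b : ℝ) * (I.rHat k ω x b + ∑ y, I.PHat k ω x b y * f y - q x b) =
      (∑ i ∈ Finset.Ico 1 k, ∑ h : Fin H,
        if I.s i h ω = x ∧ I.a i h ω = b then I.R i h ω else 0) +
      ∑ y, (∑ i ∈ Finset.Ico 1 k, ∑ h : Fin H,
        if I.s i h ω = x ∧ I.a i h ω = b ∧ I.s i (h + 1) ω = y then (1 : ℝ) else 0) * f y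
      - (I.N k ω x b : ℝ) * q x b := by
    unfold rHat PHat
    rw [mul_sub, mul_add, mul_div_cancel₀ _ hN', Finset.mul_sum]
    congr 2
    refine Finset.sum_congr rfl fun y _ => ?_
    field_simp
  rw [h1]
  unfold visitSum N
  push_cast
  simp only [Finset.sum_mul]
  rw [Finset.sum_comm (s := (Finset.univ : Finset S)), ← Finset.sum_add_distrib,
    ← Finset.sum_sub_distrib, Finset.mul_sum]
  refine Finset.sum_congr rfl fun i _ => ?_
  rw [Finset.sum_comm (s := (Finset.univ : Finset S)), ← Finset.sum_add_distrib,
    ← Finset.sum_sub_distrib, Finset.mul_sum]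
  refine Finset.sum_congr rfl fun h _ => ?_
  by_cases hv : I.s i h ω = x ∧ I.a i h ω = b
  · rw [if_pos hv, if_pos hv, if_pos hv, hv.1, hv.2]
    congr 1
    rw [Finset.sum_eq_single (I.s i (h + 1) ω)]
    · simp
    · intro y _ hy
      rw [if_neg fun hc => hy hc.2.2.symm, zero_mul]
    · simp
  · rw [if_neg hv, if_neg hv, if_neg hv]
    have : ∀ y, (if I.s i h ω = x ∧ I.a i h ω = b ∧ I.s i (h + 1) ω = y then (1 : ℝ) else 0) * f y
        = 0 := fun y => by rw [if_neg fun hc => hv ⟨hc.1, hc.2.1⟩, zero_mul]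
    simp [this]

theorem visitSum_next (x : S) (b : A) (k : ℕ) (ω : Ω) (hN : 0 < I.N k ω x b) (f : S → ℝ) :
    I.visitSum x b (fun i h ω => f (I.s i (h + 1) ω)) k ω =
      I.N k ω x b * ∑ y, I.PHat k ω x b y * f y := by
  classical
  have hN' : (I.N k ω x b : ℝ) ≠ 0 := by positivity
  have h1 : (I.N k ω x b : ℝ) * ∑ y, I.PHat k ω x b y * f y =
      ∑ y, (∑ i ∈ Finset.Ico 1 k, ∑ h : Fin H,
        if I.s i h ω = x ∧ I.a i h ω = b ∧ I.s i (h + 1) ω = y then (1 : ℝ) else 0) * f y := by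
    unfold PHat
    rw [Finset.mul_sum]
    refine Finset.sum_congr rfl fun y _ => ?_
    field_simp
  rw [h1]
  unfold visitSum
  simp only [Finset.sum_mul]
  rw [Finset.sum_comm (s := (Finset.univ : Finset S))]
  refine Finset.sum_congr rfl fun i _ => ?_
  rw [Finset.sum_comm (s := (Finset.univ : Finset S))]
  refine Finset.sum_congr rfl fun h _ => ?_
  by_cases hv : I.s i h ω = x ∧ I.a i h ω = b
  · rw [if_pos hv, Finset.sum_eq_single (I.s i (h + 1) ω)]
    · simp [hv.1, hv.2]
    · intro y _ hy
      rw [if_neg fun hc => hy hc.2.2.symm, zero_mul]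
    · simp
  · rw [if_neg hv]
    exact (Finset.sum_eq_zero fun y _ => by
      rw [if_neg fun hc => hv ⟨hc.1, hc.2.1⟩, zero_mul]).symm

theorem PHat_nonneg (k : ℕ) (ω : Ω) (x : S) (b : A) (y : S) : 0 ≤ I.PHat k ω x b y := by
  unfold PHat
  refine div_nonneg (Finset.sum_nonneg fun i _ => Finset.sum_nonneg fun h _ => ?_)
    (Nat.cast_nonneg _)
  split_ifs <;> norm_num

theorem PHat_sum {k : ℕ} {ω : Ω} {x : S} {b : A} (hN : 0 < I.N k ω x b) :
    ∑ y, I.PHat k ω x b y = 1 := by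
  classical
  have h1 := I.visitSum_next x b k ω hN fun _ => 1
  have h2 : I.visitSum x b (fun _ _ _ => 1) k ω = I.N k ω x b := by
    unfold visitSum N
    push_cast
    rfl
  rw [h2] at h1
  simp only [mul_one] at h1
  have hN' : (I.N k ω x b : ℝ) ≠ 0 := by positivity
  exact (mul_left_cancel₀ hN' (by rw [mul_one]; exact h1)).symm

variable {I} [mΩ : MeasurableSpace Ω] [Fintype A] {M : TabularMDP S A H}
  {Sinit : Set S} {μ : Measure Ω} [IsProbabilityMeasure μ] {ℱ : Filtration (ℕ ×ₗ ℕ) mΩ}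

theorem InMDP.measure_backup_deviation_le (hI : I.InMDP M Sinit μ ℱ)
    {sig : Fin H → S → A → ℝ} {Valpha : ℝ} (hsub : I.SubExp M μ ℱ sig Valpha) (j : Fin H)
    (x : S) (b : A) {t : ℝ} (ht : |t| * Valpha ≤ 1) (l : ℝ) (K : ℕ) :
    μ {ω | ∃ k, 1 ≤ k ∧ k ≤ K ∧ 0 < I.N k ω x b ∧
        sig j x b ^ 2 * t ^ 2 / 2 * I.N k ω x b + l ≤ t * (I.N k ω x b *
          (I.rHat k ω x b + ∑ y, I.PHat k ω x b y * M.Vstar (j + 1) y - M.Qstar j x b))} ≤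
      ENNReal.ofReal (Real.exp (-l)) := by
  let _ : MeasurableSpace S := ⊤
  let _ : MeasurableSpace A := ⊤
  refine le_trans (measure_mono ?_) (hI.measure_visitSum_ge_le x b
    (fun i h ω => t * (I.R i h ω + M.Vstar (j + 1) (I.s i (h + 1) ω)
        - M.Qstar j (I.s i h ω) (I.a i h ω))) (sig j x b ^ 2 * t ^ 2 / 2) l ?_ ?_ K)
  · rintro ω ⟨k, h1, h2, hN, h3⟩
    exact ⟨k, h1, h2, by rwa [I.visitSum_affine x b k ω hN]⟩
  · intro k hk h
    have e1 := hI.R_meas k hk h h.2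
    have e2 : Measurable[ℱ (toLex (k, (h : ℕ) + 2))] fun ω => M.Vstar (j + 1) (I.s k (h + 1) ω) :=
      (Measurable.of_discrete (f := M.Vstar (j + 1))).comp (hI.measurable_s hk h.2)
    have e3 : Measurable[ℱ (toLex (k, (h : ℕ) + 2))] fun ω =>
        M.Qstar j (I.s k h ω) (I.a k h ω) :=
      (Measurable.of_discrete (f := fun p : S × Policy S A H => M.Qstar j p.1 (p.2 h p.1))).comp
        (((hI.measurable_s hk h.2.le).mono (filtration_mono_of_le ℱ k (by omega)) le_rfl).prodMk
          ((hI.measurable_pol hk).mono (filtration_mono_of_le ℱ k (by omega)) le_rfl))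
    exact ((e1.add e2).sub e3).const_mul t
  · intro k hk h B hB hBv
    obtain ⟨hint, hle⟩ := hsub k hk h j t ht
    rw [setLIntegral_ofReal_eq_condExp (ℱ.le _) hint (fun ω => Real.exp_nonneg _) hB,
      ← setLIntegral_const]
    refine setLIntegral_mono_ae' (ℱ.le _ _ hB) ?_
    filter_upwards [hle] with ω hω hωB
    refine ENNReal.ofReal_le_ofReal (hω.trans (le_of_eq ?_))
    rw [(hBv ω hωB).1, (hBv ω hωB).2]

theorem InMDP.measure_transition_deviation_le (hI : I.InMDP M Sinit μ ℱ)
    (x : S) (b : A) (f : S → ℝ) {ν : ℝ} (hν : ∑ y, M.P x b y * Real.exp (f y) ≤ Real.exp ν)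
    (l : ℝ) (K : ℕ) :
    μ {ω | ∃ k, 1 ≤ k ∧ k ≤ K ∧ 0 < I.N k ω x b ∧
        ν * I.N k ω x b + l ≤ I.N k ω x b * ∑ y, I.PHat k ω x b y * f y} ≤
      ENNReal.ofReal (Real.exp (-l)) := by
  let _ : MeasurableSpace S := ⊤
  refine le_trans (measure_mono ?_) (hI.measure_visitSum_ge_le x b
    (fun i h ω => f (I.s i (h + 1) ω)) ν l ?_ ?_ K)
  · rintro ω ⟨k, h1, h2, hN, h3⟩
    exact ⟨k, h1, h2, by rwa [I.visitSum_next x b k ω hN]⟩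
  · intro k hk h
    exact (Measurable.of_discrete (f := f)).comp (hI.measurable_s hk h.2)
  · intro k hk h B hB hBv
    have hB' := ℱ.le _ _ hB
    have h1 := hI.lintegral_mul_transition hk h
      (fun y => B.indicator fun _ => ENNReal.ofReal (Real.exp (f y)))
      (fun y => measurable_const.indicator hB)
    have h2 : ∀ ω, B.indicator (fun _ => ENNReal.ofReal (Real.exp (f (I.s k (h + 1) ω)))) ω =
        B.indicator (fun ω => ENNReal.ofReal (Real.exp (f (I.s k (h + 1) ω)))) ω := fun ω => by
      by_cases hω : ω ∈ B <;> simp [hω]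
    simp only [h2] at h1
    rw [lintegral_indicator hB'] at h1
    rw [h1, ← lintegral_indicator_const hB']
    refine lintegral_mono fun ω => ?_
    by_cases hω : ω ∈ B
    · simp only [Set.indicator_of_mem hω, (hBv ω hω).1, (hBv ω hω).2]
      rw [← Finset.sum_congr rfl fun y _ => ENNReal.ofReal_mul (Real.exp_nonneg (f y)),
        ← ENNReal.ofReal_sum_of_nonneg fun y _ =>
          mul_nonneg (Real.exp_nonneg _) (M.P_nonneg _ _ _)]
      refine ENNReal.ofReal_le_ofReal (le_trans (le_of_eq ?_) hν)
      exact Finset.sum_congr rfl fun y _ => mul_comm _ _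
    · simp [Set.indicator_of_notMem hω]

end Deviations

/-! ## The law of an episode -/

section EpisodeLaw

variable {S A : Type*} [Fintype S] [Fintype A] {H : ℕ} {Ω : Type*} [mΩ : MeasurableSpace Ω]
  {I : Interaction S A H Ω} {M : TabularMDP S A H}
  {Sinit : Set S} {μ : Measure Ω} [IsProbabilityMeasure μ] {ℱ : Filtration (ℕ ×ₗ ℕ) mΩ}

/-- The states visited in episode `k`. -/
def path (I : Interaction S A H Ω) (k : ℕ) (ω : Ω) : Fin H → S := fun j => I.s k j ω

/-- Follow `p` before step `n` and `x` from step `n` on. -/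
def glue (n : ℕ) (p x : Fin H → S) : Fin H → S := fun j => if (j : ℕ) < n then p j else x j

/-- Replace the realized path from step n on by a fresh trajectory started in the realized state
s_n: by the transition law the integral does not depend on n. The case n = 0 is the right-hand side
and n = H − 1 the realized path. The parameter `d` carries the data on which the functional may
depend; its values are countable, so joint measurability is automatic. -/
theorem InMDP.lintegral_mul_path (hI : I.InMDP M Sinit μ ℱ) (hH : 1 ≤ H) {D : Type*} [Countable D]
    [MeasurableSpace D] [DiscreteMeasurableSpace D] {k : ℕ} (hk : 1 ≤ k) {d : Ω → D}
    (hd : Measurable[ℱ (toLex (k, 1))] d) (φ : D → (Fin H → S) → ℝ) (hφ : ∀ d x, 0 ≤ φ d x)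
    {g : Ω → ℝ≥0∞} (hg : Measurable[ℱ (toLex (k, 1))] g) :
    ∫⁻ ω, g ω * ENNReal.ofReal (φ (d ω) (I.path k ω)) ∂μ =
      ∫⁻ ω, g ω * ENNReal.ofReal (M.trajExp (I.pol k ω) 0 (I.s k 0 ω) (φ (d ω))) ∂μ := by
  let _ : MeasurableSpace S := ⊤
  let _ : MeasurableSpace A := ⊤
  have key : ∀ n < H, ∫⁻ ω, g ω * ENNReal.ofReal (M.trajExp (I.pol k ω) n (I.s k n ω)
      fun x => φ (d ω) (glue n (I.path k ω) x)) ∂μ =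
      ∫⁻ ω, g ω * ENNReal.ofReal (M.trajExp (I.pol k ω) 0 (I.s k 0 ω) (φ (d ω))) ∂μ := by
    intro n
    induction n with
    | zero =>
      intro _
      have : ∀ p x : Fin H → S, glue 0 p x = x := fun p x => funext fun j => if_neg (Nat.not_lt_zero _)
      simp only [this]
    | succ n ih =>
      intro hn
      rw [← ih (by omega)]
      -- The realized path frozen after step `n`: it agrees with the path where `glue (n + 1)` looks
      -- and, unlike the path, is already known at step `n`.
      let q : Ω → Fin H → S := fun ω j => I.s k (min (j : ℕ) n) ω
      have hq : Measurable[ℱ (toLex (k, n + 1))] q :=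
        @measurable_pi_lambda _ _ _ (ℱ (toLex (k, n + 1))) _ _ fun j =>
          (hI.measurable_s hk (h := min (j : ℕ) n) (by omega)).mono
            (filtration_mono_of_le ℱ k (by omega)) le_rfl
      have hglue : ∀ ω x, glue (n + 1) (I.path k ω) x = glue (n + 1) (q ω) x := by
        intro ω x
        funext j
        unfold glue
        split_ifs with h1
        · simp only [path, q]
          rw [min_eq_left (by omega)]
        · rfl
      have h1 := hI.lintegral_mul_transition hk ⟨n, by omega⟩
        (fun y ω => g ω * ENNReal.ofReal (M.trajExp (I.pol k ω) (n + 1) y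
          fun x => φ (d ω) (glue (n + 1) (q ω) x))) ?_
      · simp only [hglue]
        simp only at h1
        rw [h1]
        refine lintegral_congr fun ω => ?_
        rw [M.trajExp_step _ hn]
        rw [ENNReal.ofReal_sum_of_nonneg fun y _ => mul_nonneg (M.P_nonneg _ _ _)
          (M.trajExp_nonneg _ _ _ fun x => hφ _ _), Finset.mul_sum]
        refine Finset.sum_congr rfl fun y _ => ?_
        have hx : ∀ x, glue n (I.path k ω) (TabularMDP.pin n (I.s k n ω) x) =
            glue (n + 1) (q ω) x := by
          intro x
          rw [← hglue]
          funext j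
          simp only [glue, TabularMDP.pin, path]
          by_cases h2 : (j : ℕ) < n
          · rw [if_pos h2, if_pos (by omega)]
          · rw [if_neg h2]
            by_cases h3 : (j : ℕ) = n
            · rw [if_pos (by omega), if_pos (by omega), h3]
            · rw [if_neg (by omega), if_neg (by omega)]
        simp only [hx]
        rw [ENNReal.ofReal_mul (M.P_nonneg _ _ _)]
        simp only [Interaction.a]
        ring
      · intro y
        refine (hg.mono (filtration_mono_of_le ℱ k (by omega)) le_rfl).mul ?_
        have hψ : Measurable (fun p : (Policy S A H) × D × (Fin H → S) =>
          M.trajExp p.1 (n + 1) y fun x => φ p.2.1 (glue (n + 1) p.2.2 x)) := Measurable.of_discrete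
        have hpol : Measurable[ℱ (toLex (k, n + 1))] (I.pol k) :=
          (hI.measurable_pol hk).mono (filtration_mono_of_le ℱ k (by omega)) le_rfl
        have hd' : Measurable[ℱ (toLex (k, n + 1))] d :=
          hd.mono (filtration_mono_of_le ℱ k (by omega)) le_rfl
        exact (hψ.comp (hpol.prodMk (hd'.prodMk hq))).ennreal_ofReal
  rw [← key (H - 1) (by omega)]
  refine lintegral_congr fun ω => ?_
  rw [M.trajExp_of_le _ (by omega)]
  congr 3
  funext j
  simp only [glue, path]
  split_ifs with h1
  · rfl
  · rw [show (j : ℕ) = H - 1 by have := j.2; omega]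

/-- Exponential lower-tail bound for the sum of path functionals over the episodes. -/
theorem InMDP.measure_path_sum_ge_le (hI : I.InMDP M Sinit μ ℱ) (hH : 1 ≤ H) {D : Type*}
    [Countable D] [MeasurableSpace D] [DiscreteMeasurableSpace D] (d : ℕ → Ω → D)
    (hd : ∀ k, 1 ≤ k → Measurable[ℱ (toLex (k, 0))] (d k)) (φ : ℕ → D → (Fin H → S) → ℝ) (l : ℝ)
    (K : ℕ) :
    μ {ω | l ≤ ∑ k ∈ Finset.Icc 1 K, (-φ k (d k ω) (I.path k ω) -
        Real.log (M.trajExp (I.pol k ω) 0 (I.s k 0 ω) fun x => Real.exp (-φ k (d k ω) x)))} ≤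
      ENNReal.ofReal (Real.exp (-l)) := by
  let _ : MeasurableSpace S := ⊤
  let _ : MeasurableSpace A := ⊤
  let L : ℕ → Ω → ℝ := fun k ω =>
    M.trajExp (I.pol k ω) 0 (I.s k 0 ω) fun x => Real.exp (-φ k (d k ω) x)
  have hLpos : ∀ k ω, 0 < L k ω := by
    intro k ω
    have : Nonempty (Fin H → S) := ⟨fun _ => I.s k 0 ω⟩
    obtain ⟨x₀, hx₀⟩ := Finite.exists_min fun x : Fin H → S => Real.exp (-φ k (d k ω) x)
    refine lt_of_lt_of_le (Real.exp_pos (-φ k (d k ω) x₀)) ?_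
    calc _ = M.trajExp (I.pol k ω) 0 (I.s k 0 ω) fun _ => Real.exp (-φ k (d k ω) x₀) :=
          (M.trajExp_const _ _ _ _).symm
      _ ≤ _ := M.trajExp_mono _ _ _ fun x _ => hx₀ x
  have hLm : ∀ k, 1 ≤ k → Measurable[ℱ (toLex (k, 1))] (L k) := fun k hk =>
    (Measurable.of_discrete (f := fun p : (Policy S A H) × D × S =>
      M.trajExp p.1 0 p.2.2 fun x => Real.exp (-φ k p.2.1 x))).comp
      (((hI.measurable_pol hk).mono (filtration_mono_of_le ℱ k (by omega)) le_rfl).prodMk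
        (((hd k hk).mono (filtration_mono_of_le ℱ k (by omega)) le_rfl).prodMk
          (hI.measurable_s hk (by omega))))
  have hpathm : ∀ k, 1 ≤ k → Measurable[ℱ (toLex (k, H + 1))] (I.path k) := fun k hk =>
    @measurable_pi_lambda _ _ _ (ℱ (toLex (k, H + 1))) _ _ fun j =>
      (hI.measurable_s hk j.2.le).mono (filtration_mono_of_le ℱ k (by omega)) le_rfl
  let Z : ℕ → Ω → ℝ≥0∞ := fun k ω =>
    ENNReal.ofReal (L k ω)⁻¹ * ENNReal.ofReal (Real.exp (-φ k (d k ω) (I.path k ω)))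
  have hZm : ∀ k, 1 ≤ k → Measurable[ℱ (toLex (k, H + 1))] (Z k) := by
    intro k hk
    have h1 : Measurable[ℱ (toLex (k, H + 1))] (L k) :=
      (hLm k hk).mono (filtration_mono_of_le ℱ k (by omega)) le_rfl
    have h2 : Measurable[ℱ (toLex (k, H + 1))] (d k) :=
      (hd k hk).mono (filtration_mono_of_le ℱ k (by omega)) le_rfl
    have hψ : Measurable (fun p : D × (Fin H → S) => Real.exp (-φ k p.1 p.2)) :=
      Measurable.of_discrete
    exact h1.inv.ennreal_ofReal.mul (hψ.comp (h2.prodMk (hpathm k hk))).ennreal_ofReal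
  -- Each factor is e^{−φ} divided by its conditional mean given the initial state of the episode,
  -- so appending an episode leaves the integral unchanged. Only the final time is needed, and
  -- Markov's inequality replaces Ville's.
  have hprod : ∀ n, ∫⁻ ω, ∏ k ∈ Finset.Icc 1 n, Z k ω ∂μ ≤ 1 := by
    intro n
    induction n with
    | zero => simp
    | succ n ih =>
      refine le_trans (le_of_eq ?_) ih
      have hg : Measurable[ℱ (toLex (n + 1, 1))] fun ω =>
          (∏ k ∈ Finset.Icc 1 n, Z k ω) * ENNReal.ofReal (L (n + 1) ω)⁻¹ := by
        refine Measurable.mul (Finset.measurable_fun_prod _ fun k hk => ?_)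
          (hLm (n + 1) (by omega)).inv.ennreal_ofReal
        rw [Finset.mem_Icc] at hk
        exact (hZm k hk.1).mono (filtration_mono_of_lt ℱ (by omega) _ _) le_rfl
      have h1 := hI.lintegral_mul_path hH (k := n + 1) (by omega)
        ((hd (n + 1) (by omega)).mono (filtration_mono_of_le ℱ (n + 1) (by omega)) le_rfl)
        (fun d x => Real.exp (-φ (n + 1) d x)) (fun _ _ => Real.exp_nonneg _) hg
      calc _ = _ := lintegral_congr fun ω => by
              rw [Finset.prod_Icc_succ_top (by omega), mul_assoc]
        _ = _ := h1
        _ = _ := lintegral_congr fun ω => by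
              rw [mul_assoc, ← ENNReal.ofReal_mul (inv_nonneg.2 (hLpos _ _).le),
                inv_mul_cancel₀ (hLpos _ _).ne', ENNReal.ofReal_one, mul_one]
  have hZ : ∀ ω, ∏ k ∈ Finset.Icc 1 K, Z k ω = ENNReal.ofReal (Real.exp
      (∑ k ∈ Finset.Icc 1 K, (-φ k (d k ω) (I.path k ω) - Real.log (L k ω)))) := by
    intro ω
    rw [Real.exp_sum, ENNReal.ofReal_prod_of_nonneg fun _ _ => Real.exp_nonneg _]
    refine Finset.prod_congr rfl fun k _ => ?_
    simp only [Z]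
    rw [← ENNReal.ofReal_mul (inv_nonneg.2 (hLpos _ _).le), Real.exp_sub, Real.exp_log (hLpos _ _)]
    congr 1
    field_simp
  calc _ ≤ μ {ω | ENNReal.ofReal (Real.exp l) ≤ ∏ k ∈ Finset.Icc 1 K, Z k ω} := by
        refine measure_mono fun ω hω => ?_
        simp only [Set.mem_ofPred_eq] at hω ⊢
        rw [hZ]
        exact ENNReal.ofReal_le_ofReal (Real.exp_le_exp.2 hω)
    _ = ENNReal.ofReal (Real.exp (-l)) * (ENNReal.ofReal (Real.exp l) *
          μ {ω | ENNReal.ofReal (Real.exp l) ≤ ∏ k ∈ Finset.Icc 1 K, Z k ω}) := by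
        rw [← mul_assoc, ← ENNReal.ofReal_mul (Real.exp_nonneg _), ← Real.exp_add]
        simp
    _ ≤ ENNReal.ofReal (Real.exp (-l)) * 1 := by
        gcongr
        refine (mul_meas_ge_le_lintegral ?_ _).trans (hprod K)
        refine Finset.measurable_fun_prod _ fun k hk => ?_
        rw [Finset.mem_Icc] at hk
        exact (hZm k hk.1).mono (ℱ.le _) le_rfl
    _ = _ := mul_one _

end EpisodeLaw

end Interaction

/-! ## Elementary exponential inequalities -/

section FiniteExpectation

variable {S : Type*} [Fintype S]

/-- Average e^u ≤ 1 + u + u², valid for |u| ≤ 1, and use 1 + v ≤ e^v. This is the source of all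
Bernstein-type bounds below. -/
theorem sum_mul_exp_le_of_abs_le_one {p f : S → ℝ} (hp : ∀ y, 0 ≤ p y) (hp1 : ∑ y, p y = 1)
    (hf : ∀ y, |f y| ≤ 1) (hf0 : ∑ y, p y * f y = 0) :
    ∑ y, p y * Real.exp (f y) ≤ Real.exp (∑ y, p y * f y ^ 2) := by
  have h1 : ∀ y, Real.exp (f y) ≤ 1 + f y + f y ^ 2 := fun y => by
    have := (abs_le.1 (Real.abs_exp_sub_one_sub_id_le (hf y))).2
    linarith
  calc ∑ y, p y * Real.exp (f y) ≤ ∑ y, p y * (1 + f y + f y ^ 2) :=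
        Finset.sum_le_sum fun y _ => mul_le_mul_of_nonneg_left (h1 y) (hp y)
    _ = 1 + ∑ y, p y * f y ^ 2 := by
        simp only [mul_add, mul_one, Finset.sum_add_distrib, hp1, hf0, add_zero]
    _ ≤ _ := by
        have := Real.add_one_le_exp (∑ y, p y * f y ^ 2)
        linarith

/-- Hoeffding's lemma for a distribution on a finite set. -/
theorem sum_mul_exp_le_of_mem_Icc {p f : S → ℝ} (hp : ∀ y, 0 ≤ p y) (hp1 : ∑ y, p y = 1)
    {a D : ℝ} (hf : ∀ y, f y ∈ Set.Icc a (a + D)) (t : ℝ) :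
    ∑ y, p y * Real.exp (t * (f y - ∑ z, p z * f z)) ≤ Real.exp (t ^ 2 * D ^ 2 / 8) := by
  let _ : MeasurableSpace S := ⊤
  let μ : Measure S := ∑ y, ENNReal.ofReal (p y) • Measure.dirac y
  have hint : ∀ g : S → ℝ, ∫ y, g y ∂μ = ∑ y, p y * g y := by
    intro g
    have hfin : ∀ y, IsFiniteMeasure (ENNReal.ofReal (p y) • (Measure.dirac y : Measure S)) :=
      fun y => Measure.smul_finite _ ENNReal.ofReal_ne_top
    rw [integral_finsetSum_measure fun y _ => Integrable.of_finite]
    refine Finset.sum_congr rfl fun y _ => ?_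
    rw [integral_smul_measure, integral_dirac, ENNReal.toReal_ofReal (hp y), smul_eq_mul]
  have : IsProbabilityMeasure μ := ⟨by
    simp only [μ, Measure.coe_finsetSum, Measure.coe_smul, Finset.sum_apply, Pi.smul_apply,
      measure_univ, smul_eq_mul, mul_one]
    rw [← ENNReal.ofReal_sum_of_nonneg fun y _ => hp y, hp1, ENNReal.ofReal_one]⟩
  have h := (ProbabilityTheory.hasSubgaussianMGF_of_mem_Icc (μ := μ) (X := f) (a := a) (b := a + D)
    Measurable.of_discrete.aemeasurable (Filter.Eventually.of_forall hf)).mgf_le t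
  rw [ProbabilityTheory.mgf, hint, hint] at h
  refine h.trans (le_of_eq ?_)
  congr 1
  simp only [add_sub_cancel_left, NNReal.coe_pow, NNReal.coe_div, coe_nnnorm, Real.norm_eq_abs,
    NNReal.coe_ofNat, div_pow, sq_abs]
  ring

theorem sum_mul_sub_sq {p f : S → ℝ} (hp1 : ∑ y, p y = 1) (c : ℝ) :
    ∑ y, p y * (f y - c) ^ 2 =
      ∑ y, p y * (f y - ∑ z, p z * f z) ^ 2 + (∑ z, p z * f z - c) ^ 2 := by
  have e : ∀ d : ℝ, ∑ y, p y * (f y - d) ^ 2 =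
      ∑ y, p y * f y ^ 2 - 2 * d * ∑ y, p y * f y + d ^ 2 := by
    intro d
    have : ∀ y, p y * (f y - d) ^ 2 = p y * f y ^ 2 - 2 * d * (p y * f y) + d ^ 2 * p y :=
      fun y => by ring
    simp only [this, Finset.sum_add_distrib, Finset.sum_sub_distrib, ← Finset.mul_sum, hp1, mul_one]
  rw [e, e]
  ring

theorem sum_mul_sq_eq {p f : S → ℝ} (hp1 : ∑ y, p y = 1) :
    ∑ y, p y * f y ^ 2 =
      ∑ y, p y * (f y - ∑ z, p z * f z) ^ 2 + (∑ z, p z * f z) ^ 2 := by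
  simpa using sum_mul_sub_sq (f := f) hp1 0

end FiniteExpectation

/-! ## Peeling -/

section Peeling

/-- The exponent used for sample sizes in `[2 ^ j, 2 ^ (j + 1))`. -/
noncomputable def peelRate (l σ : ℝ) (j : ℕ) : ℝ := √(2 * l / 2 ^ j) / σ

theorem peelRate_pos {l σ : ℝ} (hl : 0 < l) (hσ : 0 < σ) (j : ℕ) : 0 < peelRate l σ j := by
  unfold peelRate; positivity

theorem two_pow_log_le_cast {N : ℕ} (hN : 0 < N) : (2 : ℝ) ^ Nat.log 2 N ≤ N := by
  exact_mod_cast Nat.pow_log_le_self 2 hN.ne'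

theorem cast_le_two_mul_two_pow_log (N : ℕ) : (N : ℝ) ≤ 2 * 2 ^ Nat.log 2 N := by
  have := (Nat.lt_pow_succ_log_self (b := 2) (by norm_num) N).le
  rw [pow_succ, mul_comm] at this
  exact_mod_cast this

/-- The optimal exponent for the exact N is √(8l/N)/σ and gives σ√(l/(2N)). The exponent fixed for
the dyadic block is off by a bounded factor only, and the slack between 1/√2 and 1 covers the loss.
-/
theorem peel_bound {N : ℕ} (hN : 0 < N) {l σ : ℝ} (hl : 0 < l) (hσ : 0 < σ) :
    peelRate l σ (Nat.log 2 N) * σ ^ 2 / 8 + l / (peelRate l σ (Nat.log 2 N) * N) ≤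
      σ * √(l / N) := by
  set q : ℝ := 2 ^ Nat.log 2 N with hq
  have hq0 : 0 < q := by positivity
  have hN0 : (0 : ℝ) < N := by positivity
  have hqN : q ≤ N := two_pow_log_le_cast hN
  have hNq : (N : ℝ) ≤ 2 * q := cast_le_two_mul_two_pow_log N
  set y := √(l / N) with hy
  have hy0 : 0 < y := by positivity
  have hy2 : y ^ 2 = l / N := Real.sq_sqrt (by positivity)
  set w := √(2 * l / q) with hw
  have hw0 : 0 < w := by positivity
  have hw2 : w ^ 2 = 2 * l / q := Real.sq_sqrt (by positivity)
  have hlN : l = y ^ 2 * N := by rw [hy2]; field_simp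
  have h1 : 2 * y ^ 2 ≤ w ^ 2 := by
    rw [hy2, hw2, mul_div_assoc]
    gcongr
  have h2 : w ^ 2 ≤ 4 * y ^ 2 := by
    rw [hy2, hw2, div_le_iff₀ hq0, mul_comm 4, div_mul_eq_mul_div, div_mul_eq_mul_div,
      le_div_iff₀ hN0]
    nlinarith
  have e : peelRate l σ (Nat.log 2 N) = w / σ := rfl
  rw [e]
  have e1 : w / σ * σ ^ 2 / 8 + l / (w / σ * N) = σ * (w / 8 + y ^ 2 / w) := by
    rw [hlN]; field_simp
  rw [e1]
  refine mul_le_mul_of_nonneg_left ?_ hσ.le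
  have h3 : w ≤ 2 * y := by nlinarith
  have h4 : (7 / 5) * y ≤ w := by nlinarith
  rw [div_add_div _ _ (by norm_num) hw0.ne', div_le_iff₀ (by positivity)]
  nlinarith

/-- An exponent outside the sub-exponential range means that N is small compared with l α²/σ². Since
σ² ≥ 2αV, the square-root bound is then already at least V, so no concentration is needed. -/
theorem le_mul_sqrt_of_one_lt_peelRate_mul {N : ℕ} (hN : 0 < N) {l σ α V : ℝ} (hl : 0 < l)
    (hσ : 0 < σ) (hα : 0 ≤ α) (hV : 0 ≤ V) (hσV : 2 * α * V ≤ σ ^ 2)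
    (h : 1 < peelRate l σ (Nat.log 2 N) * α) : V ≤ σ * √(l / N) := by
  have hNq : (N : ℝ) ≤ 2 * 2 ^ Nat.log 2 N := cast_le_two_mul_two_pow_log N
  have hN0 : (0 : ℝ) < N := by positivity
  unfold peelRate at h
  rw [div_mul_eq_mul_div, lt_div_iff₀ hσ, one_mul] at h
  have h1 : σ ^ 2 < 2 * l / 2 ^ Nat.log 2 N * α ^ 2 := by
    have := pow_lt_pow_left₀ h hσ.le (n := 2) (by norm_num)
    rwa [mul_pow, Real.sq_sqrt (by positivity)] at this
  have h2 : σ ^ 2 * N ≤ 4 * l * α ^ 2 := by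
    rw [div_mul_eq_mul_div, lt_div_iff₀ (by positivity)] at h1
    nlinarith [sq_nonneg σ]
  refine le_of_sq_le_sq ?_ (by positivity)
  rw [mul_pow, Real.sq_sqrt (by positivity), mul_div_assoc', le_div_iff₀ hN0]
  have h3 : (2 * α * V) ^ 2 ≤ (σ ^ 2) ^ 2 := by gcongr
  have hσ2 : 0 < σ ^ 2 := by positivity
  have h4 : σ ^ 2 * (V ^ 2 * N) ≤ σ ^ 2 * (σ ^ 2 * l) := by
    calc σ ^ 2 * (V ^ 2 * N) = (σ ^ 2 * N) * V ^ 2 := by ring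
      _ ≤ 4 * l * α ^ 2 * V ^ 2 := by gcongr
      _ = l * (2 * α * V) ^ 2 := by ring
      _ ≤ l * (σ ^ 2) ^ 2 := by gcongr
      _ = _ := by ring
  exact le_of_mul_le_mul_left h4 hσ2

/-- The exponent used for a Bernoulli parameter `p` and sample sizes in `[2 ^ j, 2 ^ (j + 1))`. -/
noncomputable def bernRate (l p : ℝ) (j : ℕ) : ℝ :=
  if p * 2 ^ j ≤ l then 1 else √(l / (p * 2 ^ j))

theorem bernRate_pos {l p : ℝ} (hl : 0 < l) (j : ℕ) : 0 < bernRate l p j := by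
  unfold bernRate
  split_ifs with h
  · exact one_pos
  · have : 0 < p * 2 ^ j := hl.trans (not_le.1 h)
    positivity

theorem bernRate_le_one {l p : ℝ} (hl : 0 < l) (j : ℕ) : bernRate l p j ≤ 1 := by
  unfold bernRate
  split_ifs with h
  · exact le_rfl
  · rw [Real.sqrt_le_one, div_le_one (hl.trans (not_le.1 h))]
    exact (not_le.1 h).le

/-- The Bernstein bound for one kernel entry, multiplied by z and split by AM–GM into p z²/12, which
sums over next states to a variance, and a term of order l/N. The exponent is capped at 1 when p·2^j
≤ l; then p itself is of order l/N. -/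
theorem bern_peel_bound {N : ℕ} (hN : 0 < N) {l p z : ℝ} (hl : 0 < l) (hp : 0 ≤ p) (hz2 : z ≤ 2) :
    z * (bernRate l p (Nat.log 2 N) * p + l / (bernRate l p (Nat.log 2 N) * N)) ≤
      p * z ^ 2 / 12 + 27 / 2 * l / N := by
  set q : ℝ := 2 ^ Nat.log 2 N with hq
  have hq0 : 0 < q := by positivity
  have hN0 : (0 : ℝ) < N := by positivity
  have hqN : q ≤ N := two_pow_log_le_cast hN
  have hNq : (N : ℝ) ≤ 2 * q := cast_le_two_mul_two_pow_log N
  have hlN : 0 < l / N := by positivity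
  unfold bernRate
  rw [← hq]
  split_ifs with h
  · have h1 : p ≤ 2 * (l / N) := by
      rw [mul_div_assoc', le_div_iff₀ hN0]
      nlinarith
    rw [one_mul, one_mul, mul_div_assoc (27 / 2)]
    nlinarith [mul_nonneg hp (sq_nonneg (z - 6))]
  · have hpq : 0 < p * q := hl.trans (not_le.1 h)
    have hp0 : 0 < p := pos_of_mul_pos_left hpq hq0.le
    set t := √(l / (p * q)) with ht
    have ht0 : 0 < t := by positivity
    have ht2 : t ^ 2 = l / (p * q) := Real.sq_sqrt (by positivity)
    have hlt : l = t ^ 2 * (p * q) := by rw [ht2]; field_simp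
    have e1 : t * p + l / (t * N) = t * p * (1 + q / N) := by
      rw [hlt]; field_simp
    set ρ := q / N with hρ
    have hρ1 : ρ ≤ 1 := (div_le_one hN0).2 hqN
    have hρ2 : 1 / 2 ≤ ρ := by rw [hρ, div_le_div_iff₀ (by norm_num) hN0]; linarith
    have e2 : l / N = t ^ 2 * p * ρ := by rw [hρ, hlt]; field_simp
    rw [e1, mul_div_assoc (27 / 2), e2]
    -- By convexity on [1/2, 1], with equality at 1/2. AM–GM in `h7` produces the factor 3, whence
    -- 27/2 = 3 · 9/2.
    have h5 : (1 + ρ) ^ 2 ≤ 9 / 2 * ρ := by nlinarith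
    have h6 : 3 * t ^ 2 * (1 + ρ) ^ 2 ≤ 27 / 2 * (t ^ 2 * ρ) := by
      nlinarith [mul_le_mul_of_nonneg_left h5 (sq_nonneg t)]
    have h7 : z * (t * (1 + ρ)) ≤ z ^ 2 / 12 + 3 * t ^ 2 * (1 + ρ) ^ 2 := by
      nlinarith [sq_nonneg (z - 6 * (t * (1 + ρ)))]
    nlinarith [mul_le_mul_of_nonneg_left (h7.trans (add_le_add_right h6 _)) hp0.le]

end Peeling

/-! ### Summable weights for the union bounds -/

section Weights

theorem sum_inv_sq_le_two (s : Finset ℕ) (hs : ∀ i ∈ s, 1 ≤ i) : ∑ i ∈ s, 1 / (i : ℝ) ^ 2 ≤ 2 := by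
  have hsub : s ⊆ Finset.Ico 1 (s.sup id + 2) := fun i hi => by
    rw [Finset.mem_Ico]
    have := Finset.le_sup (f := id) hi
    simp only [id] at this
    exact ⟨hs i hi, by omega⟩
  refine (Finset.sum_le_sum_of_subset_of_nonneg hsub fun _ _ _ => by positivity).trans ?_
  have : ∀ n : ℕ, ∑ i ∈ Finset.Ico 1 (n + 2), 1 / (i : ℝ) ^ 2 ≤ 2 - 1 / ((n : ℝ) + 1) := by
    intro n
    induction n with
    | zero => norm_num
    | succ n ih =>
      rw [Finset.sum_Ico_succ_top (by omega)]
      have h1 : 1 / ((n : ℝ) + 2) ^ 2 ≤ 1 / (n + 1) - 1 / (n + 2) := by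
        rw [div_sub_div _ _ (by positivity) (by positivity),
          div_le_div_iff₀ (by positivity) (by positivity)]
        have : (0 : ℝ) ≤ n := by positivity
        nlinarith [sq_nonneg (n : ℝ)]
      push_cast at ih ⊢
      rw [show (n : ℝ) + 1 + 1 = n + 2 by ring]
      linarith
  refine (this _).trans ?_
  have : (0 : ℝ) ≤ 1 / ((s.sup id : ℕ) + 1) := by positivity
  linarith

/-- Since 2 + j log 2 ≥ 0.69 (j + 2), the sum is dominated by a telescoping one. These weights make
the union over dyadic blocks cost only the squared logarithm inside ℓ₂. -/
theorem sum_peel_weight_le (J : ℕ) :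
    ∑ j ∈ Finset.range J, 1 / (2 + j * Real.log 2) ^ 2 ≤ 5 / 2 := by
  have : ∀ n : ℕ, ∑ j ∈ Finset.range n, 1 / (2 + (j : ℝ) * Real.log 2) ^ 2 ≤
      5 / 2 * (1 - 1 / ((n : ℝ) + 1)) := by
    intro n
    induction n with
    | zero => norm_num
    | succ n ih =>
      rw [Finset.sum_range_succ]
      have hn : (0 : ℝ) ≤ n := by positivity
      have h2 := Real.log_two_gt_d9
      have h1 : 1 / (2 + (n : ℝ) * Real.log 2) ^ 2 ≤ 5 / 2 * (1 / (n + 1) - 1 / (n + 2)) := by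
        have h3 : (69 / 100) * (n + 2) ≤ 2 + (n : ℝ) * Real.log 2 := by nlinarith
        calc 1 / (2 + (n : ℝ) * Real.log 2) ^ 2 ≤ 1 / ((69 / 100) * ((n : ℝ) + 2)) ^ 2 := by gcongr
          _ ≤ _ := by
            rw [div_sub_div _ _ (by positivity) (by positivity), mul_div_assoc',
              div_le_div_iff₀ (by positivity) (by positivity)]
            nlinarith [sq_nonneg (n : ℝ)]
      push_cast
      rw [show (n : ℝ) + 1 + 1 = n + 2 by ring]
      linarith
  refine (this J).trans ?_
  have : (0 : ℝ) ≤ 1 / ((J : ℝ) + 1) := by positivity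
  linarith

end Weights

/-! ## The variance potential -/

namespace TabularMDP

section Potential

variable {S A : Type*} [Fintype S] {H : ℕ} (M : TabularMDP S A H)

/-- Expectation of `f` at the next state. -/
def nextExp (s : S) (a : A) (f : S → ℝ) : ℝ := ∑ y, M.P s a y * f y

/-- Variance of `f` at the next state. -/
def nextVar (s : S) (a : A) (f : S → ℝ) : ℝ := ∑ y, M.P s a y * (f y - M.nextExp s a f) ^ 2

theorem nextVar_nonneg (s : S) (a : A) (f : S → ℝ) : 0 ≤ M.nextVar s a f :=
  Finset.sum_nonneg fun _ _ => mul_nonneg (M.P_nonneg _ _ _) (sq_nonneg _)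

theorem nextExp_const (s : S) (a : A) (c : ℝ) : M.nextExp s a (fun _ => c) = c :=
  M.P_expect_const s a c

theorem nextExp_mono (s : S) (a : A) {f g : S → ℝ} (hfg : ∀ y, 0 < M.P s a y → f y ≤ g y) :
    M.nextExp s a f ≤ M.nextExp s a g :=
  M.P_expect_mono s a hfg

theorem nextExp_nonneg (s : S) (a : A) {f : S → ℝ} (hf : ∀ y, 0 ≤ f y) : 0 ≤ M.nextExp s a f :=
  Finset.sum_nonneg fun _ _ => mul_nonneg (M.P_nonneg _ _ _) (hf _)

theorem nextExp_add (s : S) (a : A) (f g : S → ℝ) :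
    M.nextExp s a (fun y => f y + g y) = M.nextExp s a f + M.nextExp s a g := by
  simp only [nextExp, mul_add, Finset.sum_add_distrib]

theorem nextExp_sub (s : S) (a : A) (f g : S → ℝ) :
    M.nextExp s a (fun y => f y - g y) = M.nextExp s a f - M.nextExp s a g := by
  simp only [nextExp, mul_sub, Finset.sum_sub_distrib]

theorem nextExp_const_mul (s : S) (a : A) (c : ℝ) (f : S → ℝ) :
    M.nextExp s a (fun y => c * f y) = c * M.nextExp s a f := by
  simp only [nextExp, Finset.mul_sum]
  exact Finset.sum_congr rfl fun x _ => by ring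

theorem nextExp_sq (s : S) (a : A) (f : S → ℝ) :
    M.nextExp s a (fun y => f y ^ 2) = M.nextVar s a f + M.nextExp s a f ^ 2 :=
  sum_mul_sq_eq (M.P_sum s a)

/-- The variance of g is at most its mean square deviation from any constant. Taking φ(E f) as the
constant, the Lipschitz bound applies pointwise; convexity of `I` puts E f in its domain. -/
theorem nextVar_le_of_lipschitz (s : S) (a : A) {f g : S → ℝ} {L : ℝ} (φ : ℝ → ℝ)
    (hg : ∀ y, g y = φ (f y)) {I : Set ℝ} (hI : Convex ℝ I) (hf : ∀ y, f y ∈ I)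
    (hφ : ∀ u ∈ I, ∀ v ∈ I, (φ u - φ v) ^ 2 ≤ L * (u - v) ^ 2) :
    M.nextVar s a g ≤ L * M.nextVar s a f := by
  have hmem : M.nextExp s a f ∈ I := by
    have := hI.sum_mem (t := Finset.univ) (w := M.P s a) (z := f)
      (fun y _ => M.P_nonneg s a y) (M.P_sum s a) (fun y _ => hf y)
    simpa [nextExp] using this
  have h1 := sum_mul_sub_sq (f := g) (M.P_sum s a) (φ (M.nextExp s a f))
  calc M.nextVar s a g ≤ ∑ y, M.P s a y * (g y - φ (M.nextExp s a f)) ^ 2 := by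
        rw [h1]; exact le_add_of_nonneg_right (sq_nonneg _)
    _ ≤ ∑ y, M.P s a y * (L * (f y - M.nextExp s a f) ^ 2) := by
        refine Finset.sum_le_sum fun y _ => mul_le_mul_of_nonneg_left ?_ (M.P_nonneg _ _ _)
        rw [hg]
        exact hφ _ (hf y) _ hmem
    _ = _ := by
        rw [nextVar, Finset.mul_sum]
        exact Finset.sum_congr rfl fun y _ => by ring

variable (sig : Fin H → S → A → ℝ) (π : Policy S A H)

theorem W_nonneg (h : ℕ) (s : S) : 0 ≤ M.W sig π h s :=
  M.cumulative_nonneg (fun _ _ _ => by positivity) π h s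

theorem W_of_le {h : ℕ} (hh : H ≤ h) (s : S) : M.W sig π h s = 0 := M.cumulative_of_le _ π hh s

theorem W_step (h : Fin H) (s : S) :
    M.W sig π h s = sig h s (π h s) ^ 2 / 2 + M.nextExp s (π h s) (M.W sig π (h + 1)) :=
  M.cumulative_step _ π h s

/-- The total variance proxy relative to its minimum over the states. -/
noncomputable def Wrel (h : ℕ) (s : S) : ℝ := M.W sig π h s - ⨅ s', M.W sig π h s'

theorem Wrel_nonneg (h : ℕ) (s : S) : 0 ≤ M.Wrel sig π h s :=
  sub_nonneg.2 (ciInf_le (Set.finite_range _).bddBelow s)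

theorem iInf_W_nonneg (h : ℕ) : 0 ≤ ⨅ s, M.W sig π h s :=
  Real.iInf_nonneg fun s => M.W_nonneg sig π h s

variable [Fintype A]

theorem W_le_WStar (h : ℕ) (s : S) : M.W sig π h s ≤ M.WStar sig := by
  by_cases hh : h < H
  · exact le_ciSup (f := fun p : Fin H × S × Policy S A H => M.W sig p.2.2 p.1 p.2.1)
      (Set.finite_range _).bddAbove (⟨h, hh⟩, s, π)
  · rw [M.W_of_le sig π (not_lt.1 hh)]
    exact Real.iSup_nonneg fun p => M.W_nonneg sig _ _ _

theorem WStar_nonneg : 0 ≤ M.WStar sig := Real.iSup_nonneg fun _ => M.W_nonneg sig _ _ _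

theorem WDiffStar_nonneg : 0 ≤ M.WDiffStar sig := Real.iSup_nonneg fun p =>
  M.Wrel_nonneg sig p.2.2 p.1 p.2.1

theorem Wrel_le_WDiffStar (h : ℕ) (s : S) : M.Wrel sig π h s ≤ M.WDiffStar sig := by
  by_cases hh : h < H
  · exact le_ciSup (f := fun p : Fin H × S × Policy S A H =>
      (M.W sig p.2.2 p.1 p.2.1 - ⨅ s : S, M.W sig p.2.2 p.1 s))
      (Set.finite_range _).bddAbove (⟨h, hh⟩, s, π)
  · refine le_trans (le_of_eq ?_) (M.WDiffStar_nonneg sig)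
    have : Nonempty S := ⟨s⟩
    simp [Wrel, M.W_of_le sig π (not_lt.1 hh)]

/-- A potential whose expected decrease dominates the variance proxy together with the normalized
variance of the total variance proxy. -/
noncomputable def potential (h : ℕ) (s : S) : ℝ :=
  2 * M.W sig π h s - M.Wrel sig π h s ^ 2 / (2 * M.WDiffStar sig)

theorem Wrel_sq_div_le (h : ℕ) (s : S) :
    M.Wrel sig π h s ^ 2 / (2 * M.WDiffStar sig) ≤ M.Wrel sig π h s / 2 := by
  have h0 := M.Wrel_nonneg sig π h s
  have h1 := M.Wrel_le_WDiffStar sig π h s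
  -- When the range is zero the quotient is zero by the convention for division, and the potential
  -- is simply 2W.
  rcases (M.WDiffStar_nonneg sig).eq_or_lt with h2 | h2
  · rw [← h2]; simp; linarith
  · rw [div_le_div_iff₀ (by positivity) (by norm_num)]
    nlinarith

theorem potential_nonneg (h : ℕ) (s : S) : 0 ≤ M.potential sig π h s := by
  have h1 := M.Wrel_sq_div_le sig π h s
  have h2 : M.Wrel sig π h s ≤ M.W sig π h s := sub_le_self _ (M.iInf_W_nonneg sig π h)
  have h3 := M.W_nonneg sig π h s
  unfold potential
  linarith

theorem potential_of_le {h : ℕ} (hh : H ≤ h) (s : S) : M.potential sig π h s = 0 := by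
  have : Nonempty S := ⟨s⟩
  simp [potential, Wrel, M.W_of_le sig π hh]

theorem potential_le (h : ℕ) (s : S) : M.potential sig π h s ≤ 2 * M.WStar sig := by
  have h1 := M.W_le_WStar sig π h s
  have h2 : 0 ≤ M.Wrel sig π h s ^ 2 / (2 * M.WDiffStar sig) :=
    div_nonneg (sq_nonneg _) (mul_nonneg zero_le_two (M.WDiffStar_nonneg sig))
  unfold potential
  linarith

theorem potential_eq (h : ℕ) (s : S) : M.potential sig π h s =
    2 * (⨅ s', M.W sig π h s') + (2 * M.Wrel sig π h s
      - M.Wrel sig π h s ^ 2 / (2 * M.WDiffStar sig)) := by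
  unfold potential Wrel
  ring

/-- The function 2u − u²/(2D) increases from 0 to 3D/2 on [0, D]. The length 3D/2 is the range used
in Hoeffding's lemma. -/
theorem potential_mem_Icc (h : ℕ) (s : S) : M.potential sig π h s ∈
    Set.Icc (2 * ⨅ s', M.W sig π h s') (2 * (⨅ s', M.W sig π h s') + 3 / 2 * M.WDiffStar sig) := by
  have h1 := M.Wrel_sq_div_le sig π h s
  have h2 := M.Wrel_nonneg sig π h s
  have h3 := M.Wrel_le_WDiffStar sig π h s
  rw [potential_eq]
  constructor
  · linarith
  · have : 2 * M.Wrel sig π h s - M.Wrel sig π h s ^ 2 / (2 * M.WDiffStar sig) ≤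
        3 / 2 * M.WDiffStar sig := by
      rcases (M.WDiffStar_nonneg sig).eq_or_lt with h4 | h4
      · have : M.Wrel sig π h s = 0 := by linarith
        rw [this, ← h4]; simp
      · rw [sub_le_iff_le_add, ← sub_le_iff_le_add', le_div_iff₀ (by positivity)]
        nlinarith [mul_nonneg (sub_nonneg.2 h3) (sub_nonneg.2 h3),
          mul_nonneg (sub_nonneg.2 h3) h4.le]
    linarith

/-- As a function of W the potential has slope between 1 and 2 when D > 0, and slope 2 when D = 0.
-/
theorem nextVar_potential_le (s : S) (a : A) (h : ℕ) :
    M.nextVar s a (M.potential sig π h) ≤ 4 * M.nextVar s a (M.W sig π h) := by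
  set m := ⨅ s', M.W sig π h s' with hm
  set D := M.WDiffStar sig with hD
  refine M.nextVar_le_of_lipschitz s a
    (fun w => 2 * w - (w - m) ^ 2 / (2 * D)) (fun y => rfl) (I := Set.Icc m (m + D))
    (convex_Icc _ _) (fun y => ?_) ?_
  · have h1 := M.Wrel_nonneg sig π h y
    have h2 := M.Wrel_le_WDiffStar sig π h y
    unfold Wrel at h1 h2
    exact ⟨by linarith, by linarith⟩
  · intro u hu v hv
    have e : 2 * u - (u - m) ^ 2 / (2 * D) - (2 * v - (v - m) ^ 2 / (2 * D)) =
        (u - v) * (2 - ((u - m) + (v - m)) / (2 * D)) := by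
      ring
    rw [e, mul_pow, mul_comm]
    refine mul_le_mul_of_nonneg_right ?_ (sq_nonneg _)
    have hDn : 0 ≤ D := M.WDiffStar_nonneg sig
    have h0 : 0 ≤ ((u - m) + (v - m)) / (2 * D) :=
      div_nonneg (by linarith [hu.1, hv.1]) (by positivity)
    have h1 : ((u - m) + (v - m)) / (2 * D) ≤ 1 := by
      rcases hDn.eq_or_lt with h4 | h4
      · rw [← h4]; simp
      · rw [div_le_one (by positivity)]; linarith [hu.2, hv.2]
    nlinarith

/-- The expectation of the subtracted square is a variance plus the square of E − m', where E is the
expected next W and m' its minimum; this variance is the one gained. What remains is u² ≤ (E − m')²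
+ σ²D for the relative value u = σ²/2 + E − m. It holds because minima do not increase with the step
(m' ≤ m), so E − m' ≥ u − σ²/2, and because 0 ≤ u ≤ D. -/
theorem potential_step (h : Fin H) (s : S) :
    sig h s (π h s) ^ 2 / 2 + M.nextExp s (π h s) (M.potential sig π (h + 1)) +
      M.nextVar s (π h s) (M.W sig π (h + 1)) / (2 * M.WDiffStar sig) ≤
    M.potential sig π h s := by
  set D := M.WDiffStar sig with hD
  have hDn : 0 ≤ D := M.WDiffStar_nonneg sig
  set a := π h s with ha
  set σ2 := sig h s a ^ 2 with hσ
  set m := ⨅ s', M.W sig π h s' with hm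
  set m' := ⨅ s', M.W sig π (h + 1) s' with hm'
  set E := M.nextExp s a (M.W sig π (h + 1)) with hE
  have hW : M.W sig π h s = σ2 / 2 + E := M.W_step sig π h s
  have hσn : 0 ≤ σ2 := sq_nonneg _
  have : Nonempty S := ⟨s⟩
  have hmm : m' ≤ m := by
    refine le_ciInf fun s' => ?_
    rw [M.W_step]
    have h1 : m' ≤ M.nextExp s' (π h s') (M.W sig π (h + 1)) := by
      rw [← M.nextExp_const s' (π h s') m']
      exact M.nextExp_mono _ _ fun y _ => ciInf_le (Set.finite_range _).bddBelow y
    linarith [sq_nonneg (sig h s' (π h s'))]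
  have hvar : M.nextExp s a (fun y => M.Wrel sig π (h + 1) y ^ 2) =
      M.nextVar s a (M.W sig π (h + 1)) + (E - m') ^ 2 := by
    have := sum_mul_sub_sq (f := M.W sig π (h + 1)) (M.P_sum s a) m'
    exact this
  have hpot : M.nextExp s a (M.potential sig π (h + 1)) = 2 * E -
      (M.nextVar s a (M.W sig π (h + 1)) + (E - m') ^ 2) / (2 * D) := by
    rw [← hvar]
    have e : M.potential sig π (h + 1) = fun y => 2 * M.W sig π (h + 1) y -
        (2 * D)⁻¹ * (fun y => M.Wrel sig π (h + 1) y ^ 2) y := by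
      funext y
      simp only [potential]
      rw [div_eq_inv_mul]
    rw [e, M.nextExp_sub, M.nextExp_const_mul, M.nextExp_const_mul, div_eq_inv_mul]
  have hu0 := M.Wrel_nonneg sig π h s
  have hu1 := M.Wrel_le_WDiffStar sig π h s
  have hu : M.Wrel sig π h s = σ2 / 2 + E - m := by rw [Wrel, hW]
  rw [hpot, potential, hW, hu]
  rw [hu] at hu0 hu1
  rw [← hD] at hu1 ⊢
  rcases hDn.eq_or_lt with h4 | h4
  · rw [← h4]; simp; linarith
  · have key : (σ2 / 2 + E - m) ^ 2 / (2 * D) ≤ σ2 / 2 + (E - m') ^ 2 / (2 * D) := by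
      rw [div_le_iff₀ (by positivity), add_mul, div_mul_cancel₀ _ (by positivity)]
      nlinarith [mul_nonneg hu0 (sub_nonneg.2 hmm), mul_nonneg hσn (sub_nonneg.2 hu1),
        sq_nonneg (σ2 / 2 - (m - m'))]
    rw [add_div]
    linarith

end Potential

end TabularMDP

/-! ## Concentration of the empirical model -/

theorem measure_biUnion_le_ofReal_sum {Ω ι : Type*} [MeasurableSpace Ω] {μ : Measure Ω}
    (s : Finset ι) (B : ι → Set Ω) (w : ι → ℝ) (hw : ∀ i ∈ s, 0 ≤ w i)
    (hB : ∀ i ∈ s, μ (B i) ≤ ENNReal.ofReal (w i)) :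
    μ (⋃ i ∈ s, B i) ≤ ENNReal.ofReal (∑ i ∈ s, w i) := by
  rw [ENNReal.ofReal_sum_of_nonneg hw]
  exact (measure_biUnion_finset_le s B).trans (Finset.sum_le_sum hB)

/-- Logarithmic confidence level of the `j`-th peeling epoch. -/
noncomputable def peelLog (c : ℝ) (j : ℕ) : ℝ := Real.log (c * (2 + j * Real.log 2) ^ 2)

theorem peel_base_ge_two (j : ℕ) : 2 ≤ 2 + (j : ℝ) * Real.log 2 := by
  have := Real.log_pos (x := 2) (by norm_num)
  have : 0 ≤ (j : ℝ) * Real.log 2 := by positivity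
  linarith

theorem exp_neg_peelLog {c : ℝ} (hc : 0 < c) (j : ℕ) :
    Real.exp (-peelLog c j) = c⁻¹ * (1 / (2 + j * Real.log 2) ^ 2) := by
  have := peel_base_ge_two j
  unfold peelLog
  rw [Real.exp_neg, Real.exp_log (by positivity), mul_inv, one_div]

theorem peelLog_pos {c : ℝ} (hc : 1 ≤ c) (j : ℕ) : 0 < peelLog c j := by
  have := peel_base_ge_two j
  refine Real.log_pos ?_
  nlinarith

/-- The level of the epoch of a sample size `N ≤ n` is at most that of `n`. -/
theorem peelLog_le {c : ℝ} (hc : 0 < c) {N : ℕ} (hN : 0 < N) {n : ℝ} (hn : N ≤ n) :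
    peelLog c (Nat.log 2 N) ≤ Real.log (c * Real.log (Real.exp 2 * n) ^ 2) := by
  have hN0 : (0 : ℝ) < N := by positivity
  have h1 : (Nat.log 2 N : ℝ) * Real.log 2 ≤ Real.log n := by
    rw [← Real.log_pow]
    exact Real.log_le_log (by positivity) ((two_pow_log_le_cast hN).trans hn)
  have h2 : Real.log (Real.exp 2 * n) = 2 + Real.log n := by
    rw [Real.log_mul (Real.exp_pos 2).ne' (by linarith), Real.log_exp]
  have h3 := peel_base_ge_two (Nat.log 2 N)
  rw [h2]
  unfold peelLog
  refine Real.log_le_log (by positivity) ?_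
  gcongr

namespace Interaction

section Concentration

variable {S A : Type*} [Fintype S] [Fintype A] {H : ℕ} {Ω : Type*} [mΩ : MeasurableSpace Ω]
  {I : Interaction S A H Ω} {M : TabularMDP S A H}
  {Sinit : Set S} {μ : Measure Ω} [IsProbabilityMeasure μ] {ℱ : Filtration (ℕ ×ₗ ℕ) mΩ}

theorem N_le (I : Interaction S A H Ω) (k : ℕ) (ω : Ω) (x : S) (b : A) :
    I.N k ω x b ≤ (k - 1) * H := by
  classical
  unfold N
  calc _ ≤ ∑ i ∈ Finset.Ico 1 k, ∑ h : Fin H, 1 :=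
        Finset.sum_le_sum fun i _ => Finset.sum_le_sum fun h _ => by split_ifs <;> simp
    _ = _ := by simp

/-- Error of the empirical model in the optimal backup. -/
noncomputable def backupError (I : Interaction S A H Ω) (M : TabularMDP S A H) (k : ℕ) (ω : Ω)
    (j : Fin H) (x : S) (b : A) : ℝ :=
  I.rHat k ω x b + ∑ y, I.PHat k ω x b y * M.Vstar (j + 1) y - M.Qstar j x b

/-- Error of the empirical model in the expectation of `f`. -/
noncomputable def expError (I : Interaction S A H Ω) (M : TabularMDP S A H) (k : ℕ) (ω : Ω)
    (x : S) (b : A) (f : S → ℝ) : ℝ :=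
  ∑ y, I.PHat k ω x b y * f y - M.nextExp x b f

theorem backupError_abs_lt_of_not_mem {t : ℝ} (ht : 0 < t) {N σ l D : ℝ} (hN : 0 < N)
    (h1 : ¬ σ ^ 2 * t ^ 2 / 2 * N + l ≤ t * (N * D))
    (h2 : ¬ σ ^ 2 * (-t) ^ 2 / 2 * N + l ≤ -t * (N * D)) :
    |D| ≤ t * σ ^ 2 / 2 + l / (t * N) := by
  have htN : 0 < t * N := by positivity
  have e : (t * σ ^ 2 / 2 + l / (t * N)) * (t * N) = σ ^ 2 * t ^ 2 / 2 * N + l := by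
    field_simp
  rw [abs_le]
  constructor
  · refine le_of_mul_le_mul_right ?_ htN
    rw [neg_mul, e]
    nlinarith
  · refine le_of_mul_le_mul_right ?_ htN
    rw [e]
    nlinarith

theorem InMDP.measure_backupError_linear (hI : I.InMDP M Sinit μ ℱ)
    {sig : Fin H → S → A → ℝ} {Valpha : ℝ} (hsub : I.SubExp M μ ℱ sig Valpha) {t : ℝ}
    (ht : 0 < t) (htα : t * Valpha ≤ 1) (l : ℝ) (K : ℕ) :
    μ {ω | ∃ k, 1 ≤ k ∧ k ≤ K ∧ ∃ j x b, 0 < I.N k ω x b ∧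
      ¬ |I.backupError M k ω j x b| ≤ t * sig j x b ^ 2 / 2 + l / (t * I.N k ω x b)} ≤
    ENNReal.ofReal (2 * (H * Fintype.card S * Fintype.card A) * Real.exp (-l)) := by
  have hB : ∀ ε ∈ ({t, -t} : Finset ℝ), |ε| * Valpha ≤ 1 := by
    intro ε hε
    simp only [Finset.mem_insert, Finset.mem_singleton] at hε
    rcases hε with rfl | rfl
    · rwa [abs_of_pos ht]
    · rwa [abs_neg, abs_of_pos ht]
  have h := measure_biUnion_le_ofReal_sum (μ := μ)
    (({t, -t} : Finset ℝ) ×ˢ (Finset.univ : Finset (Fin H × S × A)))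
    (fun p => {ω | ∃ k, 1 ≤ k ∧ k ≤ K ∧ 0 < I.N k ω p.2.2.1 p.2.2.2 ∧
        sig p.2.1 p.2.2.1 p.2.2.2 ^ 2 * p.1 ^ 2 / 2 * I.N k ω p.2.2.1 p.2.2.2 + l ≤
          p.1 * (I.N k ω p.2.2.1 p.2.2.2 * (I.backupError M k ω p.2.1 p.2.2.1 p.2.2.2))})
    (fun _ => Real.exp (-l)) (fun _ _ => Real.exp_nonneg _) (fun p hp =>
      hI.measure_backup_deviation_le hsub p.2.1 p.2.2.1 p.2.2.2
        (hB p.1 (Finset.mem_product.1 hp).1) l K)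
  refine (measure_mono ?_).trans (h.trans (le_of_eq ?_))
  · rintro ω ⟨k, hk1, hk2, j, x, b, hN, hneg⟩
    by_contra hcon
    simp only [Set.mem_iUnion, not_exists] at hcon
    refine hneg (backupError_abs_lt_of_not_mem ht (by positivity) (fun h1 => ?_) fun h1 => ?_)
    · exact hcon (t, j, x, b) (by simp) ⟨k, hk1, hk2, hN, h1⟩
    · exact hcon (-t, j, x, b) (by simp) ⟨k, hk1, hk2, hN, h1⟩
  · rw [Finset.sum_const, Finset.card_product, Finset.card_pair (by linarith), Finset.card_univ]
    simp only [Fintype.card_prod, Fintype.card_fin, nsmul_eq_mul]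
    push_cast
    congr 1
    ring

/-- A union over the dyadic blocks of N whose exponent is admissible. For the other blocks the first
alternative holds deterministically, by `le_mul_sqrt_of_one_lt_peelRate_mul`. The constant 5 is two
signs times 5/2 from the weights. -/
theorem InMDP.measure_backupError_peeled (hI : I.InMDP M Sinit μ ℱ)
    {sig : Fin H → S → A → ℝ} (hsig : ∀ j x b, 0 ≤ sig j x b) {Valpha : ℝ} (hα : 0 ≤ Valpha)
    (hsub : I.SubExp M μ ℱ sig Valpha) {Vmax σ : ℝ} (hV : 0 ≤ Vmax) (hσ : 0 < σ)
    (hσ1 : ∀ j x b, 2 * sig j x b ≤ σ) (hσ2 : 2 * Valpha * Vmax ≤ σ ^ 2)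
    {c : ℝ} (hc : 1 ≤ c) (K : ℕ) :
    μ {ω | ∃ k, 1 ≤ k ∧ k ≤ K ∧ ∃ j x b, 0 < I.N k ω x b ∧
      ¬ (Vmax ≤ σ * √(peelLog c (Nat.log 2 (I.N k ω x b)) / I.N k ω x b) ∨
        |I.backupError M k ω j x b| ≤
          σ * √(peelLog c (Nat.log 2 (I.N k ω x b)) / I.N k ω x b))} ≤
    ENNReal.ofReal (5 * (H * Fintype.card S * Fintype.card A) * c⁻¹) := by
  classical
  have hc0 : 0 < c := by linarith
  have h := measure_biUnion_le_ofReal_sum (μ := μ)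
    ((Finset.range (K * H + 1)).filter fun i => peelRate (peelLog c i) σ i * Valpha ≤ 1)
    (fun i => {ω | ∃ k, 1 ≤ k ∧ k ≤ K ∧ ∃ j x b, 0 < I.N k ω x b ∧
      ¬ |I.backupError M k ω j x b| ≤ peelRate (peelLog c i) σ i * sig j x b ^ 2 / 2 +
        peelLog c i / (peelRate (peelLog c i) σ i * I.N k ω x b)})
    (fun i => 2 * (H * Fintype.card S * Fintype.card A) * Real.exp (-peelLog c i))
    (fun _ _ => by positivity) (fun i hi => hI.measure_backupError_linear hsub
      (peelRate_pos (peelLog_pos hc i) hσ i) (Finset.mem_filter.1 hi).2 _ K)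
  refine (measure_mono ?_).trans (h.trans (ENNReal.ofReal_le_ofReal ?_))
  · rintro ω ⟨k, hk1, hk2, j, x, b, hN, hneg⟩
    rw [not_or] at hneg
    set i := Nat.log 2 (I.N k ω x b) with hi
    have hl := peelLog_pos hc i
    have hrate : peelRate (peelLog c i) σ i * Valpha ≤ 1 := by
      by_contra hcon
      exact hneg.1 (le_mul_sqrt_of_one_lt_peelRate_mul hN hl hσ hα hV hσ2 (not_le.1 hcon))
    simp only [Set.mem_iUnion]
    refine ⟨i, Finset.mem_filter.2 ⟨?_, hrate⟩, k, hk1, hk2, j, x, b, hN, fun h1 => hneg.2 ?_⟩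
    · rw [Finset.mem_range]
      have h1 : i ≤ I.N k ω x b := Nat.log_le_self 2 _
      have h2 := I.N_le k ω x b
      have h3 : (k - 1) * H ≤ K * H := Nat.mul_le_mul_right _ (by omega)
      omega
    · refine h1.trans (le_trans ?_ (peel_bound hN hl hσ))
      have hr := (peelRate_pos hl hσ i).le
      -- The factor 2 in the scale turns the sub-exponential t·sig²/2 into tσ²/8, the Hoeffding form
      -- required by `peel_bound`.
      have hs : sig j x b ^ 2 ≤ (σ / 2) ^ 2 := by
        have := hσ1 j x b
        have := hsig j x b
        gcongr
        linarith
      have := mul_le_mul_of_nonneg_left hs hr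
      rw [← hi]
      linarith
  · rw [← Finset.mul_sum]
    have h1 : ∑ i ∈ (Finset.range (K * H + 1)).filter
        (fun i => peelRate (peelLog c i) σ i * Valpha ≤ 1), Real.exp (-peelLog c i) ≤
        c⁻¹ * (5 / 2) := by
      refine (Finset.sum_le_sum_of_subset_of_nonneg (Finset.filter_subset _ _)
        fun _ _ _ => Real.exp_nonneg _).trans ?_
      simp only [exp_neg_peelLog hc0, ← Finset.mul_sum]
      gcongr
      exact sum_peel_weight_le _
    calc _ ≤ 2 * ((H : ℝ) * Fintype.card S * Fintype.card A) * (c⁻¹ * (5 / 2)) := by gcongr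
      _ = _ := by ring

theorem InMDP.measure_expError_linear (hI : I.InMDP M Sinit μ ℱ) {ι : Type*} [Fintype ι]
    (x : ι → S) (b : ι → A) (f : ι → S → ℝ) (ν : ι → ℝ)
    (hν : ∀ i, ∑ y, M.P (x i) (b i) y * Real.exp (f i y - M.nextExp (x i) (b i) (f i)) ≤
      Real.exp (ν i)) (l : ℝ) (K : ℕ) :
    μ {ω | ∃ k, 1 ≤ k ∧ k ≤ K ∧ ∃ i, 0 < I.N k ω (x i) (b i) ∧
      ¬ I.expError M k ω (x i) (b i) (f i) ≤ ν i + l / I.N k ω (x i) (b i)} ≤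
    ENNReal.ofReal (Fintype.card ι * Real.exp (-l)) := by
  have h := measure_biUnion_le_ofReal_sum (μ := μ) (Finset.univ : Finset ι)
    (fun i => {ω | ∃ k, 1 ≤ k ∧ k ≤ K ∧ 0 < I.N k ω (x i) (b i) ∧
        ν i * I.N k ω (x i) (b i) + l ≤ I.N k ω (x i) (b i) *
          ∑ y, I.PHat k ω (x i) (b i) y * (f i y - M.nextExp (x i) (b i) (f i))})
    (fun _ => Real.exp (-l)) (fun _ _ => Real.exp_nonneg _) (fun i _ =>
      hI.measure_transition_deviation_le (x i) (b i)
        (fun y => f i y - M.nextExp (x i) (b i) (f i)) (hν i) l K)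
  refine (measure_mono ?_).trans (h.trans (le_of_eq ?_))
  · rintro ω ⟨k, hk1, hk2, i, hN, hneg⟩
    simp only [Set.mem_iUnion]
    refine ⟨i, Finset.mem_univ _, k, hk1, hk2, hN, ?_⟩
    have hN0 : (0 : ℝ) < I.N k ω (x i) (b i) := by positivity
    have e : ∑ y, I.PHat k ω (x i) (b i) y * (f i y - M.nextExp (x i) (b i) (f i)) =
        I.expError M k ω (x i) (b i) (f i) := by
      simp only [expError, mul_sub, Finset.sum_sub_distrib, ← Finset.sum_mul, I.PHat_sum hN,
        one_mul]
    rw [e]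
    have h1 := mul_le_mul_of_nonneg_right (not_le.1 hneg).le hN0.le
    rw [add_mul, div_mul_cancel₀ _ hN0.ne'] at h1
    linarith
  · simp

theorem expError_const (I : Interaction S A H Ω) (M : TabularMDP S A H) {k : ℕ} {ω : Ω} {x : S}
    {b : A} (hN : 0 < I.N k ω x b) (c : ℝ) : I.expError M k ω x b (fun _ => c) = 0 := by
  rw [expError, M.nextExp_const, ← Finset.sum_mul, I.PHat_sum hN, one_mul, sub_self]

theorem expError_const_mul (I : Interaction S A H Ω) (M : TabularMDP S A H) (k : ℕ) (ω : Ω) (x : S)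
    (b : A) (c : ℝ) (f : S → ℝ) :
    I.expError M k ω x b (fun y => c * f y) = c * I.expError M k ω x b f := by
  rw [expError, expError, M.nextExp_const_mul, mul_sub, Finset.mul_sum]
  congr 1
  exact Finset.sum_congr rfl fun y _ => by ring

variable (sig : Fin H → S → A → ℝ) (π : Policy S A H)

theorem potential_eq_const_of_WDiffStar_eq_zero (h0 : M.WDiffStar sig = 0) (h : ℕ) :
    M.potential sig π h = fun _ => 2 * ⨅ s', M.W sig π h s' := by
  funext s
  have := M.potential_mem_Icc sig π h s
  rw [h0] at this
  exact le_antisymm (by linarith [this.2]) this.1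

/-- Scale the potential by 1/(8D): its centred values then lie in [−1, 1], and its variance is at
most 4 Var(W)/(8D)² = (8D)⁻¹ · Var(W)/(2D). Multiplying back by 8D leaves exactly the variance that
`potential_step` can pay. For D = 0 the potential is constant in the state and has no error. -/
theorem InMDP.measure_potential_linear (hI : I.InMDP M Sinit μ ℱ) (l : ℝ) (K : ℕ) :
    μ {ω | ∃ k, 1 ≤ k ∧ k ≤ K ∧ ∃ (j : Fin H) (x : S) (b : A), 0 < I.N k ω x b ∧
      ¬ I.expError M k ω x b (M.potential sig π (j + 1)) ≤
        M.nextVar x b (M.W sig π (j + 1)) / (2 * M.WDiffStar sig) +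
          8 * M.WDiffStar sig * l / I.N k ω x b} ≤
    ENNReal.ofReal (H * Fintype.card S * Fintype.card A * Real.exp (-l)) := by
  set D := M.WDiffStar sig with hD
  rcases (M.WDiffStar_nonneg sig).eq_or_lt with h0 | h0
  · refine le_trans (le_of_eq ?_) zero_le
    refine measure_mono_null (t := ∅) ?_ measure_empty
    rintro ω ⟨k, hk1, hk2, j, x, b, hN, hneg⟩
    refine absurd ?_ hneg
    rw [potential_eq_const_of_WDiffStar_eq_zero sig π h0.symm, I.expError_const M hN, hD, ← h0]
    simp
  · rw [← hD] at h0
    have h := hI.measure_expError_linear (fun i : Fin H × S × A => i.2.1) (fun i => i.2.2)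
      (fun i y => (8 * D)⁻¹ * M.potential sig π (i.1 + 1) y)
      (fun i => (8 * D)⁻¹ * (M.nextVar i.2.1 i.2.2 (M.W sig π (i.1 + 1)) / (2 * D))) ?_ l K
    · refine (measure_mono ?_).trans (h.trans (le_of_eq ?_))
      · rintro ω ⟨k, hk1, hk2, j, x, b, hN, hneg⟩
        refine ⟨k, hk1, hk2, (j, x, b), hN, fun hle => hneg ?_⟩
        simp only at hle hN
        rw [I.expError_const_mul] at hle
        refine le_of_mul_le_mul_left (hle.trans (le_of_eq ?_)) (inv_pos.2 (by positivity : 0 < 8 * D))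
        field_simp
      · simp only [Fintype.card_prod, Fintype.card_fin]
        push_cast
        congr 1
        ring
    · rintro ⟨j, x, b⟩
      simp only
      rw [M.nextExp_const_mul]
      set F := M.potential sig π (j + 1) with hF
      have hsub : ∀ y, (8 * D)⁻¹ * F y - (8 * D)⁻¹ * M.nextExp x b F =
          (8 * D)⁻¹ * (F y - M.nextExp x b F) := fun y => by ring
      simp only [hsub]
      have hmem : M.nextExp x b F ∈ Set.Icc (2 * ⨅ s', M.W sig π (j + 1) s')
          (2 * (⨅ s', M.W sig π (j + 1) s') + 3 / 2 * D) := by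
        constructor
        · rw [← M.nextExp_const x b (2 * ⨅ s', M.W sig π (j + 1) s')]
          exact M.nextExp_mono x b fun y _ => (M.potential_mem_Icc sig π (j + 1) y).1
        · rw [← M.nextExp_const x b (2 * (⨅ s', M.W sig π (j + 1) s') + 3 / 2 * D)]
          exact M.nextExp_mono x b fun y _ => (M.potential_mem_Icc sig π (j + 1) y).2
      refine (sum_mul_exp_le_of_abs_le_one (M.P_nonneg x b) (M.P_sum x b) (fun y => ?_) ?_).trans
        (Real.exp_le_exp.2 ?_)
      · rw [abs_mul, abs_of_pos (by positivity), inv_mul_le_iff₀ (by positivity), abs_le]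
        have := M.potential_mem_Icc sig π (j + 1) y
        constructor <;> linarith [hmem.1, hmem.2, this.1, this.2]
      · have : M.nextExp x b (fun y => (8 * D)⁻¹ * (F y - (fun _ => M.nextExp x b F) y)) = 0 := by
          rw [M.nextExp_const_mul, M.nextExp_sub, M.nextExp_const, sub_self, mul_zero]
        exact this
      · have e : ∑ y, M.P x b y * ((8 * D)⁻¹ * (F y - M.nextExp x b F)) ^ 2 =
            ((8 * D)⁻¹) ^ 2 * M.nextVar x b F := by
          rw [TabularMDP.nextVar, Finset.mul_sum]
          exact Finset.sum_congr rfl fun y _ => by ring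
        rw [e]
        have h1 := M.nextVar_potential_le sig π x b (j + 1)
        calc ((8 * D)⁻¹) ^ 2 * M.nextVar x b F ≤
            ((8 * D)⁻¹) ^ 2 * (4 * M.nextVar x b (M.W sig π (j + 1))) := by gcongr
          _ = _ := by field_simp; ring

/-- Hoeffding's lemma for the range 3D/2, with dyadic peeling. It serves the square-root branch of
the bonus, where no variance needs to be tracked. -/
theorem InMDP.measure_potential_peeled (hI : I.InMDP M Sinit μ ℱ) {c : ℝ} (hc : 1 ≤ c) (K : ℕ) :
    μ {ω | ∃ k, 1 ≤ k ∧ k ≤ K ∧ ∃ (j : Fin H) (x : S) (b : A), 0 < I.N k ω x b ∧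
      ¬ I.expError M k ω x b (M.potential sig π (j + 1)) ≤
        3 / 2 * M.WDiffStar sig * √(peelLog c (Nat.log 2 (I.N k ω x b)) / I.N k ω x b)} ≤
    ENNReal.ofReal (5 / 2 * (H * Fintype.card S * Fintype.card A) * c⁻¹) := by
  set D := M.WDiffStar sig with hD
  have hc0 : 0 < c := by linarith
  rcases (M.WDiffStar_nonneg sig).eq_or_lt with h0 | h0
  · refine le_trans (le_of_eq ?_) zero_le
    refine measure_mono_null (t := ∅) ?_ measure_empty
    rintro ω ⟨k, hk1, hk2, j, x, b, hN, hneg⟩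
    refine absurd ?_ hneg
    rw [potential_eq_const_of_WDiffStar_eq_zero sig π h0.symm, I.expError_const M hN, hD, ← h0]
    simp
  · rw [← hD] at h0
    have hσ : 0 < 3 / 2 * D := by positivity
    set t : ℕ → ℝ := fun i => peelRate (peelLog c i) (3 / 2 * D) i with ht
    have ht0 : ∀ i, 0 < t i := fun i => peelRate_pos (peelLog_pos hc i) hσ i
    have h := measure_biUnion_le_ofReal_sum (μ := μ) (Finset.range (K * H + 1))
      (fun i => {ω | ∃ k, 1 ≤ k ∧ k ≤ K ∧ ∃ p : Fin H × S × A, 0 < I.N k ω p.2.1 p.2.2 ∧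
        ¬ I.expError M k ω p.2.1 p.2.2 (fun y => t i * M.potential sig π (p.1 + 1) y) ≤
          t i ^ 2 * (3 / 2 * D) ^ 2 / 8 + peelLog c i / I.N k ω p.2.1 p.2.2})
      (fun i => Fintype.card (Fin H × S × A) * Real.exp (-peelLog c i))
      (fun _ _ => by positivity) (fun i _ =>
        hI.measure_expError_linear (fun p : Fin H × S × A => p.2.1) (fun p => p.2.2)
          (fun p y => t i * M.potential sig π (p.1 + 1) y)
          (fun _ => t i ^ 2 * (3 / 2 * D) ^ 2 / 8) (fun p => ?_) (peelLog c i) K)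
    · refine (measure_mono ?_).trans (h.trans (ENNReal.ofReal_le_ofReal ?_))
      · rintro ω ⟨k, hk1, hk2, j, x, b, hN, hneg⟩
        set i := Nat.log 2 (I.N k ω x b) with hi
        simp only [Set.mem_iUnion]
        have hN0 : (0 : ℝ) < I.N k ω x b := by positivity
        refine ⟨i, ?_, k, hk1, hk2, (j, x, b), hN, fun hle => hneg ?_⟩
        · rw [Finset.mem_range]
          have h1 : i ≤ I.N k ω x b := Nat.log_le_self 2 _
          have h2 := I.N_le k ω x b
          have h3 : (k - 1) * H ≤ K * H := Nat.mul_le_mul_right _ (by omega)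
          omega
        · simp only at hle
          rw [I.expError_const_mul] at hle
          refine le_trans ?_ (peel_bound hN (peelLog_pos hc i) hσ)
          refine le_of_mul_le_mul_left (hle.trans (le_of_eq ?_)) (ht0 i)
          have h1 : peelRate (peelLog c i) (3 / 2 * D) (Nat.log 2 (I.N k ω x b)) = t i := rfl
          have h2 := (ht0 i).ne'
          rw [h1]
          field_simp
      · rw [← Finset.mul_sum]
        simp only [exp_neg_peelLog hc0, ← Finset.mul_sum, Fintype.card_prod, Fintype.card_fin]
        push_cast
        calc _ ≤ ((H : ℝ) * (Fintype.card S * Fintype.card A)) * (c⁻¹ * (5 / 2)) := by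
              gcongr
              exact sum_peel_weight_le _
          _ = _ := by ring
    · rw [M.nextExp_const_mul]
      simp only [← mul_sub]
      exact sum_mul_exp_le_of_mem_Icc (M.P_nonneg _ _) (M.P_sum _ _)
        (fun y => M.potential_mem_Icc sig π (p.1 + 1) y) (t i)

/-- Concentration is applied once, to the indicator of each next state, whose variance is at most
its probability. The multiplier z enters only afterwards through `bern_peel_bound`, so the bound is
uniform in z and may later be used with a random, data-dependent z. -/
theorem InMDP.measure_transition_peeled (hI : I.InMDP M Sinit μ ℱ) {c : ℝ} (hc : 1 ≤ c) (K : ℕ) :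
    μ {ω | ∃ k, 1 ≤ k ∧ k ≤ K ∧ ∃ (x : S) (b : A) (y : S), 0 < I.N k ω x b ∧
      ¬ ∀ z : ℝ, 0 ≤ z → z ≤ 2 → z * |I.PHat k ω x b y - M.P x b y| ≤ M.P x b y * z ^ 2 / 12 +
        27 / 2 * peelLog c (Nat.log 2 (I.N k ω x b)) / I.N k ω x b} ≤
    ENNReal.ofReal (5 * (Fintype.card S ^ 2 * Fintype.card A) * c⁻¹) := by
  classical
  have hc0 : 0 < c := by linarith
  set t : ℕ → ℝ → ℝ := fun i p => bernRate (peelLog c i) p i with ht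
  have ht0 : ∀ i p, 0 < t i p := fun i p => bernRate_pos (peelLog_pos hc i) i
  have ht1 : ∀ i p, t i p ≤ 1 := fun i p => bernRate_le_one (peelLog_pos hc i) i
  have hexpc : ∀ x b y, M.nextExp x b (fun z => if z = y then 1 else 0) = M.P x b y := by
    intro x b y; simp [TabularMDP.nextExp]
  have hP1 : ∀ x b y, M.P x b y ≤ 1 := fun x b y => by
    rw [← M.P_sum x b]
    exact Finset.single_le_sum (fun z _ => M.P_nonneg x b z) (Finset.mem_univ y)
  have hlin : ∀ i, ∀ ε ∈ ({1, -1} : Finset ℝ),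
      μ {ω | ∃ k, 1 ≤ k ∧ k ≤ K ∧ ∃ q : S × A × S, 0 < I.N k ω q.1 q.2.1 ∧
        ¬ I.expError M k ω q.1 q.2.1 (fun z => ε * t i (M.P q.1 q.2.1 q.2.2) *
            (if z = q.2.2 then 1 else 0)) ≤
          t i (M.P q.1 q.2.1 q.2.2) ^ 2 * M.P q.1 q.2.1 q.2.2 +
            peelLog c i / I.N k ω q.1 q.2.1} ≤
      ENNReal.ofReal (Fintype.card (S × A × S) * Real.exp (-peelLog c i)) := by
    intro i ε hε
    have hε2 : ε ^ 2 = 1 := by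
      simp only [Finset.mem_insert, Finset.mem_singleton] at hε
      rcases hε with rfl | rfl <;> norm_num
    have hεa : |ε| = 1 := by
      simp only [Finset.mem_insert, Finset.mem_singleton] at hε
      rcases hε with rfl | rfl <;> norm_num
    refine hI.measure_expError_linear (fun q : S × A × S => q.1) (fun q => q.2.1) _ _ ?_ _ K
    rintro ⟨x, b, y⟩
    simp only
    rw [M.nextExp_const_mul, hexpc]
    set p := M.P x b y with hp
    simp only [← mul_sub]
    have hp0 : 0 ≤ p := M.P_nonneg x b y
    refine (sum_mul_exp_le_of_abs_le_one (M.P_nonneg x b) (M.P_sum x b) (fun z => ?_) ?_).trans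
        (Real.exp_le_exp.2 ?_)
    · rw [abs_mul, abs_mul, hεa, one_mul, abs_of_pos (ht0 _ _)]
      refine mul_le_one₀ (ht1 _ _) (abs_nonneg _) ?_
      rw [abs_le]
      have := hP1 x b y
      split_ifs <;> constructor <;> linarith
    · have : M.nextExp x b (fun z => (ε * t i p) * ((if z = y then 1 else 0) - (fun _ => p) z)) = 0 := by
        rw [M.nextExp_const_mul, M.nextExp_sub, hexpc, M.nextExp_const, sub_self, mul_zero]
      exact this
    · have e : ∑ z, M.P x b z * (ε * t i p * ((if z = y then 1 else 0) - p)) ^ 2 =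
          t i p ^ 2 * M.nextVar x b (fun z => if z = y then 1 else 0) := by
        rw [TabularMDP.nextVar, Finset.mul_sum]
        refine Finset.sum_congr rfl fun z _ => ?_
        rw [hexpc, mul_pow, mul_pow, hε2]
        ring
      rw [e]
      refine mul_le_mul_of_nonneg_left ?_ (sq_nonneg _)
      have h1 := M.nextExp_sq x b (fun z => if z = y then 1 else 0)
      have h2 : (fun z => (if z = y then (1 : ℝ) else 0) ^ 2) = fun z => if z = y then 1 else 0 := by
        funext z; split_ifs <;> norm_num
      rw [h2, hexpc] at h1
      nlinarith
  have h := measure_biUnion_le_ofReal_sum (μ := μ)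
    (({1, -1} : Finset ℝ) ×ˢ (Finset.range (K * H + 1))) _ _
    (fun r _ => by positivity) (fun r hr => hlin r.2 r.1 (Finset.mem_product.1 hr).1)
  refine (measure_mono ?_).trans (h.trans (ENNReal.ofReal_le_ofReal ?_))
  · rintro ω ⟨k, hk1, hk2, x, b, y, hN, hneg⟩
    set i := Nat.log 2 (I.N k ω x b) with hi
    have hN0 : (0 : ℝ) < I.N k ω x b := by positivity
    have himem : i ∈ Finset.range (K * H + 1) := by
      rw [Finset.mem_range]
      have h1 : i ≤ I.N k ω x b := Nat.log_le_self 2 _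
      have h2 := I.N_le k ω x b
      have h3 : (k - 1) * H ≤ K * H := Nat.mul_le_mul_right _ (by omega)
      omega
    by_contra hcon
    simp only [Set.mem_iUnion, not_exists] at hcon
    refine hneg fun z hz0 hz2 => ?_
    set p := M.P x b y with hp
    have hp0 : 0 ≤ p := M.P_nonneg x b y
    refine le_trans (mul_le_mul_of_nonneg_left ?_ hz0)
      (bern_peel_bound hN (peelLog_pos hc i) hp0 hz2)
    have herr : I.expError M k ω x b (fun z => if z = y then 1 else 0) =
        I.PHat k ω x b y - p := by
      rw [expError, hexpc]; simp [hp]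
    have hside : ∀ ε ∈ ({1, -1} : Finset ℝ),
        ε * (I.PHat k ω x b y - p) ≤ t i p * p + peelLog c i / (t i p * I.N k ω x b) := by
      intro ε hε
      have h1 : I.expError M k ω x b (fun z => ε * t i p * (if z = y then 1 else 0)) ≤
          t i p ^ 2 * p + peelLog c i / I.N k ω x b := by
        by_contra h1
        exact hcon (ε, i) (Finset.mem_product.2 ⟨hε, himem⟩) ⟨k, hk1, hk2, (x, b, y), hN, h1⟩
      rw [I.expError_const_mul, herr] at h1
      refine le_of_mul_le_mul_left ((le_of_eq ?_).trans (h1.trans (le_of_eq ?_))) (ht0 i p)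
      · ring
      · have := (ht0 i p).ne'
        field_simp
    rw [abs_le]
    have h1 := hside 1 (by simp)
    have h2 := hside (-1) (by simp)
    constructor <;> linarith
  · rw [Finset.sum_product]
    simp only [Finset.sum_const, Finset.card_pair (show (1 : ℝ) ≠ -1 by norm_num), nsmul_eq_mul,
      ← Finset.mul_sum, exp_neg_peelLog hc0, Fintype.card_prod]
    push_cast
    calc _ ≤ 2 * ((Fintype.card S : ℝ) * (Fintype.card A * Fintype.card S) * (c⁻¹ * (5 / 2))) := by
          gcongr
          exact sum_peel_weight_le _
      _ = _ := by ring

end Concentration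

end Interaction

/-! ## The concentration event -/

section Levels

variable {H nS nA : ℕ} {δ : ℝ}

theorem ell_base_ge (hH : 1 ≤ H) (hS : 1 ≤ nS) (hA : 1 ≤ nA) (hδ : 0 < δ) (hδ1 : δ ≤ 1) :
    32 * (nS : ℝ) ≤ 32 * H * nS * nA / δ := by
  have h1 : (1 : ℝ) ≤ H := by exact_mod_cast hH
  have h2 : (1 : ℝ) ≤ nS := by exact_mod_cast hS
  have h3 : (1 : ℝ) ≤ nA := by exact_mod_cast hA
  rw [le_div_iff₀ hδ]
  have h4 : (1 : ℝ) ≤ H * nA := one_le_mul_of_one_le_of_one_le h1 h3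
  calc 32 * (nS : ℝ) * δ ≤ 32 * nS * 1 := by gcongr
    _ ≤ 32 * nS * (H * nA) := by gcongr
    _ = _ := by ring

theorem ell1_eq (i : ℕ) : ell1 H nS nA i δ = Real.log (32 * H * nS * nA / δ * (i : ℝ) ^ 2) := by
  unfold ell1; congr 1; ring

theorem ell2_eq (k : ℕ) : ell2 H nS nA k δ =
    Real.log (32 * H * nS * nA / δ * Real.log (Real.exp 2 * (k * H)) ^ 2) := by
  unfold ell2
  rw [← mul_assoc]
  congr 1; ring

theorem exp_neg_ell1 (hH : 1 ≤ H) (hS : 1 ≤ nS) (hA : 1 ≤ nA) (hδ : 0 < δ) {i : ℕ} (hi : 1 ≤ i) :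
    Real.exp (-ell1 H nS nA i δ) = (32 * H * nS * nA / δ)⁻¹ * (1 / (i : ℝ) ^ 2) := by
  have h1 : (0 : ℝ) < H := by exact_mod_cast hH
  have h2 : (0 : ℝ) < nS := by exact_mod_cast hS
  have h3 : (0 : ℝ) < nA := by exact_mod_cast hA
  have h4 : (0 : ℝ) < i := by exact_mod_cast hi
  rw [ell1_eq, Real.exp_neg, Real.exp_log (by positivity), mul_inv, one_div]

theorem log_exp_two_mul {k : ℕ} (hk : 1 ≤ k) (hH : 1 ≤ H) :
    Real.log (Real.exp 2 * (k * H)) = 2 + Real.log (k * H) := by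
  have h1 : (0 : ℝ) < H := by exact_mod_cast hH
  have h2 : (0 : ℝ) < k := by exact_mod_cast hk
  rw [Real.log_mul (Real.exp_pos 2).ne' (by positivity), Real.log_exp]

theorem log_natCast_mul_nonneg {k : ℕ} (hk : 1 ≤ k) (hH : 1 ≤ H) : 0 ≤ Real.log ((k : ℝ) * H) := by
  refine Real.log_nonneg ?_
  have h1 : (1 : ℝ) ≤ H := by exact_mod_cast hH
  have h2 : (1 : ℝ) ≤ k := by exact_mod_cast hk
  exact one_le_mul_of_one_le_of_one_le h2 h1

theorem ell2_mono (hH : 1 ≤ H) (hS : 1 ≤ nS) (hA : 1 ≤ nA) (hδ : 0 < δ) {k K : ℕ} (hk : 1 ≤ k)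
    (hkK : k ≤ K) : ell2 H nS nA k δ ≤ ell2 H nS nA K δ := by
  have h1 : (0 : ℝ) < H := by exact_mod_cast hH
  have h2 : (0 : ℝ) < nS := by exact_mod_cast hS
  have h3 : (0 : ℝ) < nA := by exact_mod_cast hA
  have h4 : (0 : ℝ) < k := by exact_mod_cast hk
  have h5 : (k : ℝ) ≤ K := by exact_mod_cast hkK
  have h6 := log_natCast_mul_nonneg hk hH
  rw [ell2_eq, ell2_eq, log_exp_two_mul hk hH, log_exp_two_mul (hk.trans hkK) hH]
  have h7 : Real.log ((k : ℝ) * H) ≤ Real.log (K * H) :=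
    Real.log_le_log (by positivity) (by gcongr)
  refine Real.log_le_log (by positivity) ?_
  gcongr

theorem log_two_ge : (69 / 100 : ℝ) ≤ Real.log 2 := by
  have := Real.log_two_gt_d9; linarith

/-- `ℓ₂ ≥ log (128 S)`. -/
theorem ell2_ge (hH : 1 ≤ H) (hS : 1 ≤ nS) (hA : 1 ≤ nA) (hδ : 0 < δ) (hδ1 : δ ≤ 1) {k : ℕ}
    (hk : 1 ≤ k) : 97 / 20 + Real.log nS ≤ ell2 H nS nA k δ := by
  have h2 : (0 : ℝ) < nS := by exact_mod_cast hS
  have h5 := ell_base_ge hH hS hA hδ hδ1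
  have h6 := log_natCast_mul_nonneg hk hH
  rw [ell2_eq, log_exp_two_mul hk hH]
  have h8 : Real.log (128 * nS) ≤
      Real.log (32 * H * nS * nA / δ * (2 + Real.log (k * H)) ^ 2) := by
    refine Real.log_le_log (by positivity) ?_
    have : (4 : ℝ) ≤ (2 + Real.log (k * H)) ^ 2 := by nlinarith
    calc 128 * (nS : ℝ) = 32 * nS * 4 := by ring
      _ ≤ _ := by gcongr
  refine le_trans ?_ h8
  rw [Real.log_mul (by norm_num) h2.ne', show (128 : ℝ) = 2 ^ 7 by norm_num, Real.log_pow]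
  have := Real.log_two_gt_d9
  push_cast
  linarith

theorem ell2_pos (hH : 1 ≤ H) (hS : 1 ≤ nS) (hA : 1 ≤ nA) (hδ : 0 < δ) (hδ1 : δ ≤ 1) {k : ℕ}
    (hk : 1 ≤ k) : 97 / 20 ≤ ell2 H nS nA k δ := by
  have h1 := ell2_ge hH hS hA hδ hδ1 hk
  have h2 : 0 ≤ Real.log nS := Real.log_natCast_nonneg nS
  linarith

theorem ell1_one_ge (hH : 1 ≤ H) (hS : 1 ≤ nS) (hA : 1 ≤ nA) (hδ : 0 < δ) (hδ1 : δ ≤ 1) :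
    69 / 20 ≤ ell1 H nS nA 1 δ := by
  have h2 : (1 : ℝ) ≤ nS := by exact_mod_cast hS
  have h5 := ell_base_ge hH hS hA hδ hδ1
  rw [ell1_eq]
  have h8 : Real.log (2 ^ 5) ≤ Real.log (32 * H * nS * nA / δ * ((1 : ℕ) : ℝ) ^ 2) := by
    refine Real.log_le_log (by norm_num) ?_
    simp only [Nat.cast_one, one_pow, mul_one]
    linarith
  refine le_trans ?_ h8
  rw [Real.log_pow]
  have := Real.log_two_gt_d9
  push_cast
  linarith

theorem ell1_eq_add (hH : 1 ≤ H) (hS : 1 ≤ nS) (hA : 1 ≤ nA) (hδ : 0 < δ) {i : ℕ} (hi : 1 ≤ i) :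
    ell1 H nS nA i δ = ell1 H nS nA 1 δ + 2 * Real.log i := by
  have h1 : (0 : ℝ) < H := by exact_mod_cast hH
  have h2 : (0 : ℝ) < nS := by exact_mod_cast hS
  have h3 : (0 : ℝ) < nA := by exact_mod_cast hA
  have h4 : (0 : ℝ) < i := by exact_mod_cast hi
  rw [ell1_eq, ell1_eq, Real.log_mul (by positivity) (by positivity), Real.log_pow]
  simp

theorem ell1_pos (hH : 1 ≤ H) (hS : 1 ≤ nS) (hA : 1 ≤ nA) (hδ : 0 < δ) (hδ1 : δ ≤ 1) {i : ℕ}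
    (hi : 1 ≤ i) : 0 < ell1 H nS nA i δ := by
  have h1 := ell1_one_ge hH hS hA hδ hδ1
  have h2 : 0 ≤ Real.log i := Real.log_natCast_nonneg i
  rw [ell1_eq_add hH hS hA hδ hi]
  linarith

end Levels

/-! ### Definition and probability of the accuracy event -/

namespace Interaction

section Event

variable {S A : Type*} [Fintype S] [Fintype A] [Nonempty A] {H : ℕ} {Ω : Type*}
  [mΩ : MeasurableSpace Ω] {I : Interaction S A H Ω} {M : TabularMDP S A H}
  {Sinit : Set S} {μ : Measure Ω} [IsProbabilityMeasure μ] {ℱ : Filtration (ℕ ×ₗ ℕ) mΩ}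

/-- Accuracy of the empirical model before episode `k`. -/
structure Concentrated (I : Interaction S A H Ω) (M : TabularMDP S A H)
    (sig : Fin H → S → A → ℝ) (Vmax σ lam l l₁ l₂ L : ℝ) (k : ℕ) (ω : Ω) : Prop where
  backup_linear : ∀ j x b, 0 < I.N k ω x b →
    |I.backupError M k ω j x b| ≤ lam * sig j x b ^ 2 / 2 + l / (lam * I.N k ω x b)
  backup_sqrt : ∀ j x b, 0 < I.N k ω x b → Vmax ≤ σ * √(l₂ / I.N k ω x b) ∨
    |I.backupError M k ω j x b| ≤ σ * √(l₂ / I.N k ω x b)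
  potential_linear : ∀ (j : Fin H) x b, 0 < I.N k ω x b →
    I.expError M k ω x b (M.potential sig M.optPolicy (j + 1)) ≤
      M.nextVar x b (M.W sig M.optPolicy (j + 1)) / (2 * M.WDiffStar sig) +
        8 * M.WDiffStar sig * l₁ / I.N k ω x b
  potential_sqrt : ∀ (j : Fin H) x b, 0 < I.N k ω x b →
    I.expError M k ω x b (M.potential sig M.optPolicy (j + 1)) ≤
      3 / 2 * M.WDiffStar sig * √(l₂ / I.N k ω x b)
  transition : ∀ x b y, 0 < I.N k ω x b → ∀ z : ℝ, 0 ≤ z → z ≤ 2 →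
    z * |I.PHat k ω x b y - M.P x b y| ≤ M.P x b y * z ^ 2 / 12 + 27 / 2 * L / I.N k ω x b

/-- The five failures cost at most 4/32, 5/32, 1/32, 5/64 and 5/32 of δ, in the order of the fields
of `Concentrated`; the sum 35/64 is rounded up to 18/32. -/
theorem InMDP.measure_not_concentrated_le [Nonempty S] (hI : I.InMDP M Sinit μ ℱ) (hH : 1 ≤ H)
    {sig : Fin H → S → A → ℝ} (hsig : ∀ j x b, 0 ≤ sig j x b) {Valpha : ℝ} (hα : 0 ≤ Valpha)
    (hsub : I.SubExp M μ ℱ sig Valpha) {Vmax σ : ℝ} (hV : 0 ≤ Vmax) (hσ : 0 < σ)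
    (hσ1 : ∀ j x b, 2 * sig j x b ≤ σ) (hσ2 : 2 * Valpha * Vmax ≤ σ ^ 2)
    {δ : ℝ} (hδ : 0 < δ) (hδ1 : δ ≤ 1) {lam : ℕ → ℝ} {ι : ℕ → ℕ}
    (hlam : ∀ i, 1 ≤ i → 0 < lam i) (hlamα : ∀ i, 1 ≤ i → lam i * Valpha ≤ 1)
    (hι : ∀ k, 1 ≤ k → 1 ≤ ι k) (K : ℕ) :
    μ {ω | ¬ ∀ k, 1 ≤ k → k ≤ K → I.Concentrated M sig Vmax σ (lam (ι k))
      (ell1 H (Fintype.card S) (Fintype.card A) (ι k) δ)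
      (ell1 H (Fintype.card S) (Fintype.card A) 1 δ)
      (ell2 H (Fintype.card S) (Fintype.card A) k δ)
      (ell2 H (Fintype.card S) (Fintype.card A) K δ + Real.log (Fintype.card S)) k ω} ≤
    ENNReal.ofReal (18 / 32 * δ) := by
  classical
  have hS : 1 ≤ Fintype.card S := Fintype.card_pos
  have hA : 1 ≤ Fintype.card A := Fintype.card_pos
  set nS := Fintype.card S with hnS
  set nA := Fintype.card A with hnA
  have hH' : (1 : ℝ) ≤ H := by exact_mod_cast hH
  have hS' : (1 : ℝ) ≤ nS := by exact_mod_cast hS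
  have hA' : (1 : ℝ) ≤ nA := by exact_mod_cast hA
  set c := 32 * H * nS * nA / δ with hc
  have hcge := ell_base_ge hH hS hA hδ hδ1
  rw [← hc] at hcge
  have hc1 : 1 ≤ c := by linarith
  have hc0 : 0 < c := by linarith
  have hcS : 1 ≤ c * nS := one_le_mul_of_one_le_of_one_le hc1 hS'
  have hcc : ((H : ℝ) * nS * nA) * c⁻¹ = δ / 32 := by
    rw [hc]; field_simp
  -- The union runs over the distinct values of ι rather than over episodes, since the event for an
  -- exponent is already uniform in k. Hence ℓ₁(i) needs only i², with ∑ 1/i² ≤ 2.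
  have h1 := measure_biUnion_le_ofReal_sum (μ := μ) ((Finset.Icc 1 K).image ι)
    (fun i => {ω | ∃ k, 1 ≤ k ∧ k ≤ K ∧ ∃ j x b, 0 < I.N k ω x b ∧
      ¬ |I.backupError M k ω j x b| ≤ lam i * sig j x b ^ 2 / 2 +
        ell1 H nS nA i δ / (lam i * I.N k ω x b)})
    (fun i => 2 * (H * nS * nA) * Real.exp (-ell1 H nS nA i δ)) (fun _ _ => by positivity)
    (fun i hi => by
      obtain ⟨k, hk, rfl⟩ := Finset.mem_image.1 hi
      have hk1 := hι k (Finset.mem_Icc.1 hk).1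
      exact hI.measure_backupError_linear hsub (hlam _ hk1) (hlamα _ hk1) _ K)
  have h1' : ∑ i ∈ (Finset.Icc 1 K).image ι, 2 * ((H : ℝ) * nS * nA) *
      Real.exp (-ell1 H nS nA i δ) ≤ 4 / 32 * δ := by
    have hT : ∀ i ∈ (Finset.Icc 1 K).image ι, 1 ≤ i := by
      intro i hi
      obtain ⟨k, hk, rfl⟩ := Finset.mem_image.1 hi
      exact hι k (Finset.mem_Icc.1 hk).1
    rw [Finset.sum_congr rfl fun i hi => by
      rw [exp_neg_ell1 hH hS hA hδ (hT i hi), ← hc, ← mul_assoc, mul_assoc 2, hcc]]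
    rw [← Finset.mul_sum]
    have := sum_inv_sq_le_two _ hT
    nlinarith
  have h2 := hI.measure_backupError_peeled hsig hα hsub hV hσ hσ1 hσ2 hc1 K
  have h3 := hI.measure_potential_linear sig M.optPolicy (ell1 H nS nA 1 δ) K
  have h4 := hI.measure_potential_peeled sig M.optPolicy hc1 K
  have h5 := hI.measure_transition_peeled hcS K
  rw [← hnS, ← hnA] at h2 h3 h4 h5
  have e3 : (H : ℝ) * nS * nA * Real.exp (-ell1 H nS nA 1 δ) = 1 / 32 * δ := by
    rw [exp_neg_ell1 hH hS hA hδ le_rfl, ← hc, ← mul_assoc, hcc]; norm_num; ring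
  have e2 : 5 * ((H : ℝ) * nS * nA) * c⁻¹ = 5 / 32 * δ := by rw [mul_assoc, hcc]; ring
  have e4 : 5 / 2 * ((H : ℝ) * nS * nA) * c⁻¹ = 5 / 64 * δ := by rw [mul_assoc, hcc]; ring
  -- There are S²A triples instead of HSA. Raising the level by a factor S, which is the log S in
  -- `L`, restores the balance.
  have e5 : 5 * ((nS : ℝ) ^ 2 * nA) * (c * nS)⁻¹ ≤ 5 / 32 * δ := by
    have : 5 * ((nS : ℝ) ^ 2 * nA) * (c * nS)⁻¹ = 5 / 32 * δ / H := by
      rw [hc]; field_simp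
    rw [this]
    exact div_le_self (by positivity) hH'
  rw [e2] at h2
  rw [e3] at h3
  rw [e4] at h4
  have key := (measure_union_le _ _).trans (add_le_add (measure_union_le _ _ |>.trans
    (add_le_add (measure_union_le _ _ |>.trans (add_le_add (measure_union_le _ _ |>.trans
      (add_le_add (h1.trans (ENNReal.ofReal_le_ofReal h1')) h2)) h3)) h4))
    (h5.trans (ENNReal.ofReal_le_ofReal e5)))
  rw [← ENNReal.ofReal_add (by positivity) (by positivity),
    ← ENNReal.ofReal_add (by positivity) (by positivity),
    ← ENNReal.ofReal_add (by positivity) (by positivity),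
    ← ENNReal.ofReal_add (by positivity) (by positivity)] at key
  refine (measure_mono ?_).trans (key.trans (ENNReal.ofReal_le_ofReal (by linarith)))
  intro ω hω
  by_contra hcon
  simp only [Set.mem_union, not_or] at hcon
  obtain ⟨⟨⟨⟨g1, g2⟩, g3⟩, g4⟩, g5⟩ := hcon
  refine hω fun k hk1 hk2 => ?_
  have hNk : ∀ x b, ((I.N k ω x b : ℕ) : ℝ) ≤ (k : ℝ) * H := fun x b => by
    have h6 := I.N_le k ω x b
    have h7 : (k - 1) * H ≤ k * H := Nat.mul_le_mul_right _ (by omega)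
    exact_mod_cast h6.trans h7
  have hkK : (k : ℝ) ≤ K := by exact_mod_cast hk2
  have hl2 : ∀ x b, 0 < I.N k ω x b →
      peelLog c (Nat.log 2 (I.N k ω x b)) ≤ ell2 H nS nA k δ := fun x b hN => by
    rw [ell2_eq]
    exact peelLog_le hc0 hN (hNk x b)
  have hL : ∀ x b, 0 < I.N k ω x b →
      peelLog (c * nS) (Nat.log 2 (I.N k ω x b)) ≤ ell2 H nS nA K δ + Real.log nS := by
    intro x b hN
    have h6 := peelLog_le (c := c * nS) (by positivity) hN (n := (K : ℝ) * H)
      ((hNk x b).trans (by gcongr))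
    refine h6.trans (le_of_eq ?_)
    rw [ell2_eq, ← hc, mul_right_comm, Real.log_mul _ (by positivity)]
    have h7 := log_natCast_mul_nonneg (hk1.trans hk2) hH
    rw [log_exp_two_mul (hk1.trans hk2) hH]
    positivity
  refine ⟨fun j x b hN => ?_, fun j x b hN => ?_, fun j x b hN => ?_, fun j x b hN => ?_,
    fun x b y hN z hz0 hz2 => ?_⟩
  · by_contra hc'
    refine g1 ?_
    simp only [Set.mem_iUnion]
    exact ⟨ι k, Finset.mem_image_of_mem _ (Finset.mem_Icc.2 ⟨hk1, hk2⟩), k, hk1, hk2, j, x, b, hN,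
      hc'⟩
  · by_contra hc'
    refine g2 ⟨k, hk1, hk2, j, x, b, hN, not_or.1 fun h6 => hc' ?_⟩
    have h7 : σ * √(peelLog c (Nat.log 2 (I.N k ω x b)) / I.N k ω x b) ≤
        σ * √(ell2 H nS nA k δ / I.N k ω x b) := by
      gcongr
      exact hl2 x b hN
    exact h6.imp (fun h => h.trans h7) fun h => h.trans h7
  · by_contra hc'
    exact g3 ⟨k, hk1, hk2, j, x, b, hN, hc'⟩
  · by_contra hc'
    refine g4 ⟨k, hk1, hk2, j, x, b, hN, fun h6 => hc' (h6.trans ?_)⟩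
    have := M.WDiffStar_nonneg sig
    gcongr
    exact hl2 x b hN
  · by_contra hc'
    refine g5 ⟨k, hk1, hk2, x, b, y, hN, fun h6 => hc' ((h6 z hz0 hz2).trans ?_)⟩
    gcongr
    exact hL x b hN

end Event

end Interaction

/-! ## Quasi-optimism and the error recursion -/

namespace TabularMDP

section Bounds

variable {S A : Type*} [Fintype S] [Fintype A] [Nonempty A] {H : ℕ} {M : TabularMDP S A H}
  {Vmax : ℝ}

theorem Vmax_nonneg [Nonempty S] (hH : 1 ≤ H)
    (hV : ∀ (π : Policy S A H) (h : Fin H) (s : S), 0 ≤ M.V π h s ∧ M.V π h s ≤ Vmax) :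
    0 ≤ Vmax := by
  obtain ⟨s⟩ := ‹Nonempty S›
  have := hV M.optPolicy ⟨0, hH⟩ s
  exact this.1.trans this.2

theorem V_mem (hV0 : 0 ≤ Vmax)
    (hV : ∀ (π : Policy S A H) (h : Fin H) (s : S), 0 ≤ M.V π h s ∧ M.V π h s ≤ Vmax)
    (π : Policy S A H) (h : ℕ) (s : S) : 0 ≤ M.V π h s ∧ M.V π h s ≤ Vmax := by
  by_cases hh : h < H
  · exact hV π ⟨h, hh⟩ s
  · rw [M.V_of_le π (not_lt.1 hh)]; exact ⟨le_rfl, hV0⟩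

theorem Vstar_mem (hV0 : 0 ≤ Vmax)
    (hV : ∀ (π : Policy S A H) (h : Fin H) (s : S), 0 ≤ M.V π h s ∧ M.V π h s ≤ Vmax)
    (h : ℕ) (s : S) : 0 ≤ M.Vstar h s ∧ M.Vstar h s ≤ Vmax := by
  rw [M.Vstar_eq]; exact V_mem hV0 hV _ h s

/-- The value at the last step of the policy that always plays `a` is the mean reward itself. -/
theorem r_nonneg (hH : 1 ≤ H)
    (hV : ∀ (π : Policy S A H) (h : Fin H) (s : S), 0 ≤ M.V π h s ∧ M.V π h s ≤ Vmax)
    (s : S) (a : A) : 0 ≤ M.r s a := by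
  have h1 := (hV (fun _ _ => a) ⟨H - 1, by omega⟩ s).1
  rw [M.V_step] at h1
  simpa [M.V_of_le _ (show H ≤ H - 1 + 1 by omega)] using h1

end Bounds

end TabularMDP

/-! ### Lower and upper bounds for the estimated values -/

namespace Interaction

section Recursion

variable {S A : Type*} [Fintype S] [Fintype A] [Nonempty A] {H : ℕ} {Ω : Type*}
  {I : Interaction S A H Ω} {M : TabularMDP S A H} {c₁ c₂ : ℕ → ℝ} {Vmax : ℝ} {k : ℕ} {ω : Ω}

theorem bonus_nonneg (h₁ : 0 ≤ c₁ k) (h₂ : 0 ≤ c₂ k) (x : S) (b : A) :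
    0 ≤ I.bonus c₁ c₂ k ω x b := by
  unfold bonus; positivity

theorem backup_mem (h₁ : 0 ≤ c₁ k) (h₂ : 0 ≤ c₂ k) (hV0 : 0 ≤ Vmax) (v : S → ℝ) (x : S) (b : A) :
    0 ≤ I.backup c₁ c₂ Vmax k ω v x b ∧ I.backup c₁ c₂ Vmax k ω v x b ≤ Vmax := by
  unfold backup
  split_ifs
  · exact ⟨le_min (add_nonneg (le_max_right _ _) (bonus_nonneg h₁ h₂ x b)) hV0, min_le_right _ _⟩
  · exact ⟨hV0, le_rfl⟩

/-- Estimated values at step `h`. -/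
noncomputable def VEst (I : Interaction S A H Ω) (c₁ c₂ : ℕ → ℝ) (Vmax : ℝ) (k : ℕ) (ω : Ω)
    (h : ℕ) : S → ℝ := I.estToGo c₁ c₂ Vmax k ω (H - h)

theorem VEst_of_le {h : ℕ} (hh : H ≤ h) (s : S) : I.VEst c₁ c₂ Vmax k ω h s = 0 := by
  unfold VEst
  rw [show H - h = 0 by omega]
  rfl

theorem VEst_eq_iSup (h : Fin H) (s : S) : I.VEst c₁ c₂ Vmax k ω h s =
    ⨆ b : A, I.backup c₁ c₂ Vmax k ω (I.VEst c₁ c₂ Vmax k ω (h + 1)) s b := by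
  unfold VEst
  rw [show H - (h : ℕ) = (H - ((h : ℕ) + 1)) + 1 by have := h.2; omega]
  rfl

theorem backup_le_VEst (h : Fin H) (s : S) (b : A) :
    I.backup c₁ c₂ Vmax k ω (I.VEst c₁ c₂ Vmax k ω (h + 1)) s b ≤ I.VEst c₁ c₂ Vmax k ω h s := by
  rw [VEst_eq_iSup]
  exact le_ciSup (f := fun b => I.backup c₁ c₂ Vmax k ω (I.VEst c₁ c₂ Vmax k ω (h + 1)) s b)
    (Set.finite_range _).bddAbove b

theorem FollowsEQO.VEst_eq (hE : I.FollowsEQO c₁ c₂ Vmax) (hk : 1 ≤ k) (h : Fin H) (s : S) :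
    I.VEst c₁ c₂ Vmax k ω h s =
      I.backup c₁ c₂ Vmax k ω (I.VEst c₁ c₂ Vmax k ω (h + 1)) s (I.pol k ω h s) := by
  refine le_antisymm ?_ (backup_le_VEst h s _)
  rw [VEst_eq_iSup]
  refine ciSup_le fun b => ?_
  have h1 := hE k hk ω h s b
  unfold QEst at h1
  unfold VEst
  rwa [show H - ((h : ℕ) + 1) = H - 1 - h by omega]

theorem VEst_mem (h₁ : 0 ≤ c₁ k) (h₂ : 0 ≤ c₂ k) (hV0 : 0 ≤ Vmax) (h : ℕ) (s : S) :
    0 ≤ I.VEst c₁ c₂ Vmax k ω h s ∧ I.VEst c₁ c₂ Vmax k ω h s ≤ Vmax := by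
  by_cases hh : h < H
  · rw [VEst_eq_iSup ⟨h, hh⟩]
    exact ⟨Real.iSup_nonneg fun b => (backup_mem h₁ h₂ hV0 _ s b).1,
      ciSup_le fun b => (backup_mem h₁ h₂ hV0 _ s b).2⟩
  · rw [VEst_of_le (not_lt.1 hh)]; exact ⟨le_rfl, hV0⟩

variable {sig : Fin H → S → A → ℝ} {σ lam l l₁ l₂ L : ℝ}

/-- The parameters `c₁, c₂` are large enough in episode `k`. -/
structure LargeBonus (Wd σ lam l l₁ l₂ c d : ℝ) : Prop where
  c_pos : 0 < c
  lam_pos : 0 < lam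
  l₁_nonneg : 0 ≤ l₁
  l₂_nonneg : 0 ≤ l₂
  lower : l / lam + 13 * lam * Wd * l₁ ≤ c
  upper : c ≤ 4 * l / lam
  sqrt_le : (σ + 6 * Wd * l / c) * √l₂ ≤ d

/-- The upper bound c ≤ 4l/λ gives (3/2)λ·Wd ≤ 6·Wd·l/c, the second summand in the condition on c₂.
-/
theorem sqrt_bonus_ge {N : ℕ} (hN : 0 < N) {Wd d c : ℝ} (hWd : 0 ≤ Wd)
    (hb : LargeBonus Wd σ lam l l₁ l₂ c d) :
    σ * √(l₂ / N) + lam * (3 / 2 * Wd * √(l₂ / N)) ≤ d / √N := by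
  have hN0 : (0 : ℝ) < N := by positivity
  rw [Real.sqrt_div hb.l₂_nonneg, ← mul_div_assoc, ← mul_div_assoc, ← mul_div_assoc, ← add_div]
  gcongr
  refine le_trans ?_ hb.sqrt_le
  rw [add_mul, ← mul_assoc]
  gcongr
  have h1 : c * lam ≤ 4 * l := by
    have := hb.upper
    rwa [le_div_iff₀ hb.lam_pos] at this
  rw [le_div_iff₀ hb.c_pos]
  nlinarith [mul_le_mul_of_nonneg_left h1 hWd]

/-- Backward induction along the optimal action. The induction hypothesis enters under the empirical
kernel, so the estimate misses V* by at most the backup error plus λ(P F + E) minus the bonus, where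
E is the empirical error on the next potential F. In the c₁ branch the bonus pays the 1/N terms of
both errors, and `potential_step` pays λσ²/2 and the variance. In the c₂ branch the bonus pays both
errors entirely. -/
theorem Concentrated.quasi_optimism
    (hC : I.Concentrated M sig Vmax σ lam l l₁ l₂ L k ω) (hV0 : 0 ≤ Vmax)
    (hV : ∀ (π : Policy S A H) (h : Fin H) (s : S), 0 ≤ M.V π h s ∧ M.V π h s ≤ Vmax)
    (hb : LargeBonus (M.WDiffStar sig) σ lam l l₁ l₂ (c₁ k) (c₂ k)) (h : ℕ) (s : S) :
    M.Vstar h s - I.VEst c₁ c₂ Vmax k ω h s ≤ lam * M.potential sig M.optPolicy h s := by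
  induction hn : H - h generalizing h s with
  | zero =>
    rw [M.Vstar_of_le (by omega), VEst_of_le (by omega), M.potential_of_le _ _ (by omega)]
    simp
  | succ n ih =>
    obtain ⟨h, rfl⟩ : ∃ j : Fin H, (j : ℕ) = h := ⟨⟨h, by omega⟩, rfl⟩
    replace ih := fun y => ih (h + 1) y (by omega)
    set a := M.optPolicy h s with ha
    set v := I.VEst c₁ c₂ Vmax k ω (h + 1) with hv
    set F := M.potential sig M.optPolicy (h + 1) with hF
    have hlam := hb.lam_pos
    have hFn : 0 ≤ lam * M.potential sig M.optPolicy h s :=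
      mul_nonneg hlam.le (M.potential_nonneg _ _ _ _)
    have hVs := TabularMDP.Vstar_mem hV0 hV h s
    suffices hs : M.Vstar h s - I.backup c₁ c₂ Vmax k ω v s a ≤
        lam * M.potential sig M.optPolicy h s by
      have := backup_le_VEst (I := I) (c₁ := c₁) (c₂ := c₂) (Vmax := Vmax) (k := k) (ω := ω) h s a
      linarith
    unfold backup
    split_ifs with hN
    swap
    · linarith [hVs.2]
    have hN0 : (0 : ℝ) < I.N k ω s a := by positivity
    rw [sub_le_comm]
    refine le_min ?_ (by linarith [hVs.2])
    set P := M.nextExp s a F with hP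
    set E := I.expError M k ω s a F with hE
    set D := I.backupError M k ω h s a with hD
    set N : ℝ := (I.N k ω s a : ℝ) with hNdef
    have hQ : M.Vstar h s = M.Qstar h s a := M.Vstar_eq_Qstar h s
    have hlow : M.Vstar h s + D - lam * (P + E) ≤ I.rHat k ω s a + ∑ y, I.PHat k ω s a y * v y := by
      have h1 : ∑ y, I.PHat k ω s a y * (M.Vstar (h + 1) y - lam * F y) ≤
          ∑ y, I.PHat k ω s a y * v y :=
        Finset.sum_le_sum fun y _ => mul_le_mul_of_nonneg_left (by linarith [ih y])
          (I.PHat_nonneg _ _ _ _ _)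
      have h2 : ∑ y, I.PHat k ω s a y * (M.Vstar (h + 1) y - lam * F y) =
          ∑ y, I.PHat k ω s a y * M.Vstar (h + 1) y - lam * (P + E) := by
        have : P + E = ∑ y, I.PHat k ω s a y * F y := by rw [hE, expError]; ring
        rw [this, Finset.mul_sum, ← Finset.sum_sub_distrib]
        exact Finset.sum_congr rfl fun y _ => by ring
      rw [hD, backupError, ← hQ]
      linarith
    have hstep := M.potential_step sig M.optPolicy h s
    rw [← ha, ← hF, ← hP] at hstep
    have hvar : 0 ≤ M.nextVar s a (M.W sig M.optPolicy (h + 1)) / (2 * M.WDiffStar sig) :=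
      div_nonneg (M.nextVar_nonneg _ _ _) (mul_nonneg zero_le_two (M.WDiffStar_nonneg _))
    have hmax := le_max_left (I.rHat k ω s a + ∑ y, I.PHat k ω s a y * v y) 0
    have hmax0 := le_max_right (I.rHat k ω s a + ∑ y, I.PHat k ω s a y * v y) 0
    have hlamstep := mul_le_mul_of_nonneg_left hstep hlam.le
    rcases min_choice (c₁ k / N) (c₂ k / √N) with hm | hm
    · have e1 := (abs_le.1 (hC.backup_linear h s a hN)).1
      have e2 := mul_le_mul_of_nonneg_left (hC.potential_linear h s a hN) hlam.le
      rw [← hD] at e1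
      rw [← hF, ← hE] at e2
      have e3 : l / (lam * N) + lam * (8 * M.WDiffStar sig * l₁ / N) ≤ c₁ k / N := by
        have : l / (lam * N) + lam * (8 * M.WDiffStar sig * l₁ / N) =
            (l / lam + 8 * lam * M.WDiffStar sig * l₁) / N := by
          field_simp
        rw [this]
        gcongr
        refine le_trans ?_ hb.lower
        have : 0 ≤ lam * M.WDiffStar sig * l₁ :=
          mul_nonneg (mul_nonneg hlam.le (M.WDiffStar_nonneg _)) hb.l₁_nonneg
        linarith
      unfold bonus
      rw [hm]
      rw [mul_add] at e2
      nlinarith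
    · have e3 := sqrt_bonus_ge hN (M.WDiffStar_nonneg sig) hb
      rw [← hNdef] at e3
      have hx : 0 ≤ lam * (3 / 2 * M.WDiffStar sig * √(l₂ / N)) :=
        mul_nonneg hlam.le (mul_nonneg (mul_nonneg (by norm_num) (M.WDiffStar_nonneg _))
          (Real.sqrt_nonneg _))
      unfold bonus
      rw [hm]
      -- In the trivial alternative the bonus alone is at least Vmax, hence at least V*.
      rcases hC.backup_sqrt h s a hN with e1 | e1
      · linarith [hVs.2]
      · have e1' := (abs_le.1 e1).1
        have e2 := mul_le_mul_of_nonneg_left (hC.potential_sqrt h s a hN) hlam.le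
        rw [← hD] at e1'
        rw [← hF, ← hE] at e2
        have : 0 ≤ lam * (sig h s a ^ 2 / 2) := by positivity
        have := mul_nonneg hlam.le hvar
        nlinarith

/-- Width of the confidence interval at a state-action pair, as a function of its visit count. -/
noncomputable def widthOf (c d Vmax : ℝ) (nS : ℕ) (L : ℝ) (N : ℕ) : ℝ :=
  if N = 0 then Vmax else
    min Vmax (2 * min (c / N) (d / √N) + 27 / 2 * Vmax * nS * L / N)

theorem widthOf_le (c d Vmax : ℝ) (nS : ℕ) (L : ℝ) (N : ℕ) : widthOf c d Vmax nS L N ≤ Vmax := by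
  unfold widthOf; split_ifs
  · exact le_rfl
  · exact min_le_left _ _

theorem widthOf_nonneg {c d Vmax : ℝ} (hc : 0 ≤ c) (hd : 0 ≤ d) (hV : 0 ≤ Vmax) (nS : ℕ) {L : ℝ}
    (hL : 0 ≤ L) (N : ℕ) : 0 ≤ widthOf c d Vmax nS L N := by
  unfold widthOf; split_ifs
  · exact hV
  · positivity

/-- Centre f at its mean m and apply the entrywise bound with z = |f(y) − m|/Vmax ≤ 2. The quadratic
parts sum to the variance; the remainders give a factor S. No independence of f from the data is
needed. -/
theorem Concentrated.expError_le (hC : I.Concentrated M sig Vmax σ lam l l₁ l₂ L k ω)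
    (hV0 : 0 < Vmax) {x : S} {b : A} (hN : 0 < I.N k ω x b) {f : S → ℝ} (hf : ∀ y, |f y| ≤ Vmax) :
    I.expError M k ω x b f ≤ M.nextVar x b f / (12 * Vmax) +
      27 / 2 * Vmax * Fintype.card S * L / I.N k ω x b := by
  set m := M.nextExp x b f with hm
  have hmb : |m| ≤ Vmax := by
    rw [abs_le]
    constructor
    · rw [← M.nextExp_const x b (-Vmax)]
      exact M.nextExp_mono x b fun y _ => (abs_le.1 (hf y)).1
    · rw [← M.nextExp_const x b Vmax]
      exact M.nextExp_mono x b fun y _ => (abs_le.1 (hf y)).2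
  have e1 : I.expError M k ω x b f =
      ∑ y, (I.PHat k ω x b y - M.P x b y) * (f y - m) := by
    have : ∑ y, (I.PHat k ω x b y - M.P x b y) * (f y - m) =
        ∑ y, (I.PHat k ω x b y * f y - M.P x b y * f y - I.PHat k ω x b y * m + M.P x b y * m) :=
      Finset.sum_congr rfl fun y _ => by ring
    rw [this, Finset.sum_add_distrib, Finset.sum_sub_distrib, Finset.sum_sub_distrib,
      ← Finset.sum_mul, ← Finset.sum_mul, I.PHat_sum hN, M.P_sum, expError, TabularMDP.nextExp]
    ring
  have e2 : ∀ y, (I.PHat k ω x b y - M.P x b y) * (f y - m) ≤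
      M.P x b y * (f y - m) ^ 2 / (12 * Vmax) + 27 / 2 * Vmax * L / I.N k ω x b := by
    intro y
    have hz2 : |f y - m| / Vmax ≤ 2 := by
      rw [div_le_iff₀ hV0]
      exact (abs_sub _ _).trans (by linarith [hf y])
    have h1 := mul_le_mul_of_nonneg_left
      (hC.transition x b y hN (|f y - m| / Vmax) (by positivity) hz2) hV0.le
    calc (I.PHat k ω x b y - M.P x b y) * (f y - m)
        ≤ |I.PHat k ω x b y - M.P x b y| * |f y - m| := by
          rw [← abs_mul]; exact le_abs_self _
      _ = Vmax * (|f y - m| / Vmax * |I.PHat k ω x b y - M.P x b y|) := by field_simp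
      _ ≤ _ := h1
      _ = _ := by
          rw [div_pow, sq_abs]
          field_simp
  rw [e1]
  refine (Finset.sum_le_sum fun y _ => e2 y).trans (le_of_eq ?_)
  rw [Finset.sum_add_distrib, Finset.sum_const, Finset.card_univ, nsmul_eq_mul,
    TabularMDP.nextVar, Finset.sum_div]
  congr 1
  ring

/-- The error of the backup of V^k splits into the error on V*, which is a fixed function, and the
error on V^k − V*, which is random and is treated by `expError_le`. One bonus in the width is the
algorithm's own; the second covers the error on V*, up to λσ²/2. If the truncation at Vmax is active
in the width, the bound is trivial. -/
theorem Concentrated.backup_le (hH : 1 ≤ H)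
    (hC : I.Concentrated M sig Vmax σ lam l l₁ l₂ L k ω) (hV0 : 0 < Vmax)
    (hV : ∀ (π : Policy S A H) (h : Fin H) (s : S), 0 ≤ M.V π h s ∧ M.V π h s ≤ Vmax)
    (h₂ : 0 ≤ c₂ k) (hL : 0 ≤ L)
    (hb : LargeBonus (M.WDiffStar sig) σ lam l l₁ l₂ (c₁ k) (c₂ k)) (h : Fin H) (s : S) (a : A) :
    I.backup c₁ c₂ Vmax k ω (I.VEst c₁ c₂ Vmax k ω (h + 1)) s a ≤
      M.r s a + M.nextExp s a (I.VEst c₁ c₂ Vmax k ω (h + 1)) + lam * sig h s a ^ 2 / 2 +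
      widthOf (c₁ k) (c₂ k) Vmax (Fintype.card S) L (I.N k ω s a) +
      M.nextVar s a (fun y => I.VEst c₁ c₂ Vmax k ω (h + 1) y - M.Vstar (h + 1) y) /
        (12 * Vmax) := by
  set v := I.VEst c₁ c₂ Vmax k ω (h + 1) with hv
  have hlam := hb.lam_pos
  have hvm : ∀ y, 0 ≤ v y ∧ v y ≤ Vmax := fun y => VEst_mem hb.c_pos.le h₂ hV0.le _ y
  have hr := TabularMDP.r_nonneg hH hV s a
  have hPv : 0 ≤ M.nextExp s a v := M.nextExp_nonneg s a fun y => (hvm y).1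
  have hvar : 0 ≤ M.nextVar s a (fun y => v y - M.Vstar (h + 1) y) / (12 * Vmax) :=
    div_nonneg (M.nextVar_nonneg _ _ _) (by positivity)
  have hs0 : 0 ≤ lam * sig h s a ^ 2 / 2 := by positivity
  have hle := (backup_mem (I := I) (ω := ω) (Vmax := Vmax) hb.c_pos.le h₂ hV0.le v s a).2
  unfold widthOf
  split_ifs with hN
  · linarith
  replace hN : 0 < I.N k ω s a := Nat.pos_of_ne_zero hN
  have hN0 : (0 : ℝ) < I.N k ω s a := by positivity
  rcases min_choice Vmax (2 * min (c₁ k / I.N k ω s a) (c₂ k / √(I.N k ω s a)) +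
    27 / 2 * Vmax * Fintype.card S * L / I.N k ω s a) with hm | hm
  · rw [hm]; linarith
  rw [hm]
  have hm' := min_eq_right_iff.1 hm
  set N : ℝ := (I.N k ω s a : ℝ) with hNdef
  have hbon : I.bonus c₁ c₂ k ω s a = min (c₁ k / N) (c₂ k / √N) := rfl
  rw [← hbon] at hm' ⊢
  have hbn := bonus_nonneg (I := I) (ω := ω) hb.c_pos.le h₂ s a
  have hCS : 0 ≤ 27 / 2 * Vmax * Fintype.card S * L / N := by positivity
  have hexp := hC.expError_le hV0 hN (f := fun y => v y - M.Vstar (h + 1) y) fun y => by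
    have h1 := hvm y
    have h2 := TabularMDP.Vstar_mem hV0.le hV (h + 1) y
    rw [abs_le]; constructor <;> linarith
  set D := I.backupError M k ω h s a with hD
  have hval : I.rHat k ω s a + ∑ y, I.PHat k ω s a y * v y = M.r s a + M.nextExp s a v + D +
      I.expError M k ω s a (fun y => v y - M.Vstar (h + 1) y) := by
    rw [hD, backupError, expError, M.nextExp_sub, M.Qstar_eq]
    simp only [mul_sub, Finset.sum_sub_distrib]
    rw [TabularMDP.nextExp, TabularMDP.nextExp]
    ring
  have hdev : Vmax ≤ I.bonus c₁ c₂ k ω s a ∨ D ≤ I.bonus c₁ c₂ k ω s a + lam * sig h s a ^ 2 / 2 := by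
    rcases min_choice (c₁ k / N) (c₂ k / √N) with hmm | hmm
    · right
      have e1 := (abs_le.1 (hC.backup_linear h s a hN)).2
      rw [← hD] at e1
      have e3 : l / (lam * N) ≤ c₁ k / N := by
        rw [← div_div]
        gcongr
        refine le_trans ?_ hb.lower
        have : 0 ≤ lam * M.WDiffStar sig * l₁ :=
          mul_nonneg (mul_nonneg hlam.le (M.WDiffStar_nonneg _)) hb.l₁_nonneg
        linarith
      rw [hbon, hmm]
      linarith
    · have e3 := sqrt_bonus_ge hN (M.WDiffStar_nonneg sig) hb
      have hx : 0 ≤ lam * (3 / 2 * M.WDiffStar sig * √(l₂ / N)) :=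
        mul_nonneg hlam.le (mul_nonneg (mul_nonneg (by norm_num) (M.WDiffStar_nonneg _))
          (Real.sqrt_nonneg _))
      rw [hbon, hmm]
      rcases hC.backup_sqrt h s a hN with e1 | e1
      · left; linarith
      · right
        have e1' := (abs_le.1 e1).2
        linarith
  rcases hdev with hd | hd
  · linarith
  · have h1 : I.backup c₁ c₂ Vmax k ω v s a ≤
        max (I.rHat k ω s a + ∑ y, I.PHat k ω s a y * v y) 0 + I.bonus c₁ c₂ k ω s a := by
      unfold backup
      rw [if_pos hN]
      exact min_le_left _ _
    have h2 : max (I.rHat k ω s a + ∑ y, I.PHat k ω s a y * v y) 0 ≤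
        M.r s a + M.nextExp s a v + lam * sig h s a ^ 2 / 2 + I.bonus c₁ c₂ k ω s a +
        27 / 2 * Vmax * Fintype.card S * L / N +
        M.nextVar s a (fun y => v y - M.Vstar (h + 1) y) / (12 * Vmax) := by
      refine max_le ?_ (by linarith)
      rw [hval]
      linarith
    linarith

/-- The error potential: over-estimation with respect to the policy, plus a quadratic function of
the over-estimation with respect to the optimal values, minus the accumulated variance proxy. -/
noncomputable def errorPotential (I : Interaction S A H Ω) (M : TabularMDP S A H) (c₁ c₂ : ℕ → ℝ)
    (Vmax : ℝ) (sig : Fin H → S → A → ℝ) (lam : ℝ) (k : ℕ) (ω : Ω) (h : ℕ) (s : S) : ℝ :=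
  I.VEst c₁ c₂ Vmax k ω h s - M.V (I.pol k ω) h s +
    ((I.VEst c₁ c₂ Vmax k ω h s - M.Vstar h s) / 4 +
      (I.VEst c₁ c₂ Vmax k ω h s - M.Vstar h s) ^ 2 / (8 * Vmax)) -
    3 / 2 * lam * M.W sig (I.pol k ω) h s

theorem errorPotential_of_le {h : ℕ} (hh : H ≤ h) (s : S) :
    I.errorPotential M c₁ c₂ Vmax sig lam k ω h s = 0 := by
  simp [errorPotential, VEst_of_le hh, M.V_of_le _ hh, M.Vstar_of_le hh, M.W_of_le _ _ hh]

theorem errorPotential_le (hV0 : 0 < Vmax)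
    (hV : ∀ (π : Policy S A H) (h : Fin H) (s : S), 0 ≤ M.V π h s ∧ M.V π h s ≤ Vmax)
    (h₁ : 0 ≤ c₁ k) (h₂ : 0 ≤ c₂ k) (hlam : 0 ≤ lam) (h : ℕ) (s : S) :
    I.errorPotential M c₁ c₂ Vmax sig lam k ω h s ≤ 3 / 2 * Vmax := by
  have e1 := VEst_mem (I := I) (ω := ω) h₁ h₂ hV0.le h s
  have e2 := TabularMDP.Vstar_mem hV0.le hV h s
  have e3 := TabularMDP.V_mem hV0.le hV (I.pol k ω) h s
  have e4 := mul_nonneg hlam (M.W_nonneg sig (I.pol k ω) h s)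
  have e5 : (I.VEst c₁ c₂ Vmax k ω h s - M.Vstar h s) ^ 2 / (8 * Vmax) ≤ Vmax / 8 := by
    rw [div_le_iff₀ (by positivity)]
    nlinarith
  unfold errorPotential
  linarith

/-- Let β be the one-step error λσ²/2 + width + ν/(12 Vmax), where ν is the variance of V^k − V* at
the next state. It enters once through V^k − V^π and at most half again through the quadratic, in
total 3β/2. The quadratic at the next step has an extra ν/(8 Vmax), exactly 3/2 of ν/(12 Vmax); the
term in W removes 3/2 of λσ²/2; 3/2 of the width remains. -/
theorem Concentrated.errorPotential_step (hH : 1 ≤ H)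
    (hC : I.Concentrated M sig Vmax σ lam l l₁ l₂ L k ω) (hV0 : 0 < Vmax)
    (hV : ∀ (π : Policy S A H) (h : Fin H) (s : S), 0 ≤ M.V π h s ∧ M.V π h s ≤ Vmax)
    (h₂ : 0 ≤ c₂ k) (hL : 0 ≤ L)
    (hb : LargeBonus (M.WDiffStar sig) σ lam l l₁ l₂ (c₁ k) (c₂ k))
    (hE : I.FollowsEQO c₁ c₂ Vmax) (hk : 1 ≤ k) (h : Fin H) (s : S) :
    I.errorPotential M c₁ c₂ Vmax sig lam k ω h s ≤
      3 / 2 * widthOf (c₁ k) (c₂ k) Vmax (Fintype.card S) L (I.N k ω s (I.pol k ω h s)) +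
      M.nextExp s (I.pol k ω h s) (I.errorPotential M c₁ c₂ Vmax sig lam k ω (h + 1)) := by
  set a := I.pol k ω h s with ha
  have hup := hC.backup_le hH hV0 hV h₂ hL hb h s a
  have hveq := hE.VEst_eq (ω := ω) hk h s
  rw [← ha] at hveq
  rw [← hveq] at hup
  have hVst := M.V_step (I.pol k ω) h s
  have hWst := M.W_step sig (I.pol k ω) h s
  have hQV := M.Qstar_le_Vstar h s a
  rw [M.Qstar_eq] at hQV
  rw [← ha] at hVst hWst
  have e1 := VEst_mem (I := I) (ω := ω) hb.c_pos.le h₂ hV0.le h s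
  have e2 := TabularMDP.Vstar_mem hV0.le hV h s
  have hv' := fun y => VEst_mem (I := I) (ω := ω) hb.c_pos.le h₂ hV0.le (h + 1) y
  have hV' := fun y => TabularMDP.Vstar_mem hV0.le hV (h + 1) y
  unfold errorPotential
  set v := I.VEst c₁ c₂ Vmax k ω (h + 1) with hv
  set w := widthOf (c₁ k) (c₂ k) Vmax (Fintype.card S) L (I.N k ω s a) with hw
  set f : S → ℝ := fun y => v y - M.Vstar (h + 1) y with hf
  set ν := M.nextVar s a f with hν
  set y := M.nextExp s a f with hy
  have hyv : y = M.nextExp s a v - M.nextExp s a (M.Vstar (h + 1)) := M.nextExp_sub s a _ _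
  have hyb : -Vmax ≤ y ∧ y ≤ Vmax := by
    constructor
    · rw [← M.nextExp_const s a (-Vmax)]
      exact M.nextExp_mono s a fun z _ => by simp only [hf]; linarith [(hv' z).1, (hV' z).2]
    · rw [← M.nextExp_const s a Vmax]
      exact M.nextExp_mono s a fun z _ => by simp only [hf]; linarith [(hv' z).2, (hV' z).1]
  have hexp : M.nextExp s a (fun z => v z - M.V (I.pol k ω) (h + 1) z +
      ((v z - M.Vstar (h + 1) z) / 4 + (v z - M.Vstar (h + 1) z) ^ 2 / (8 * Vmax)) -
      3 / 2 * lam * M.W sig (I.pol k ω) (h + 1) z) =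
      M.nextExp s a v - M.nextExp s a (M.V (I.pol k ω) (h + 1)) +
      (y / 4 + (ν + y ^ 2) / (8 * Vmax)) -
      3 / 2 * lam * M.nextExp s a (M.W sig (I.pol k ω) (h + 1)) := by
    rw [hν, hy, ← M.nextExp_sq s a f]
    simp only [TabularMDP.nextExp, hf, Finset.mul_sum, Finset.sum_div, ← Finset.sum_sub_distrib,
      ← Finset.sum_add_distrib]
    exact Finset.sum_congr rfl fun z _ => by ring
  rw [hexp]
  set g := I.VEst c₁ c₂ Vmax k ω h s - M.Vstar h s with hg
  have hgy : g ≤ y + (lam * sig h s a ^ 2 / 2 + w + ν / (12 * Vmax)) := by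
    have : M.nextExp s a (M.Vstar (h + 1)) = ∑ y, M.P s a y * M.Vstar (h + 1) y := rfl
    rw [hyv, this]
    linarith
  have hβ : 0 ≤ lam * sig h s a ^ 2 / 2 + w + ν / (12 * Vmax) := by
    have h1 := hb.lam_pos
    have h2 : 0 ≤ w := widthOf_nonneg hb.c_pos.le h₂ hV0.le _ hL _
    have h3 : 0 ≤ ν := M.nextVar_nonneg _ _ _
    positivity
  set β := lam * sig h s a ^ 2 / 2 + w + ν / (12 * Vmax) with hβdef
  -- The function u/4 + u²/(8 Vmax) has derivative between 0 and 1/2 on [−Vmax, Vmax], and both g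
  -- and y lie there.
  have hψ : g / 4 + g ^ 2 / (8 * Vmax) ≤ y / 4 + y ^ 2 / (8 * Vmax) + β / 2 := by
    have e : y / 4 + y ^ 2 / (8 * Vmax) + β / 2 - (g / 4 + g ^ 2 / (8 * Vmax)) =
        (2 * Vmax * (y - g) + (y ^ 2 - g ^ 2) + 4 * Vmax * β) / (8 * Vmax) := by
      field_simp; ring
    have h2 : 0 ≤ 2 * Vmax * (y - g) + (y ^ 2 - g ^ 2) + 4 * Vmax * β := by
      have hgb : -Vmax ≤ g ∧ g ≤ Vmax := ⟨by rw [hg]; linarith [e1.1, e2.2], by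
        rw [hg]; linarith [e1.2, e2.1]⟩
      rcases le_total g y with hle | hle
      · nlinarith [mul_nonneg (sub_nonneg.2 hle) (by linarith [hgb.1, hyb.1] : 0 ≤ 2 * Vmax + (y + g)),
          mul_nonneg hV0.le hβ]
      · nlinarith [mul_nonneg (sub_nonneg.2 hle) (by linarith [hgb.2, hyb.2] : 0 ≤ 2 * Vmax - (y + g)),
          mul_nonneg hV0.le (by linarith : 0 ≤ y + β - g)]
    have := div_nonneg h2 (by positivity : 0 ≤ 8 * Vmax)
    linarith
  have hsplit : (ν + y ^ 2) / (8 * Vmax) = 3 / 2 * (ν / (12 * Vmax)) + y ^ 2 / (8 * Vmax) := by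
    field_simp; ring
  have hPV : M.nextExp s a (M.V (I.pol k ω) (h + 1)) =
      ∑ y, M.P s a y * M.V (I.pol k ω) (h + 1) y := rfl
  rw [hsplit, hPV, hWst]
  linarith

end Recursion

end Interaction

/-! ## Saturated path sums -/

/-- A smooth truncation of the identity at level `1 / t`. -/
noncomputable def saturate (t y : ℝ) : ℝ := (1 - Real.exp (-(t * y))) / t

section Saturate

variable {t : ℝ}

theorem saturate_zero : saturate t 0 = 0 := by simp [saturate]

theorem saturate_mono (ht : 0 < t) {x y : ℝ} (h : x ≤ y) : saturate t x ≤ saturate t y := by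
  unfold saturate; gcongr

theorem saturate_nonneg (ht : 0 < t) {y : ℝ} (hy : 0 ≤ y) : 0 ≤ saturate t y := by
  rw [← saturate_zero (t := t)]; exact saturate_mono ht hy

theorem saturate_le_self (ht : 0 < t) (y : ℝ) : saturate t y ≤ y := by
  unfold saturate
  rw [div_le_iff₀ ht]
  have := Real.add_one_le_exp (-(t * y))
  linarith

theorem saturate_le_inv (ht : 0 < t) (y : ℝ) : saturate t y ≤ 1 / t := by
  unfold saturate
  gcongr
  linarith [Real.exp_pos (-(t * y))]

theorem saturate_add_le (ht : 0 < t) {x y : ℝ} (hx : 0 ≤ x) (hy : 0 ≤ y) :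
    saturate t (x + y) ≤ saturate t x + saturate t y := by
  unfold saturate
  rw [← add_div]
  gcongr
  rw [mul_add, neg_add, Real.exp_add]
  have h1 : Real.exp (-(t * x)) ≤ 1 := Real.exp_le_one_iff.2 (by nlinarith)
  have h2 : Real.exp (-(t * y)) ≤ 1 := Real.exp_le_one_iff.2 (by nlinarith)
  nlinarith

/-- From (1 − y + y²/2)(1 + y + y²/2) = 1 + y⁴/4 ≥ 1. -/
theorem exp_neg_le_quadratic {y : ℝ} (hy : 0 ≤ y) : Real.exp (-y) ≤ 1 - y + y ^ 2 / 2 := by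
  have h1 := Real.quadratic_le_exp_of_nonneg hy
  have h2 : 0 < 1 - y + y ^ 2 / 2 := by nlinarith [sq_nonneg (y - 1)]
  rw [Real.exp_neg, inv_le_comm₀ (Real.exp_pos y) h2]
  refine le_trans ?_ h1
  rw [inv_le_iff_one_le_mul₀ h2]
  nlinarith [sq_nonneg (y ^ 2)]

theorem exp_neg_three_le : Real.exp (-3) ≤ 1 / 17 := by
  rw [Real.exp_neg, one_div, inv_le_inv₀ (Real.exp_pos 3) (by norm_num)]
  have h1 : Real.exp 3 = Real.exp 1 ^ 3 := by rw [← Real.exp_nat_mul]; norm_num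
  rw [h1]
  have h2 := Real.exp_one_gt_d9
  calc (17 : ℝ) ≤ 2.7182818283 ^ 3 := by norm_num
    _ ≤ _ := by gcongr

end Saturate

/-! ### Bounded recursions and the first sub-optimal action -/

namespace TabularMDP

section PathSums

variable {S A : Type*} [Fintype S] {H : ℕ} (M : TabularMDP S A H)

/-- Sum of `X j (s_j, a_j)` over the steps `j ≥ h` of a path. -/
def tailSum (X : Fin H → S → A → ℝ) (π : Policy S A H) (h : ℕ) (x : Fin H → S) : ℝ :=
  ∑ j : Fin H, if h ≤ (j : ℕ) then X j (x j) (π j (x j)) else 0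

theorem tailSum_nonneg {X : Fin H → S → A → ℝ} (hX : ∀ j s a, 0 ≤ X j s a) (π : Policy S A H)
    (h : ℕ) (x : Fin H → S) : 0 ≤ tailSum X π h x :=
  Finset.sum_nonneg fun j _ => by
    split_ifs
    · exact hX _ _ _
    · exact le_rfl

theorem tailSum_of_le (X : Fin H → S → A → ℝ) (π : Policy S A H) {h : ℕ} (hh : H ≤ h)
    (x : Fin H → S) : tailSum X π h x = 0 :=
  Finset.sum_eq_zero fun j _ => if_neg (by have := j.2; omega)

theorem tailSum_eq (X : Fin H → S → A → ℝ) (π : Policy S A H) (h : Fin H) (x : Fin H → S) :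
    tailSum X π h x = X h (x h) (π h (x h)) + tailSum X π (h + 1) x := by
  unfold tailSum
  rw [← Finset.add_sum_erase _ _ (Finset.mem_univ h),
    ← Finset.add_sum_erase (a := h) Finset.univ (fun j : Fin H => if (h : ℕ) + 1 ≤ (j : ℕ) then
      X j (x j) (π j (x j)) else 0) (Finset.mem_univ h)]
  simp only [le_refl, if_true, add_le_iff_nonpos_right, nonpos_iff_eq_zero, one_ne_zero,
    if_false, zero_add]
  congr 1
  refine Finset.sum_congr rfl fun j hj => ?_
  have hne : (j : ℕ) ≠ h := fun e => (Finset.ne_of_mem_erase hj) (Fin.ext e)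
  by_cases h1 : (h : ℕ) ≤ (j : ℕ)
  · rw [if_pos h1, if_pos (show (h : ℕ) + 1 ≤ j by omega)]
  · rw [if_neg h1, if_neg (by omega)]

theorem tailSum_pin (X : Fin H → S → A → ℝ) (π : Policy S A H) (h : ℕ) (s : S) (x : Fin H → S) :
    tailSum X π (h + 1) (pin h s x) = tailSum X π (h + 1) x := by
  unfold tailSum
  refine Finset.sum_congr rfl fun j _ => ?_
  split_ifs with h1
  · rw [pin, if_neg (by omega)]
  · rfl

theorem trajExp_tailSum_step (X : Fin H → S → A → ℝ) (π : Policy S A H) (φ : ℝ → ℝ) (h : Fin H)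
    (s : S) : M.trajExp π h s (fun x => φ (tailSum X π h x)) =
      M.nextExp s (π h s) fun y =>
        M.trajExp π (h + 1) y fun x => φ (X h s (π h s) + tailSum X π (h + 1) x) := by
  by_cases hh : (h : ℕ) + 1 < H
  · rw [M.trajExp_step π hh]
    refine Finset.sum_congr rfl fun y _ => ?_
    congr 2
    funext x
    rw [tailSum_eq, tailSum_pin, pin, if_pos le_rfl]
  · have h1 : ∀ y, (M.trajExp π (h + 1) y fun x => φ (X h s (π h s) + tailSum X π (h + 1) x)) =
        φ (X h s (π h s)) := fun y => by
      rw [M.trajExp_of_le π (by omega), tailSum_of_le X π (by omega), add_zero]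
    simp only [h1]
    rw [M.nextExp_const, M.trajExp_of_le π (by omega), tailSum_eq, tailSum_of_le X π (by omega),
      add_zero]

theorem trajExp_saturate (π : Policy S A H) (h : ℕ) (s : S) (t : ℝ) (Y : (Fin H → S) → ℝ) :
    M.trajExp π h s (fun x => saturate t (Y x)) =
      (1 - M.trajExp π h s fun x => Real.exp (-(t * Y x))) / t := by
  have : ∀ x, saturate t (Y x) = t⁻¹ * (1 - Real.exp (-(t * Y x))) := fun x => by
    rw [saturate, div_eq_inv_mul]
  simp only [this]
  rw [M.trajExp_const_mul, M.trajExp_sub, M.trajExp_const, div_eq_inv_mul]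

/-- A bounded solution of the recursion `T_h ≤ X_h + P T_{h+1}` is dominated by the expected
saturated sum of `X`. -/
theorem le_trajExp_saturate {X : Fin H → S → A → ℝ} {B t : ℝ} (hB : 0 < B) (htB : t * B = 1 / 8)
    (hX0 : ∀ j s a, 0 ≤ X j s a) (hXB : ∀ j s a, X j s a ≤ B) (π : Policy S A H) {T : ℕ → S → ℝ}
    (hT : ∀ h s, T h s ≤ B) (hTH : ∀ h s, H ≤ h → T h s ≤ 0)
    (hstep : ∀ (h : Fin H) s, T h s ≤ X h s (π h s) + M.nextExp s (π h s) (T (h + 1))) (h : ℕ)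
    (s : S) : T h s ≤ 6 / 5 * M.trajExp π h s fun x => saturate t (tailSum X π h x) := by
  have ht : 0 < t := by
    by_contra hcon
    nlinarith [not_lt.1 hcon]
  induction hn : H - h generalizing h s with
  | zero =>
    refine (hTH h s (by omega)).trans ?_
    exact mul_nonneg (by norm_num) (M.trajExp_nonneg _ _ _ fun x =>
      saturate_nonneg ht (tailSum_nonneg hX0 π h x))
  | succ n ih =>
    obtain ⟨h, rfl⟩ : ∃ j : Fin H, (j : ℕ) = h := ⟨⟨h, by omega⟩, rfl⟩
    replace ih := fun y => ih (h + 1) y (by omega)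
    set E : S → ℝ := fun y => M.trajExp π (h + 1) y fun x =>
      Real.exp (-(t * tailSum X π (h + 1) x)) with hE
    set e := M.nextExp s (π h s) E with he
    set ξ := X h s (π h s) with hξ
    have hEstep : (M.trajExp π h s fun x => Real.exp (-(t * tailSum X π h x))) =
        Real.exp (-(t * ξ)) * e := by
      rw [M.trajExp_tailSum_step X π (fun z => Real.exp (-(t * z))), he, ← M.nextExp_const_mul]
      congr 1
      funext y
      rw [hE, ← M.trajExp_const_mul]
      congr 1
      funext x
      rw [mul_add, neg_add, Real.exp_add]
    rw [M.trajExp_saturate, hEstep]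
    have hE1 : ∀ y, E y ≤ 1 := fun y => by
      rw [← M.trajExp_const π (h + 1) y 1]
      refine M.trajExp_mono _ _ _ fun x _ => Real.exp_le_one_iff.2 ?_
      have := tailSum_nonneg hX0 π (h + 1) x
      nlinarith
    have hE0 : ∀ y, 0 ≤ E y := fun y => M.trajExp_nonneg _ _ _ fun x => Real.exp_nonneg _
    have he1 : e ≤ 1 := by
      rw [← M.nextExp_const s (π h s) 1]; exact M.nextExp_mono _ _ fun y _ => hE1 y
    have he0 : 0 ≤ e := M.nextExp_nonneg _ _ hE0
    have hTw : T h s ≤ ξ + 6 / 5 * ((1 - e) / t) := by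
      refine (hstep h s).trans (add_le_add_right ?_ ξ)
      calc M.nextExp s (π h s) (T (h + 1)) ≤
          M.nextExp s (π h s) fun y => 6 / 5 * t⁻¹ * ((fun _ => 1) y - E y) := by
            refine M.nextExp_mono _ _ fun y _ => (ih y).trans (le_of_eq ?_)
            rw [M.trajExp_saturate]
            simp only [hE]
            ring
        _ = _ := by
            rw [M.nextExp_const_mul, M.nextExp_sub, M.nextExp_const, ← he]
            ring
    have hξ0 : 0 ≤ ξ := hX0 _ _ _
    have hξB : ξ ≤ B := hXB _ _ _
    have htξ : 0 ≤ t * ξ := by positivity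
    have htξ1 : t * ξ ≤ 1 / 8 := by rw [← htB]; gcongr
    have hq := exp_neg_le_quadratic htξ
    set q := Real.exp (-(t * ξ)) with hqdef
    have hq1 : q ≤ 1 := Real.exp_le_one_iff.2 (by linarith)
    rw [mul_div_assoc', le_div_iff₀ ht] at *
    have hTB : T h s * t ≤ 1 / 8 := by rw [← htB, mul_comm]; gcongr; exact hT h s
    have hTw' : T h s * t ≤ t * ξ + 6 / 5 * (1 - e) := by
      have := mul_le_mul_of_nonneg_right hTw ht.le
      rw [add_mul, div_mul_cancel₀ _ ht.ne'] at this
      linarith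
    -- If the later steps have already used up 5/48, then 6/5 of that is 1/8 = tB and the bound T ≤
    -- B suffices. Otherwise the present increment is hardly saturated: (6/5)(15/16)(43/48) > 1.
    rcases le_total (5 / 48) (1 - e) with h1 | h1
    · nlinarith
    · have h2 : 43 / 48 ≤ e := by linarith
      have h3 : t * ξ * (15 / 16) ≤ 1 - q := by nlinarith
      nlinarith [mul_le_mul h3 h2 (by norm_num) (by linarith)]

end PathSums

/-! ### The first sub-optimal action -/

section FirstSubopt

variable {S A : Type*} [Fintype S] [Fintype A] [Nonempty A] {H : ℕ} (M : TabularMDP S A H)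

theorem firstSubopt_le_iff (π : Policy S A H) (x : Fin H → S) (j : Fin H) :
    M.firstSubopt π x ≤ (j : ℕ) ↔ ∃ i : Fin H, (i : ℕ) ≤ j ∧ 0 < M.gapAt i (x i) (π i (x i)) := by
  unfold firstSubopt
  constructor
  · intro h
    have hmem := Nat.sInf_mem (s := {h | ∃ hh : h < H, 0 < M.gapAt h (x ⟨h, hh⟩)
      (π ⟨h, hh⟩ (x ⟨h, hh⟩))} ∪ {H}) ⟨H, Or.inr rfl⟩
    rcases hmem with ⟨hh, hg⟩ | hH
    · exact ⟨⟨_, hh⟩, h, hg⟩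
    · have h1 : sInf ({h | ∃ hh : h < H, 0 < M.gapAt h (x ⟨h, hh⟩)
        (π ⟨h, hh⟩ (x ⟨h, hh⟩))} ∪ {H}) = H := hH
      rw [h1] at h
      exact absurd j.2 (not_lt.2 h)
  · rintro ⟨i, hij, hg⟩
    exact (Nat.sInf_le (Or.inl ⟨i.2, hg⟩)).trans hij

theorem gapAt_pos_of_firstSubopt_eq {π : Policy S A H} {x : Fin H → S} {h : Fin H}
    (hh : M.firstSubopt π x = h) : 0 < M.gapAt h (x h) (π h (x h)) := by
  obtain ⟨i, hi, hg⟩ := (M.firstSubopt_le_iff π x h).1 hh.le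
  have h1 := (M.firstSubopt_le_iff π x i).2 ⟨i, le_rfl, hg⟩
  have : i = h := Fin.ext (le_antisymm hi (hh ▸ h1))
  rwa [this] at hg

theorem firstSubopt_eq {π : Policy S A H} {x : Fin H → S} {h : Fin H}
    (hg : 0 < M.gapAt h (x h) (π h (x h)))
    (hlt : ∀ i : Fin H, i < h → ¬ 0 < M.gapAt i (x i) (π i (x i))) : M.firstSubopt π x = h := by
  refine le_antisymm ((M.firstSubopt_le_iff π x h).2 ⟨h, le_rfl, hg⟩) ?_
  by_contra hcon
  have hlt' : M.firstSubopt π x < h := not_le.1 hcon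
  have hH : M.firstSubopt π x < H := hlt'.trans h.2
  obtain ⟨i, hi, hgi⟩ := (M.firstSubopt_le_iff π x ⟨_, hH⟩).1 le_rfl
  exact hlt i (Fin.lt_def.2 (lt_of_le_of_lt hi hlt')) hgi

/-- Sum of `X j (s_j, a_j)` over the steps from the first sub-optimal action on. -/
noncomputable def suboptSum (X : Fin H → S → A → ℝ) (π : Policy S A H) (x : Fin H → S) : ℝ :=
  ∑ j : Fin H, if M.firstSubopt π x ≤ (j : ℕ) then X j (x j) (π j (x j)) else 0

theorem suboptSum_nonneg {X : Fin H → S → A → ℝ} (hX : ∀ j s a, 0 ≤ X j s a) (π : Policy S A H)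
    (x : Fin H → S) : 0 ≤ M.suboptSum X π x :=
  Finset.sum_nonneg fun j _ => by
    split_ifs
    · exact hX _ _ _
    · exact le_rfl

/-- Step `h`, state `s` can be the place of the first sub-optimal action of `π` started in `s₀`. -/
def FirstSuboptAt (π : Policy S A H) (s₀ : S) (h : Fin H) (s : S) : Prop :=
  ∃ x : Fin H → S, 0 < M.trajProb π 0 s₀ x ∧ M.firstSubopt π x = h ∧ x h = s

open Classical in
/-- Sum over the steps from the first sub-optimal action at or after step `h` on. -/
noncomputable def suboptSumFrom (X : Fin H → S → A → ℝ) (π : Policy S A H) (h : ℕ)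
    (x : Fin H → S) : ℝ :=
  ∑ j : Fin H, if ∃ i : Fin H, h ≤ (i : ℕ) ∧ (i : ℕ) ≤ j ∧ 0 < M.gapAt i (x i) (π i (x i)) then
    X j (x j) (π j (x j)) else 0

theorem suboptSumFrom_zero (X : Fin H → S → A → ℝ) (π : Policy S A H) (x : Fin H → S) :
    M.suboptSumFrom X π 0 x = M.suboptSum X π x := by
  unfold suboptSumFrom suboptSum
  refine Finset.sum_congr rfl fun j _ => ?_
  simp only [M.firstSubopt_le_iff, zero_le, true_and]

theorem suboptSumFrom_of_gap_pos (X : Fin H → S → A → ℝ) (π : Policy S A H) (h : Fin H)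
    (x : Fin H → S) (hg : 0 < M.gapAt h (x h) (π h (x h))) :
    M.suboptSumFrom X π h x = tailSum X π h x := by
  unfold suboptSumFrom tailSum
  refine Finset.sum_congr rfl fun j _ => ?_
  by_cases hj : (h : ℕ) ≤ j
  · rw [if_pos hj, if_pos ⟨h, le_rfl, hj, hg⟩]
  · rw [if_neg hj, if_neg]
    rintro ⟨i, h1, h2, -⟩
    omega

theorem suboptSumFrom_pin (X : Fin H → S → A → ℝ) (π : Policy S A H) (h : Fin H) (s : S)
    (x : Fin H → S) (hg : ¬ 0 < M.gapAt h s (π h s)) :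
    M.suboptSumFrom X π h (pin h s x) = M.suboptSumFrom X π (h + 1) x := by
  unfold suboptSumFrom
  refine Finset.sum_congr rfl fun j _ => ?_
  have hx : ∀ i : Fin H, (h : ℕ) + 1 ≤ i → pin h s x i = x i := fun i hi => if_neg (by omega)
  have hiff : (∃ i : Fin H, (h : ℕ) ≤ i ∧ (i : ℕ) ≤ j ∧
      0 < M.gapAt i (pin h s x i) (π i (pin h s x i))) ↔
      ∃ i : Fin H, (h : ℕ) + 1 ≤ i ∧ (i : ℕ) ≤ j ∧ 0 < M.gapAt i (x i) (π i (x i)) := by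
    constructor
    · rintro ⟨i, h1, h2, h3⟩
      by_cases hi : (i : ℕ) = h
      · have : i = h := Fin.ext hi
        subst this
        rw [pin, if_pos le_rfl] at h3
        exact absurd h3 hg
      · have h4 : (h : ℕ) + 1 ≤ i := by omega
        rw [hx i h4] at h3
        exact ⟨i, h4, h2, h3⟩
    · rintro ⟨i, h1, h2, h3⟩
      exact ⟨i, by omega, h2, by rwa [hx i h1]⟩
  by_cases hc : ∃ i : Fin H, (h : ℕ) + 1 ≤ i ∧ (i : ℕ) ≤ j ∧ 0 < M.gapAt i (x i) (π i (x i))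
  · rw [if_pos (hiff.2 hc), if_pos hc]
    obtain ⟨i, h1, h2, -⟩ := hc
    rw [hx j (by omega)]
  · rw [if_neg (mt hiff.1 hc), if_neg hc]

theorem exists_P_pos (s : S) (a : A) : ∃ y, 0 < M.P s a y := by
  by_contra hcon
  push Not at hcon
  have h1 := M.P_sum s a
  rw [Finset.sum_eq_zero fun y _ => le_antisymm (hcon y) (M.P_nonneg s a y)] at h1
  exact zero_ne_one h1

/-- A prefix of positive probability without sub-optimal actions that leads to a sub-optimal action
extends to a full trajectory. -/
theorem firstSuboptAt_of_prefix (π : Policy S A H) (p : ℕ → S) (h : Fin H)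
    (hp : ∀ j : Fin H, j < h → 0 < M.P (p j) (π j (p j)) (p (j + 1)) ∧
      ¬ 0 < M.gapAt j (p j) (π j (p j)))
    (hg : 0 < M.gapAt h (p h) (π h (p h))) : M.FirstSuboptAt π (p 0) h (p h) := by
  classical
  choose next hnext using fun q : S × A => M.exists_P_pos q.1 q.2
  -- After step `h` any successor of positive probability will do, since neither the first
  -- sub-optimal step nor the state there depends on the continuation.
  let ext : ℕ → S := Nat.rec (p h) fun n z =>
    next (z, if hn : (h : ℕ) + n < H then π ⟨(h : ℕ) + n, hn⟩ z else Classical.arbitrary A)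
  let q : ℕ → S := fun j => if j ≤ h then p j else ext (j - h)
  have hq1 : ∀ j, j ≤ (h : ℕ) → q j = p j := fun j hj => if_pos hj
  have hq2 : ∀ n, q (h + n) = ext n := by
    intro n
    rcases Nat.eq_zero_or_pos n with rfl | hn
    · exact hq1 _ le_rfl
    · simp only [q]
      rw [if_neg (by omega), Nat.add_sub_cancel_left]
  refine ⟨fun j => q j, ?_, M.firstSubopt_eq ?_ ?_, hq1 _ le_rfl⟩
  · unfold trajProb
    rw [if_pos, one_mul]
    · refine Finset.prod_pos fun j _ => ?_
      split_ifs with hj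
      · simp only
        by_cases hjh : (j : ℕ) < h
        · rw [hq1 _ hjh.le, hq1 _ (by omega)]
          exact (hp j hjh).1
        · obtain ⟨n, hn⟩ : ∃ n, (j : ℕ) = h + n := ⟨j - h, by omega⟩
          have h1 : q ((j : ℕ) + 1) = ext (n + 1) := by rw [hn, add_assoc, hq2]
          have h2 : q j = ext n := by rw [hn, hq2]
          rw [h1, h2]
          have h3 : ext (n + 1) = next (ext n, π j (ext n)) := by
            change next (ext n, if hn : (h : ℕ) + n < H then π ⟨(h : ℕ) + n, hn⟩ (ext n)
              else Classical.arbitrary A) = _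
            rw [dif_pos (by omega)]
            congr 3
            exact Fin.ext hn.symm
          rw [h3]
          exact hnext (ext n, π j (ext n))
      · exact one_pos
    · intro j hj
      have : (j : ℕ) = 0 := by omega
      change q (j : ℕ) = p 0
      rw [this]
      exact hq1 0 (Nat.zero_le _)
  · rw [hq1 _ le_rfl]
    exact hg
  · intro i hi
    rw [hq1 _ (Fin.lt_def.1 hi).le]
    exact (hp i hi).2

/-- The regret is carried by what happens from the first sub-optimal action on. -/
theorem regret_le_of_firstSuboptAt (π : Policy S A H) (s₀ : S) (X : Fin H → S → A → ℝ)
    {φ : ℝ → ℝ} (hφ : ∀ x, 0 ≤ φ (M.suboptSumFrom X π H x)) {C e : ℝ} (hC : 0 ≤ C) (he : 0 ≤ e)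
    (hB : ∀ h s, M.FirstSuboptAt π s₀ h s → M.Vstar h s - M.V π h s ≤
      C * M.trajExp π h s (fun x => φ (tailSum X π h x)) + e) :
    M.Vstar 0 s₀ - M.V π 0 s₀ ≤ C * M.trajExp π 0 s₀ (fun x => φ (M.suboptSum X π x)) + e := by
  -- The induction carries a whole prefix of positive probability without sub-optimal actions,
  -- because `hB` is available only at places that a possible trajectory from `s₀` reaches as its
  -- first sub-optimal selection. While the gap vanishes, the regret to go is the mean of that at
  -- the next state.
  have key : ∀ n h, H - h = n → h ≤ H → ∀ p : ℕ → S, p 0 = s₀ →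
      (∀ j : Fin H, (j : ℕ) < h → 0 < M.P (p j) (π j (p j)) (p (j + 1)) ∧
        ¬ 0 < M.gapAt j (p j) (π j (p j))) →
      M.Vstar h (p h) - M.V π h (p h) ≤
        C * M.trajExp π h (p h) (fun x => φ (M.suboptSumFrom X π h x)) + e := by
    intro n
    induction n with
    | zero =>
      intro h hn hh p _ _
      obtain rfl : h = H := by omega
      rw [M.Vstar_of_le le_rfl, M.V_of_le _ le_rfl, sub_zero]
      exact add_nonneg (mul_nonneg hC (M.trajExp_nonneg _ _ _ hφ)) he
    | succ n ih =>
      intro h hn hh p hp0 hp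
      obtain ⟨h, rfl⟩ : ∃ j : Fin H, (j : ℕ) = h := ⟨⟨h, by omega⟩, rfl⟩
      by_cases hg : 0 < M.gapAt h (p h) (π h (p h))
      · have h1 := hB h (p h) (hp0 ▸ M.firstSuboptAt_of_prefix π p h (fun j hj => hp j hj) hg)
        refine h1.trans (le_of_eq ?_)
        congr 2
        refine M.trajExp_congr π h (p h) fun x hx => ?_
        rw [M.suboptSumFrom_of_gap_pos X π h x (by rwa [hx h le_rfl])]
      · have hg0 : M.gapAt h (p h) (π h (p h)) = 0 :=
          le_antisymm (not_lt.1 hg) (M.gapAt_nonneg _ _ _)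
        rw [M.Vstar_sub_V_step, hg0, zero_add]
        have hstep : (M.trajExp π h (p h) fun x => φ (M.suboptSumFrom X π h x)) =
            M.nextExp (p h) (π h (p h)) fun y =>
              M.trajExp π (h + 1) y fun x => φ (M.suboptSumFrom X π (h + 1) x) := by
          by_cases hH : (h : ℕ) + 1 < H
          · rw [M.trajExp_step π hH]
            refine Finset.sum_congr rfl fun y _ => ?_
            congr 2
            funext x
            rw [M.suboptSumFrom_pin X π h _ x hg]
          · have hH' : H ≤ (h : ℕ) + 1 := by omega
            have hz : ∀ x, M.suboptSumFrom X π ((h : ℕ) + 1) x = 0 := fun x =>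
              Finset.sum_eq_zero fun j _ => if_neg (by
                rintro ⟨i, h1, -, -⟩
                have := i.2
                omega)
            simp only [hz]
            simp only [M.trajExp_const]
            rw [M.nextExp_const, M.trajExp_of_le π hH']
            have h0 := M.suboptSumFrom_pin X π h (p h) (fun _ => p h) hg
            have h1 : pin (h : ℕ) (p h) (fun _ : Fin H => p h) = fun _ => p h := by
              funext j; unfold pin; split_ifs <;> rfl
            rw [h1, hz] at h0
            rw [h0]
        rw [hstep]
        have h2 : C * (M.nextExp (p h) (π h (p h)) fun y =>
            M.trajExp π (h + 1) y fun x => φ (M.suboptSumFrom X π (h + 1) x)) + e =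
            M.nextExp (p h) (π h (p h)) fun y =>
              C * (M.trajExp π (h + 1) y fun x => φ (M.suboptSumFrom X π (h + 1) x)) + (fun _ => e) y := by
          rw [M.nextExp_add, M.nextExp_const_mul, M.nextExp_const]
        rw [h2]
        refine M.P_expect_mono _ _ fun y hy => ?_
        have h3 := ih (h + 1) (by omega) h.2 (fun j => if j ≤ h then p j else y)
          (by simp [hp0]) ?_
        · simpa using h3
        · intro j hj
          by_cases hjh : (j : ℕ) < h
          · simp only [if_pos hjh.le, if_pos (show (j : ℕ) + 1 ≤ h by omega)]
            exact hp j hjh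
          · have : j = h := Fin.ext (by omega)
            subst this
            simp only [le_refl, if_true, add_le_iff_nonpos_right, nonpos_iff_eq_zero, one_ne_zero,
              if_false]
            exact ⟨hy, hg⟩
  have h1 := key (H - 0) 0 rfl (Nat.zero_le _) (fun _ => s₀) rfl (fun j hj => absurd hj (Nat.not_lt_zero _))
  simpa only [M.suboptSumFrom_zero] using h1

/-- The regret bound after subtracting effective gaps. -/
theorem regret_le_of_effectiveGap {Sinit : Set S} {eg : Fin H → S → A → ℝ}
    (heg : M.IsEffectiveGap Sinit eg) (π : Policy S A H) {s₀ : S} (hs₀ : s₀ ∈ Sinit)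
    {X : Fin H → S → A → ℝ} (hX : ∀ j s a, 0 ≤ X j s a) {t : ℝ} (ht : 0 < t) {C e : ℝ} (hC : 0 < C)
    (he : 0 ≤ e)
    (hB : ∀ h s, M.FirstSuboptAt π s₀ h s → M.Vstar h s - M.V π h s ≤
      C * M.trajExp π h s (fun x => saturate t (tailSum X π h x)) + e) :
    M.Vstar 0 s₀ - M.V π 0 s₀ ≤ 2 * C * M.trajExp π 0 s₀ (fun x => saturate t
      (M.suboptSum (fun j s a => max (X j s a - eg j s a / (2 * C)) 0) π x)) + 2 * e := by
  have h1 := M.regret_le_of_firstSuboptAt π s₀ X (φ := saturate t) (fun x => by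
    refine saturate_nonneg ht (Finset.sum_nonneg fun j _ => ?_)
    split_ifs
    · exact hX _ _ _
    · exact le_rfl) hC.le he hB
  have h2 := heg.2 s₀ hs₀ π
  -- Doubling the regret bound and subtracting one copy of the regret, which is at least the
  -- expected sum of effective gaps, clips each width at its gap. By subadditivity and saturate y ≤
  -- y, the gap part leaves the saturation linearly with coefficient 2C/(2C) = 1.
  have hpt : ∀ x, 2 * C * saturate t (M.suboptSum X π x) - M.suboptSum eg π x ≤
      2 * C * saturate t
        (M.suboptSum (fun j s a => max (X j s a - eg j s a / (2 * C)) 0) π x) := by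
    intro x
    set p := M.suboptSum (fun j s a => max (X j s a - eg j s a / (2 * C)) 0) π x with hp
    set g := M.suboptSum eg π x with hgdef
    have hg0 : 0 ≤ g := M.suboptSum_nonneg (fun j s a => (heg.1 j s a).le) π x
    have hp0 : 0 ≤ p := M.suboptSum_nonneg (fun j s a => le_max_right _ _) π x
    have hle : M.suboptSum X π x ≤ p + g / (2 * C) := by
      rw [hp, hgdef]
      unfold suboptSum
      rw [Finset.sum_div, ← Finset.sum_add_distrib]
      refine Finset.sum_le_sum fun j _ => ?_
      split_ifs
      · have := le_max_left (X j (x j) (π j (x j)) - eg j (x j) (π j (x j)) / (2 * C)) 0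
        linarith
      · simp
    have h3 : saturate t (M.suboptSum X π x) ≤ saturate t p + g / (2 * C) :=
      (saturate_mono ht hle).trans ((saturate_add_le ht hp0 (by positivity)).trans
        (add_le_add_right (saturate_le_self ht _) _))
    have h4 := mul_le_mul_of_nonneg_left h3 (by positivity : 0 ≤ 2 * C)
    rw [mul_add, mul_div_cancel₀ _ (by positivity)] at h4
    linarith
  have h5 := M.trajExp_mono π 0 s₀ fun x _ => hpt x
  rw [M.trajExp_sub, M.trajExp_const_mul, M.trajExp_const_mul] at h5
  change M.trajExp π 0 s₀ (fun x => M.suboptSum eg π x) ≤ _ at h2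
  linarith

end FirstSubopt

end TabularMDP

/-! ## Counting visits -/

section Pigeonhole

variable {N v : ℕ → ℕ}

/-- The v visits of a good episode take the count from m to at most 5m/4. Each visit is charged to
its own count n in (m, m + v], for which f(m) ≤ F(n) by hypothesis. -/
theorem sum_good_visits_le (h1 : N 1 = 0) (hN : ∀ k, 1 ≤ k → N (k + 1) = N k + v k)
    {f F : ℕ → ℝ} (hF : ∀ n, 0 ≤ F n)
    (hfF : ∀ m n, 0 < m → m < n → 4 * n ≤ 5 * m → f m ≤ F n) (K : ℕ) :
    ∑ k ∈ Finset.Icc 1 K, (if 4 * v k ≤ N k then (v k : ℝ) * f (N k) else 0) ≤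
      ∑ n ∈ Finset.Icc 1 (N (K + 1)), F n := by
  induction K with
  | zero => simp [h1]
  | succ K ih =>
    rw [Finset.sum_Icc_succ_top (by omega)]
    have hstep := hN (K + 1) (by omega)
    have hsplit : ∑ n ∈ Finset.Icc 1 (N (K + 1 + 1)), F n =
        ∑ n ∈ Finset.Icc 1 (N (K + 1)), F n +
          ∑ n ∈ Finset.Ioc (N (K + 1)) (N (K + 1 + 1)), F n := by
      have : Finset.Icc 1 (N (K + 1 + 1)) =
          Finset.Icc 1 (N (K + 1)) ∪ Finset.Ioc (N (K + 1)) (N (K + 1 + 1)) := by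
        ext n; simp only [Finset.mem_union, Finset.mem_Icc, Finset.mem_Ioc]; omega
      rw [this, Finset.sum_union]
      rw [Finset.disjoint_left]
      intro n
      simp only [Finset.mem_Icc, Finset.mem_Ioc]
      omega
    rw [hsplit]
    refine add_le_add ih ?_
    split_ifs with hv
    · have hcard : (Finset.Ioc (N (K + 1)) (N (K + 1 + 1))).card = v (K + 1) := by
        rw [Nat.card_Ioc]; omega
      rw [← hcard, ← nsmul_eq_mul]
      refine Finset.card_nsmul_le_sum _ _ _ fun n hn => ?_
      rw [Finset.mem_Ioc] at hn
      exact hfF _ _ (by omega) hn.1 (by omega)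
    · exact Finset.sum_nonneg fun n _ => hF n

/-- Apart from the first visited episode, a bad episode multiplies the count by at least 5/4. -/
theorem card_bad_le (h1 : N 1 = 0) (hN : ∀ k, 1 ≤ k → N (k + 1) = N k + v k) (K : ℕ) :
    (∑ k ∈ Finset.Icc 1 K, if N k < 4 * v k then (1 : ℝ) else 0) ≤
      if N (K + 1) = 0 then 0 else 1 + Real.log (N (K + 1)) / Real.log (5 / 4) := by
  have hl : 0 < Real.log (5 / 4) := Real.log_pos (by norm_num)
  induction K with
  | zero => simp [h1]
  | succ K ih =>
    rw [Finset.sum_Icc_succ_top (by omega)]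
    have hstep := hN (K + 1) (by omega)
    refine (add_le_add_left ih _).trans ?_
    by_cases h0 : N (K + 1 + 1) = 0
    · rw [if_pos h0, if_pos (by omega), if_neg (by omega), add_zero]
    · rw [if_neg h0]
      have h0' : (1 : ℝ) ≤ N (K + 1 + 1) := by exact_mod_cast Nat.one_le_iff_ne_zero.2 h0
      by_cases h2 : N (K + 1) = 0
      · rw [if_pos h2, zero_add]
        have : 0 ≤ Real.log (N (K + 1 + 1)) / Real.log (5 / 4) :=
          div_nonneg (Real.log_nonneg h0') hl.le
        split_ifs <;> linarith
      · rw [if_neg h2]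
        have h2' : (0 : ℝ) < N (K + 1) := by exact_mod_cast Nat.pos_of_ne_zero h2
        split_ifs with hb
        · have h3 : (5 / 4 : ℝ) * N (K + 1) ≤ N (K + 1 + 1) := by
            have : 5 * N (K + 1) ≤ 4 * N (K + 1 + 1) := by omega
            have : (5 : ℝ) * N (K + 1) ≤ 4 * N (K + 1 + 1) := by exact_mod_cast this
            linarith
          have h4 := Real.log_le_log (by positivity) h3
          rw [Real.log_mul (by norm_num) h2'.ne'] at h4
          have h5 : (Real.log (5 / 4) + Real.log (N (K + 1))) / Real.log (5 / 4) ≤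
              Real.log (N (K + 1 + 1)) / Real.log (5 / 4) := by gcongr
          rw [add_div, div_self hl.ne'] at h5
          linarith
        · have h3 : (N (K + 1) : ℝ) ≤ N (K + 1 + 1) := by
            exact_mod_cast (show N (K + 1) ≤ N (K + 1 + 1) by omega)
          have h5 : Real.log (N (K + 1)) / Real.log (5 / 4) ≤
              Real.log (N (K + 1 + 1)) / Real.log (5 / 4) := by gcongr
          linarith

end Pigeonhole

/-! ### Path sums as sums over state-action pairs -/

section PathVisits

variable {S A : Type*} [Fintype S] {H : ℕ}

open Classical in
/-- Number of visits of `(s, a)` along a path. -/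
noncomputable def pathVisits (π : Policy S A H) (x : Fin H → S) (s : S) (a : A) : ℕ :=
  ∑ j : Fin H, if x j = s ∧ π j (x j) = a then 1 else 0

theorem sum_path_eq [Fintype A] (π : Policy S A H) (x : Fin H → S) (f : S → A → ℝ) :
    ∑ j : Fin H, f (x j) (π j (x j)) = ∑ s, ∑ a, (pathVisits π x s a : ℝ) * f s a := by
  classical
  have h1 : ∀ s a, (pathVisits π x s a : ℝ) * f s a =
      ∑ j : Fin H, if x j = s ∧ π j (x j) = a then f s a else 0 := fun s a => by
    unfold pathVisits
    push_cast
    rw [Finset.sum_mul]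
    exact Finset.sum_congr rfl fun j _ => by split_ifs <;> simp
  simp only [h1]
  calc _ = ∑ j : Fin H, ∑ s, ∑ a, (if x j = s ∧ π j (x j) = a then f s a else 0) := by
        refine Finset.sum_congr rfl fun j _ => ?_
        rw [Finset.sum_eq_single (x j) _ (by simp), Finset.sum_eq_single (π j (x j)) _ (by simp)]
        · simp
        · intro a _ ha; rw [if_neg]; exact fun h => ha h.2.symm
        · intro s _ hs
          exact Finset.sum_eq_zero fun a _ => if_neg fun h => hs h.1.symm
    _ = ∑ s, ∑ j : Fin H, ∑ a, (if x j = s ∧ π j (x j) = a then f s a else 0) := Finset.sum_comm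
    _ = _ := Finset.sum_congr rfl fun s _ => Finset.sum_comm

theorem Interaction.N_succ {Ω : Type*} (I : Interaction S A H Ω) {k : ℕ} (hk : 1 ≤ k) (ω : Ω) (s : S)
    (a : A) :
    I.N (k + 1) ω s a = I.N k ω s a + pathVisits (I.pol k ω) (I.path k ω) s a := by
  unfold Interaction.N pathVisits
  rw [Finset.sum_Ico_succ_top hk]
  rfl

theorem Interaction.N_one {Ω : Type*} (I : Interaction S A H Ω) (ω : Ω) (s : S) (a : A) :
    I.N 1 ω s a = 0 := by
  simp [Interaction.N]

end PathVisits

/-! ## The cost of an episode -/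

namespace TabularMDP

variable {S A : Type*} [Fintype S] [Fintype A] [Nonempty A] {H : ℕ} (M : TabularMDP S A H)

theorem gapAt_le_regret (π : Policy S A H) (h : Fin H) (s : S) :
    M.gapAt h s (π h s) ≤ M.Vstar h s - M.V π h s := by
  rw [M.Vstar_sub_V_step]
  have : 0 ≤ M.nextExp s (π h s) fun y => M.Vstar (h + 1) y - M.V π (h + 1) y :=
    M.nextExp_nonneg _ _ fun y => sub_nonneg.2 (M.V_le_Vstar _ _ _)
  exact le_add_of_nonneg_right this

theorem vGap_mem {Sinit : Set S} {π : Policy S A H} {s₀ : S} (hs₀ : s₀ ∈ Sinit) {h : Fin H} {s : S}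
    (hB : M.FirstSuboptAt π s₀ h s) :
    0 < M.vGap Sinit ∧ M.vGap Sinit ≤ M.gapAt h s (π h s) := by
  set G := {g | ∃ π : Policy S A H, ∃ s ∈ Sinit, ∃ x : Fin H → S, 0 < M.trajProb π 0 s x ∧
    ∃ hB : M.firstSubopt π x < H,
      g = M.gapAt (M.firstSubopt π x) (x ⟨_, hB⟩) (π ⟨_, hB⟩ (x ⟨_, hB⟩))} with hG
  have hfin : G.Finite := by
    refine (Set.finite_range fun p : Fin H × S × A => M.gapAt p.1 p.2.1 p.2.2).subset ?_
    rintro g ⟨π, s, -, x, -, hB, rfl⟩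
    exact ⟨(⟨_, hB⟩, _, _), rfl⟩
  have hmem : M.gapAt h s (π h s) ∈ G := by
    obtain ⟨x, hx, hf, rfl⟩ := hB
    have hlt : M.firstSubopt π x < H := hf ▸ h.2
    have : (⟨M.firstSubopt π x, hlt⟩ : Fin H) = h := Fin.ext hf
    refine ⟨π, s₀, hs₀, x, hx, hlt, ?_⟩
    rw [this, hf]
  have hinf : sInf G ∈ G := Set.Nonempty.csInf_mem ⟨_, hmem⟩ hfin
  refine ⟨?_, csInf_le hfin.bddBelow hmem⟩
  obtain ⟨π', s', -, x, -, hB', he⟩ := hinf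
  have hpos := M.gapAt_pos_of_firstSubopt_eq (π := π') (x := x) (h := ⟨_, hB'⟩) rfl
  change 0 < sInf G
  rw [he]
  exact hpos

end TabularMDP

namespace Interaction

variable {S A : Type*} [Fintype S] [Fintype A] [Nonempty A] {H : ℕ} {Ω : Type*}
  {I : Interaction S A H Ω} {M : TabularMDP S A H} {c₁ c₂ : ℕ → ℝ} {Vmax : ℝ} {k : ℕ} {ω : Ω}
  {sig : Fin H → S → A → ℝ} {σ lam l l₁ l₂ L : ℝ}

/-- Solving the definition of the error potential for V* − V^π leaves 5/4 of V* − V^k and (3/2)λW.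
Quasi-optimism bounds the former by (5/4)·2λ·WStar, in total 4λ·WStar ≤ 16·WStar·l/c₁. -/
theorem Concentrated.regret_from_le (hH : 1 ≤ H)
    (hC : I.Concentrated M sig Vmax σ lam l l₁ l₂ L k ω) (hV0 : 0 < Vmax)
    (hV : ∀ (π : Policy S A H) (h : Fin H) (s : S), 0 ≤ M.V π h s ∧ M.V π h s ≤ Vmax)
    (h₂ : 0 ≤ c₂ k) (hL : 0 ≤ L)
    (hb : LargeBonus (M.WDiffStar sig) σ lam l l₁ l₂ (c₁ k) (c₂ k))
    (hE : I.FollowsEQO c₁ c₂ Vmax) (hk : 1 ≤ k) (h : ℕ) (s : S) :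
    M.Vstar h s - M.V (I.pol k ω) h s ≤
      6 / 5 * M.trajExp (I.pol k ω) h s (fun x => saturate (1 / (12 * Vmax))
        (TabularMDP.tailSum (fun _ s a => 3 / 2 * widthOf (c₁ k) (c₂ k) Vmax (Fintype.card S) L
          (I.N k ω s a)) (I.pol k ω) h x)) + 16 * (M.WStar sig * l / c₁ k) := by
  have h1 := M.le_trajExp_saturate (X := fun _ s a => 3 / 2 * widthOf (c₁ k) (c₂ k) Vmax
    (Fintype.card S) L (I.N k ω s a)) (B := 3 / 2 * Vmax) (t := 1 / (12 * Vmax)) (by positivity)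
    (by field_simp; norm_num)
    (fun _ s a => mul_nonneg (by norm_num) (widthOf_nonneg hb.c_pos.le h₂ hV0.le _ hL _))
    (fun _ s a => mul_le_mul_of_nonneg_left (widthOf_le _ _ _ _ _ _) (by norm_num)) (I.pol k ω)
    (T := I.errorPotential M c₁ c₂ Vmax sig lam k ω)
    (errorPotential_le hV0 hV hb.c_pos.le h₂ hb.lam_pos.le)
    (fun h s hh => (errorPotential_of_le hh s).le)
    (hC.errorPotential_step hH hV0 hV h₂ hL hb hE hk) h s
  have h2 := hC.quasi_optimism hV0.le hV hb h s
  have h3 := mul_le_mul_of_nonneg_left (M.potential_le sig M.optPolicy h s) hb.lam_pos.le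
  have h4 := mul_le_mul_of_nonneg_left (M.W_le_WStar sig (I.pol k ω) h s) hb.lam_pos.le
  have h5 : lam * M.WStar sig ≤ 4 * (M.WStar sig * l / c₁ k) := by
    have hup := hb.upper
    rw [le_div_iff₀ hb.lam_pos] at hup
    rw [← mul_div_assoc, le_div_iff₀ hb.c_pos]
    nlinarith [M.WStar_nonneg sig]
  have h6 : 0 ≤ (I.VEst c₁ c₂ Vmax k ω h s - M.Vstar h s) ^ 2 / (8 * Vmax) := by positivity
  unfold errorPotential at h1
  linarith

/-- Regret of one episode in terms of effective gaps. -/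
theorem Concentrated.regret_le (hH : 1 ≤ H)
    (hC : I.Concentrated M sig Vmax σ lam l l₁ l₂ L k ω) (hV0 : 0 < Vmax)
    (hV : ∀ (π : Policy S A H) (h : Fin H) (s : S), 0 ≤ M.V π h s ∧ M.V π h s ≤ Vmax)
    (h₂ : 0 ≤ c₂ k) (hL : 0 ≤ L) (hl : 0 ≤ l)
    (hb : LargeBonus (M.WDiffStar sig) σ lam l l₁ l₂ (c₁ k) (c₂ k))
    (hE : I.FollowsEQO c₁ c₂ Vmax) (hk : 1 ≤ k) {Sinit : Set S} {eg : Fin H → S → A → ℝ}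
    (heg : M.IsEffectiveGap Sinit eg) (hs : I.s k 0 ω ∈ Sinit) {e : ℝ} (he : 0 ≤ e)
    (hgap : 36 * M.WStar sig * l / M.vGap Sinit ≤ c₁ k ∨ 144 * M.WStar sig * l / c₁ k ≤ e) :
    M.Vstar 0 (I.s k 0 ω) - M.V (I.pol k ω) 0 (I.s k 0 ω) ≤
      108 / 25 * M.trajExp (I.pol k ω) 0 (I.s k 0 ω) (fun x => saturate (1 / (12 * Vmax))
        (M.suboptSum (fun j s a => max (3 / 2 * widthOf (c₁ k) (c₂ k) Vmax (Fintype.card S) L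
          (I.N k ω s a) - eg j s a / (108 / 25)) 0) (I.pol k ω) x)) + e := by
  have ht : (0 : ℝ) < 1 / (12 * Vmax) := by positivity
  have hX0 : ∀ (_ : Fin H) s a, 0 ≤ 3 / 2 * widthOf (c₁ k) (c₂ k) Vmax (Fintype.card S) L
      (I.N k ω s a) := fun _ s a =>
    mul_nonneg (by norm_num) (widthOf_nonneg hb.c_pos.le h₂ hV0.le _ hL _)
  have hWl : 0 ≤ M.WStar sig * l / c₁ k :=
    div_nonneg (mul_nonneg (M.WStar_nonneg sig) hl) hb.c_pos.le
  -- For large c₁ the additive 16·WStar·l/c₁ is at most 4/9 of `vGap`, hence of the regret at the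
  -- first sub-optimal action. Moving it to the left turns 6/5 into (6/5)/(5/9) = 54/25.
  have h1 := M.regret_le_of_effectiveGap heg (I.pol k ω) hs hX0 ht (C := 54 / 25) (e := e / 2)
    (by norm_num) (by positivity) (fun h s hB => by
      have h2 := hC.regret_from_le hH hV0 hV h₂ hL hb hE hk h s
      have hU := M.trajExp_nonneg (I.pol k ω) h s fun x =>
        saturate_nonneg ht (TabularMDP.tailSum_nonneg hX0 (I.pol k ω) h x)
      rcases hgap with hg | hg
      · obtain ⟨hv0, hv⟩ := M.vGap_mem hs hB
        have h3 := M.gapAt_le_regret (I.pol k ω) h s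
        rw [div_le_iff₀ hv0] at hg
        have h4 : 36 * (M.WStar sig * l / c₁ k) ≤ M.vGap Sinit := by
          rw [← mul_div_assoc, div_le_iff₀ hb.c_pos]; linarith
        linarith
      · have : 144 * M.WStar sig * l / c₁ k = 144 * (M.WStar sig * l / c₁ k) := by ring
        linarith)
  rw [show (2 : ℝ) * (54 / 25) = 108 / 25 by norm_num] at h1
  linarith

end Interaction

namespace TabularMDP

variable {S A : Type*} [Fintype S] [Fintype A] [Nonempty A] {H : ℕ} (M : TabularMDP S A H)

open Classical in
/-- A path sum, replaced by `m` on a set of bad paths. -/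
noncomputable def truncCost (bad : (Fin H → S) → Prop) (m : ℝ) (Y : (Fin H → S) → ℝ)
    (x : Fin H → S) : ℝ := if bad x then m else Y x

/-- A saturated cost never exceeds 1/t, so on bad paths it may be exchanged for the constant cost
3/t at a factor 17/16, as e^{−3} ≤ 1/17. Then 1 − x ≤ −log x passes to the compensator of the
exponential martingale. -/
theorem trajExp_saturate_le_neg_log (π : Policy S A H) (s : S) {t : ℝ} (ht : 0 < t)
    (bad : (Fin H → S) → Prop) {Y : (Fin H → S) → ℝ} (hY : ∀ x, 0 ≤ Y x) :
    M.trajExp π 0 s (fun x => saturate t (Y x)) ≤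
      17 / 16 * (-Real.log (M.trajExp π 0 s fun x =>
        Real.exp (-(t * truncCost bad (3 / t) Y x))) / t) := by
  classical
  have h1 : M.trajExp π 0 s (fun x => saturate t (Y x)) ≤
      17 / 16 * M.trajExp π 0 s fun x => saturate t (truncCost bad (3 / t) Y x) := by
    rw [← M.trajExp_const_mul]
    refine M.trajExp_mono _ _ _ fun x _ => ?_
    unfold truncCost
    split_ifs
    · refine (saturate_le_inv ht _).trans ?_
      have h3 := exp_neg_three_le
      rw [saturate, mul_div_cancel₀ _ ht.ne', ← mul_div_assoc]
      gcongr
      linarith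
    · have := saturate_nonneg ht (hY x)
      linarith
  refine h1.trans ?_
  rw [M.trajExp_saturate]
  gcongr
  set Z := truncCost bad (3 / t) Y with hZ
  obtain ⟨B, hB⟩ := (Set.finite_range Z).bddAbove
  have hpos : 0 < M.trajExp π 0 s fun x => Real.exp (-(t * Z x)) := by
    refine lt_of_lt_of_le (Real.exp_pos (-(t * B))) ?_
    rw [← M.trajExp_const π 0 s (Real.exp (-(t * B)))]
    refine M.trajExp_mono _ _ _ fun x _ => Real.exp_le_exp.2 ?_
    have := hB ⟨x, rfl⟩
    nlinarith
  linarith [Real.log_le_sub_one_of_pos hpos]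

end TabularMDP

/-! ## Total cost of the episodes -/

namespace Interaction

section TotalCost

theorem widthOf_mono {c c' d d' : ℝ} (hc : c ≤ c') (hd : d ≤ d') (Vmax : ℝ) (nS : ℕ) (L : ℝ)
    (N : ℕ) : widthOf c d Vmax nS L N ≤ widthOf c' d' Vmax nS L N := by
  unfold widthOf
  split_ifs
  · exact le_rfl
  · gcongr

/-- Excess of the width over the gap, and its integral bound between two consecutive counts. -/
theorem excess_le {c d Vmax L g : ℝ} (hc : 0 ≤ c) (hd : 0 ≤ d) (hV : 0 ≤ Vmax) (nS : ℕ)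
    (hL : 0 ≤ L) {m n : ℕ} (hm : 0 < m) (hmn : m < n) (h : 4 * n ≤ 5 * m) :
    max (3 / 2 * widthOf c d Vmax nS L m - g) 0 ≤
      max (15 / 4 * min (c / n) (d / √n) - g) 0 + 405 / 16 * Vmax * nS * L * (1 / n) := by
  have hm0 : (0 : ℝ) < m := by exact_mod_cast hm
  have hn0 : (0 : ℝ) < n := by exact_mod_cast hm.trans hmn
  have h4 : (4 : ℝ) * n ≤ 5 * m := by exact_mod_cast h
  have h1 : (1 : ℝ) / m ≤ 5 / 4 * (1 / n) := by
    rw [← mul_div_assoc, div_le_div_iff₀ hm0 hn0]; linarith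
  have h2 : (1 : ℝ) / √m ≤ 5 / 4 * (1 / √n) := by
    rw [← mul_div_assoc, div_le_div_iff₀ (Real.sqrt_pos.2 hm0) (Real.sqrt_pos.2 hn0), one_mul,
      mul_one]
    refine Real.sqrt_le_iff.2 ⟨by positivity, ?_⟩
    rw [mul_pow, Real.sq_sqrt hm0.le]
    nlinarith
  have h3 : min (c / m) (d / √m) ≤ 5 / 4 * min (c / n) (d / √n) := by
    rw [mul_min_of_nonneg _ _ (by norm_num : (0 : ℝ) ≤ 5 / 4)]
    refine min_le_min ?_ ?_
    · calc c / m = c * (1 / m) := by ring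
        _ ≤ c * (5 / 4 * (1 / n)) := by gcongr
        _ = _ := by ring
    · calc d / √m = d * (1 / √m) := by ring
        _ ≤ d * (5 / 4 * (1 / √n)) := by gcongr
        _ = _ := by ring
  have h5 : widthOf c d Vmax nS L m ≤ 2 * min (c / m) (d / √m) + 27 / 2 * Vmax * nS * L / m := by
    rw [widthOf, if_neg hm.ne']; exact min_le_right _ _
  have h6 : 27 / 2 * Vmax * nS * L / m ≤ 135 / 8 * Vmax * nS * L * (1 / n) := by
    calc 27 / 2 * Vmax * nS * L / m = 27 / 2 * Vmax * nS * L * (1 / m) := by ring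
      _ ≤ 27 / 2 * Vmax * nS * L * (5 / 4 * (1 / n)) := by gcongr
      _ = _ := by ring
  have h7 : 0 ≤ 405 / 16 * Vmax * nS * L * (1 / n) := by positivity
  have h8 : 405 / 16 * Vmax * nS * L * (1 / n) = 3 / 2 * (135 / 8 * Vmax * nS * L * (1 / n)) := by
    ring
  refine max_le ?_ (by positivity)
  have := le_max_left (15 / 4 * min (c / n) (d / √n) - g) 0
  linarith

variable {S A : Type*} [Fintype S] [Fintype A] [Nonempty A] {H : ℕ} {Ω : Type*}

/-- Cost charged to an episode with policy `π`, counts `N` and path `x`. -/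
noncomputable def episodeCost (M : TabularMDP S A H) (c d Vmax L : ℝ) (eg : Fin H → S → A → ℝ)
    (N : S → A → ℕ) (π : Policy S A H) (x : Fin H → S) : ℝ :=
  TabularMDP.truncCost (fun x => ∃ s a, N s a < 4 * pathVisits π x s a) (3 / (1 / (12 * Vmax)))
    (M.suboptSum (fun j s a => max (3 / 2 * widthOf c d Vmax (Fintype.card S) L (N s a)
      - eg j s a / (108 / 25)) 0) π) x

/-- The minimum over steps of the effective gap appears here because visit counts do not distinguish
the step. A bad path is paid by any one bad pair, at the price 3/t = 36 Vmax. -/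
theorem episodeCost_le (M : TabularMDP S A H) {c c' d d' Vmax L : ℝ} (hc : c ≤ c') (hd : d ≤ d')
    (hV : 0 ≤ Vmax) (eg : Fin H → S → A → ℝ) (N : S → A → ℕ) (π : Policy S A H) (x : Fin H → S) :
    episodeCost M c d Vmax L eg N π x ≤ ∑ s, ∑ a,
      (36 * Vmax * (if N s a < 4 * pathVisits π x s a then 1 else 0) +
        if 4 * pathVisits π x s a ≤ N s a then (pathVisits π x s a : ℝ) *
          max (3 / 2 * widthOf c' d' Vmax (Fintype.card S) L (N s a)
            - minOverSteps eg s a / (108 / 25)) 0 else 0) := by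
  classical
  have hterm : ∀ s a, 0 ≤ (36 * Vmax * (if N s a < 4 * pathVisits π x s a then 1 else 0) +
        if 4 * pathVisits π x s a ≤ N s a then (pathVisits π x s a : ℝ) *
          max (3 / 2 * widthOf c' d' Vmax (Fintype.card S) L (N s a)
            - minOverSteps eg s a / (108 / 25)) 0 else 0) := fun s a => by
    refine add_nonneg ?_ ?_
    · split_ifs <;> simp [hV]
    · split_ifs
      · exact mul_nonneg (Nat.cast_nonneg _) (le_max_right _ _)
      · exact le_rfl
  unfold episodeCost TabularMDP.truncCost
  split_ifs with hbad
  · obtain ⟨s, a, hsa⟩ := hbad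
    refine le_trans ?_ (Finset.single_le_sum (fun s _ => Finset.sum_nonneg fun a _ => hterm s a)
      (Finset.mem_univ s))
    refine le_trans ?_ (Finset.single_le_sum (fun a _ => hterm s a) (Finset.mem_univ a))
    rw [if_pos hsa, if_neg (by omega), add_zero, mul_one, div_div_eq_mul_div, div_one]
    linarith
  · push Not at hbad
    calc M.suboptSum (fun j s a => max (3 / 2 * widthOf c d Vmax (Fintype.card S) L (N s a)
          - eg j s a / (108 / 25)) 0) π x
        ≤ ∑ j : Fin H, (fun s a => max (3 / 2 * widthOf c' d' Vmax (Fintype.card S) L (N s a)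
            - minOverSteps eg s a / (108 / 25)) 0) (x j) (π j (x j)) := by
          refine Finset.sum_le_sum fun j _ => ?_
          split_ifs
          · have h1 := widthOf_mono hc hd Vmax (Fintype.card S) L (N (x j) (π j (x j)))
            have h2 : minOverSteps eg (x j) (π j (x j)) ≤ eg j (x j) (π j (x j)) :=
              ciInf_le (Set.finite_range _).bddBelow j
            refine max_le_max ?_ le_rfl
            linarith
          · exact le_max_right _ _
      _ = ∑ s, ∑ a, (pathVisits π x s a : ℝ) *
          max (3 / 2 * widthOf c' d' Vmax (Fintype.card S) L (N s a)
            - minOverSteps eg s a / (108 / 25)) 0 := 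
          sum_path_eq π x fun s a => max (3 / 2 * widthOf c' d' Vmax (Fintype.card S) L (N s a)
            - minOverSteps eg s a / (108 / 25)) 0
      _ ≤ _ := by
          refine Finset.sum_le_sum fun s _ => Finset.sum_le_sum fun a _ => ?_
          rw [if_pos (hbad s a), if_neg (not_lt.2 (hbad s a)), mul_zero, zero_add]

theorem episodeCost_nonneg (M : TabularMDP S A H) {c d Vmax L : ℝ} (hV : 0 ≤ Vmax)
    (eg : Fin H → S → A → ℝ) (N : S → A → ℕ) (π : Policy S A H) (x : Fin H → S) :
    0 ≤ episodeCost M c d Vmax L eg N π x := by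
  unfold episodeCost TabularMDP.truncCost
  split_ifs
  · positivity
  · exact M.suboptSum_nonneg (fun _ _ _ => le_max_right _ _) _ _

theorem sum_one_div_le (n : ℕ) : ∑ i ∈ Finset.Icc 1 n, (1 : ℝ) / i ≤ 1 + Real.log n := by
  have h := harmonic_le_one_add_log n
  rw [harmonic_eq_sum_Icc] at h
  push_cast at h
  simpa [one_div] using h

theorem sum_episodeCost_le (I : Interaction S A H Ω) (M : TabularMDP S A H) (hH : 1 ≤ H)
    {c₁ c₂ : ℕ → ℝ} {Vmax L : ℝ} {K : ℕ} (hK : 1 ≤ K) (hc₁ : 0 ≤ c₁ K) (hc₂ : 0 ≤ c₂ K)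
    (hmono₁ : ∀ k, 1 ≤ k → k ≤ K → c₁ k ≤ c₁ K) (hmono₂ : ∀ k, 1 ≤ k → k ≤ K → c₂ k ≤ c₂ K)
    (hV : 0 ≤ Vmax) (hL : 0 ≤ L) (eg : Fin H → S → A → ℝ) (ω : Ω) :
    ∑ k ∈ Finset.Icc 1 K, episodeCost M (c₁ k) (c₂ k) Vmax L eg (I.N k ω) (I.pol k ω) (I.path k ω) ≤
      ∑ s, ∑ a, (36 * Vmax * (1 + Real.log (K * H) / Real.log (5 / 4)) +
        (∑ n ∈ Finset.Icc 1 (K * H), max (15 / 4 * min (c₁ K / n) (c₂ K / √n)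
          - minOverSteps eg s a / (108 / 25)) 0 +
          405 / 16 * Vmax * Fintype.card S * L * (1 + Real.log (K * H)))) := by
  refine (Finset.sum_le_sum fun k hk => episodeCost_le M
    (hmono₁ k (Finset.mem_Icc.1 hk).1 (Finset.mem_Icc.1 hk).2)
    (hmono₂ k (Finset.mem_Icc.1 hk).1 (Finset.mem_Icc.1 hk).2) hV eg _ _ _).trans ?_
  rw [Finset.sum_comm]
  refine Finset.sum_le_sum fun s _ => ?_
  rw [Finset.sum_comm]
  refine Finset.sum_le_sum fun a _ => ?_
  rw [Finset.sum_add_distrib, ← Finset.mul_sum]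
  have hN1 : I.N 1 ω s a = 0 := I.N_one ω s a
  have hNs : ∀ k, 1 ≤ k → I.N (k + 1) ω s a =
      I.N k ω s a + pathVisits (I.pol k ω) (I.path k ω) s a := fun k hk => I.N_succ hk ω s a
  let _ : MeasurableSpace Ω := ⊤
  have hNle : I.N (K + 1) ω s a ≤ K * H := I.N_le (K + 1) ω s a
  have hKH : 1 ≤ K * H := Nat.mul_pos hK hH
  have hKH' : (1 : ℝ) ≤ K * H := by exact_mod_cast hKH
  have hl : 0 < Real.log (5 / 4) := Real.log_pos (by norm_num)
  refine add_le_add ?_ ?_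
  · refine mul_le_mul_of_nonneg_left ((card_bad_le (N := fun k => I.N k ω s a)
      (v := fun k => pathVisits (I.pol k ω) (I.path k ω) s a) hN1 hNs K).trans ?_) (by positivity)
    have h0 : 0 ≤ Real.log (K * H) := Real.log_nonneg hKH'
    split_ifs with h1
    · positivity
    · have h2 : (I.N (K + 1) ω s a : ℝ) ≤ K * H := by exact_mod_cast hNle
      have h3 : (0 : ℝ) < I.N (K + 1) ω s a := by exact_mod_cast Nat.pos_of_ne_zero h1
      gcongr
  · set F : ℕ → ℝ := fun n => max (15 / 4 * min (c₁ K / n) (c₂ K / √n)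
          - minOverSteps eg s a / (108 / 25)) 0 + 405 / 16 * Vmax * Fintype.card S * L * (1 / n)
      with hF
    have hF0 : ∀ n, 0 ≤ F n := fun n => add_nonneg (le_max_right _ _) (by positivity)
    refine (sum_good_visits_le (N := fun k => I.N k ω s a)
      (v := fun k => pathVisits (I.pol k ω) (I.path k ω) s a) hN1 hNs hF0
      (f := fun m => max (3 / 2 * widthOf (c₁ K) (c₂ K) Vmax (Fintype.card S) L m
            - minOverSteps eg s a / (108 / 25)) 0)
      (fun m n hm hmn h => excess_le hc₁ hc₂ hV _ hL hm hmn h) K).trans ?_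
    refine (Finset.sum_le_sum_of_subset_of_nonneg (Finset.Icc_subset_Icc_right hNle)
      fun n _ _ => hF0 n).trans ?_
    rw [hF, Finset.sum_add_distrib, ← Finset.mul_sum]
    gcongr
    have := sum_one_div_le (K * H)
    push_cast at this
    exact this

end TotalCost

end Interaction

/-! ## Numerical estimates -/

theorem log_five_quarters_ge : (2 : ℝ) / 9 ≤ Real.log (5 / 4) := by
  rw [Real.le_log_iff_exp_le (by norm_num)]
  have h1 : Real.exp (2 / 9) ^ 9 ≤ (5 / 4 : ℝ) ^ 9 := by
    rw [← Real.exp_nat_mul]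
    have h2 : Real.exp (((9 : ℕ) : ℝ) * (2 / 9)) = Real.exp 1 ^ 2 := by
      rw [← Real.exp_nat_mul]; norm_num
    rw [h2]
    calc Real.exp 1 ^ 2 ≤ 2.7182818286 ^ 2 := by
          gcongr; exact Real.exp_one_lt_d9.le
      _ ≤ _ := by norm_num
  exact le_of_pow_le_pow_left₀ (by norm_num) (by norm_num) h1

/-- The lower-order terms, in units of `S² A`. -/
theorem lower_order_le {Vmax q p x l l₀ L Λ : ℝ} (hV : 0 ≤ Vmax) (hp : 1 ≤ p) (hqp : q ≤ p) (hx : x = Λ - Real.log 2) (hΛ : 97 / 10 ≤ Λ) (hl : 97 / 20 ≤ l) (hl₀ : l₀ ≤ l)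
    (hL : L ≤ 2 * l - 97 / 20) :
    459 / 100 * (12 * Vmax * l₀ + q * (36 * Vmax * (1 + x / Real.log (5 / 4))) +
      p * (405 / 16 * Vmax * L * (1 + x))) ≤ 287 * Vmax * p * l * Λ := by
  have h2 := Real.log_two_gt_d9
  have h2' := Real.log_two_lt_d9
  have h5 := log_five_quarters_ge
  have hx0 : 0 ≤ x := by rw [hx]; linarith
  have e1 : x / Real.log (5 / 4) ≤ 9 / 2 * x := by
    rw [div_le_iff₀ (by linarith)]; nlinarith
  have e2 : 12 * l₀ ≤ p * (12 * l) := by nlinarith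
  have e3 : q * (36 * (1 + x / Real.log (5 / 4))) ≤ p * (36 * (1 + 9 / 2 * x)) := by
    have : 0 ≤ x / Real.log (5 / 4) := div_nonneg hx0 (by linarith)
    gcongr
  have e4 : p * (405 / 16 * L * (1 + x)) ≤ p * (405 / 16 * (2 * l - 97 / 20) * (1 + x)) := by
    gcongr
  -- The coefficient of l·x on the left is about 232; the margin up to 287 and the lower bounds on l
  -- and Λ absorb the affine terms.
  have e5 : 459 / 100 * (12 * l + 36 * (1 + 9 / 2 * x) +
      405 / 16 * (2 * l - 97 / 20) * (1 + x)) ≤ 287 * l * Λ := by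
    have hx1 : x ≤ Λ - 69 / 100 := by rw [hx]; linarith
    have hx2 : Λ - 7 / 10 ≤ x := by rw [hx]; linarith
    nlinarith [mul_nonneg (sub_nonneg.2 hl) (sub_nonneg.2 hΛ),
      mul_nonneg (sub_nonneg.2 hl) (sub_nonneg.2 hx1), mul_nonneg (sub_nonneg.2 hl) hx0]
  calc _ = Vmax * (459 / 100 * (12 * l₀ + q * (36 * (1 + x / Real.log (5 / 4))) +
        p * (405 / 16 * L * (1 + x)))) := by ring
    _ ≤ Vmax * (459 / 100 * (p * (12 * l) + p * (36 * (1 + 9 / 2 * x)) +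
        p * (405 / 16 * (2 * l - 97 / 20) * (1 + x)))) := by gcongr
    _ = Vmax * (p * (459 / 100 * (12 * l + 36 * (1 + 9 / 2 * x) +
      405 / 16 * (2 * l - 97 / 20) * (1 + x)))) := by ring
    _ ≤ Vmax * (p * (287 * l * Λ)) := by gcongr
    _ = _ := by ring

/-- With few episodes the lower-order term exceeds the number of episodes. -/
theorem natCast_le_of_log_lt {K H : ℕ} (hK : 1 ≤ K) (hH : 1 ≤ H) {p l : ℝ} (hp : 1 ≤ p)
    (hl : 97 / 20 ≤ l) (hΛ : Real.log (2 * K * H) < 97 / 10) :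
    (K : ℝ) ≤ 287 * p * l * Real.log (2 * K * H) := by
  have h2 := Real.log_two_gt_d9
  have hK' : (1 : ℝ) ≤ K := by exact_mod_cast hK
  have hH' : (1 : ℝ) ≤ H := by exact_mod_cast hH
  have hpow : ∀ n : ℕ, (2 : ℝ) ^ n ≤ 2 * K → n * Real.log 2 ≤ Real.log (2 * K * H) := fun n hn => by
    rw [← Real.log_pow]
    refine Real.log_le_log (by positivity) (hn.trans ?_)
    nlinarith
  have hpl : 97 / 20 ≤ p * l := by nlinarith
  have h8192 : (K : ℝ) < 8192 := by
    by_contra hcon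
    have := hpow 14 (by norm_num; linarith [not_lt.1 hcon])
    push_cast at this
    linarith
  have hΛ1 := hpow 1 (by linarith)
  push_cast at hΛ1
  rcases le_total (K : ℝ) 900 with h | h
  · nlinarith [mul_le_mul hpl hΛ1 (by linarith) (by linarith)]
  · have hΛ2 := hpow 10 (by norm_num; linarith)
    push_cast at hΛ2
    nlinarith [mul_le_mul hpl hΛ2 (by linarith) (by linarith)]

/-! ## The regret bound for admissible gap sums -/

section Kappa

theorem card_filter_not_lt (κ : ℕ∞) (K : ℕ) [DecidablePred fun k : ℕ => κ < (k : ℕ∞)] :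
    ((Finset.Icc 1 K).filter fun k : ℕ => ¬ κ < (k : ℕ∞)).card ≤ (min κ (K : ℕ∞)).toNat := by
  have hsub : ((Finset.Icc 1 K).filter fun k : ℕ => ¬ κ < (k : ℕ∞)) ⊆
      Finset.Icc 1 (min κ (K : ℕ∞)).toNat := by
    intro k hk
    rw [Finset.mem_filter, Finset.mem_Icc] at hk
    rw [Finset.mem_Icc]
    refine ⟨hk.1.1, ?_⟩
    have h1 : (k : ℕ∞) ≤ min κ K := le_min (not_lt.1 hk.2) (by exact_mod_cast hk.1.2)
    have h2 : min κ (K : ℕ∞) ≠ ⊤ := ne_top_of_le_ne_top (ENat.natCast_ne_top K) (min_le_right _ _)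
    rw [← ENat.natCast_toNat h2] at h1
    exact_mod_cast h1
  exact (Finset.card_le_card hsub).trans (by simp)

variable {l1 l2 : ℕ → ℝ} {Wd Valpha sMax Ws g : ℝ} {c₁ c₂ : ℕ → ℝ} {ι : ℕ → ℕ} {k : ℕ}

theorem le_of_kappa_lt (hk : 1 ≤ k) (h : kappa l1 l2 Wd Valpha sMax c₁ c₂ ι < k) :
    c1Threshold Wd Valpha (l1 1) ≤ c₁ k ∧
      (sMax + 6 * Wd * l1 (ι k) / c₁ k) * √(l2 k) ≤ c₂ k := by
  have hnot : ¬ (c₁ k < c1Threshold Wd Valpha (l1 1) ∨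
      c₂ k < (sMax + 6 * Wd * l1 (ι k) / c₁ k) * √(l2 k)) := fun hcon =>
    absurd (le_iSup₂ (f := fun (k : ℕ) (_ : k ∈ {k : ℕ | 1 ≤ k ∧
      (c₁ k < c1Threshold Wd Valpha (l1 1) ∨
      c₂ k < (sMax + 6 * Wd * l1 (ι k) / c₁ k) * √(l2 k))}) => (k : ℕ∞)) k ⟨hk, hcon⟩) (not_le.2 h)
  push Not at hnot
  exact hnot

theorem le_of_kappaGap_lt (hk : 1 ≤ k) (h : kappaGap l1 Ws c₁ ι g < k) :
    36 * Ws * l1 (ι k) / g ≤ c₁ k := by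
  by_contra hcon
  exact absurd (le_iSup₂ (f := fun (k : ℕ) (_ : k ∈ {k : ℕ | 1 ≤ k ∧
    c₁ k < 36 * Ws * l1 (ι k) / g}) => (k : ℕ∞)) k ⟨hk, not_le.1 hcon⟩) (not_le.2 h)

end Kappa

/-! ### A positive scale for the square-root bounds -/

section Scale

variable {S A : Type*} [Fintype S] [Fintype A] [Nonempty A] {H : ℕ} (M : TabularMDP S A H)
  {sig : Fin H → S → A → ℝ} {Valpha Vmax : ℝ}

theorem two_mul_sig_le_sigmaMax (h : Fin H) (s : S) (a : A) :
    2 * sig h s a ≤ sigmaMax sig Valpha Vmax ∧ √(2 * Valpha * Vmax) ≤ sigmaMax sig Valpha Vmax := by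
  have := le_ciSup (f := fun p : Fin H × S × A => max (2 * sig p.1 p.2.1 p.2.2)
    (√(2 * Valpha * Vmax))) (Set.finite_range _).bddAbove (h, s, a)
  exact ⟨(le_max_left _ _).trans this, (le_max_right _ _).trans this⟩

theorem TabularMDP.WDiffStar_eq_zero (h : ∀ j s a, sig j s a = 0) : M.WDiffStar sig = 0 := by
  have hW : ∀ π j s, M.W sig π j s = 0 := fun π j s => by
    unfold TabularMDP.W TabularMDP.cumulative
    simp [h, TabularMDP.trajExp]
  unfold TabularMDP.WDiffStar
  simp [hW]

/-- A positive scale at least `σ_max` that satisfies the same condition on `c₂`. -/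
theorem exists_scale [Nonempty S] (hH : 1 ≤ H) (hsig : ∀ j s a, 0 ≤ sig j s a) {c₂ l2 : ℕ → ℝ}
    {K : ℕ} (hc₂ : 0 < c₂ 1) (hmono : ∀ k, 1 ≤ k → c₂ 1 ≤ c₂ k) (hl2 : 0 < l2 K)
    (hl2mono : ∀ k, 1 ≤ k → k ≤ K → l2 k ≤ l2 K) :
    ∃ σ : ℝ, 0 < σ ∧ (∀ j s a, 2 * sig j s a ≤ σ) ∧ 2 * Valpha * Vmax ≤ σ ^ 2 ∧
      ∀ k, 1 ≤ k → k ≤ K → ∀ l c,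
        (sigmaMax sig Valpha Vmax + 6 * M.WDiffStar sig * l / c) * √(l2 k) ≤ c₂ k →
        (σ + 6 * M.WDiffStar sig * l / c) * √(l2 k) ≤ c₂ k := by
  obtain ⟨s₀⟩ := ‹Nonempty S›
  obtain ⟨a₀⟩ := ‹Nonempty A›
  have h0 := two_mul_sig_le_sigmaMax (sig := sig) (Valpha := Valpha) (Vmax := Vmax)
  have hs := (h0 ⟨0, hH⟩ s₀ a₀).2
  have hs0 : 0 ≤ sigmaMax sig Valpha Vmax := (Real.sqrt_nonneg _).trans hs
  -- Peeling divides by the scale. If σ_max = 0 all proxies vanish, so does `WDiffStar`, and any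
  -- scale small enough for c₂ works; c₂(1)/√ℓ₂(K) serves all episodes by monotonicity.
  rcases hs0.eq_or_lt with hz | hpos
  · have hsz : ∀ j s a, sig j s a = 0 := fun j s a => by
      have h1 := (h0 j s a).1
      have h2 := hsig j s a
      linarith
    have hq : 0 < √(l2 K) := Real.sqrt_pos.2 hl2
    refine ⟨c₂ 1 / √(l2 K), by positivity, fun j s a => ?_, ?_, fun k hk hkK l c _ => ?_⟩
    · rw [hsz, mul_zero]; positivity
    · have h1 : 2 * Valpha * Vmax ≤ 0 := by
        rw [← hz] at hs
        exact Real.sqrt_eq_zero'.1 (le_antisymm hs (Real.sqrt_nonneg _))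
      exact h1.trans (sq_nonneg _)
    · rw [M.WDiffStar_eq_zero hsz]
      simp only [mul_zero, zero_mul, zero_div, add_zero]
      calc c₂ 1 / √(l2 K) * √(l2 k) ≤ c₂ 1 / √(l2 K) * √(l2 K) := by
            gcongr; exact hl2mono k hk hkK
        _ = c₂ 1 := div_mul_cancel₀ _ hq.ne'
        _ ≤ c₂ k := hmono k hk
  · exact ⟨_, hpos, fun j s a => (h0 j s a).1, (Real.sqrt_le_left hs0).1 hs,
      fun k _ _ l c h => h⟩

end Scale

/-! ### Regret on the good event -/

namespace Interaction

variable {S A Ω : Type*} [Fintype S] [Fintype A] [Nonempty A]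

open Classical in
/-- Regret on the event where the model is concentrated and the path costs do not fall too far below
their compensators. -/
theorem regret_le_of_concentrated {H : ℕ} (hH : 1 ≤ H) {I : Interaction S A H Ω}
    {M : TabularMDP S A H} {Sinit : Set S} {Vmax : ℝ} (hV0 : 0 < Vmax)
    (hV : ∀ (π : Policy S A H) (h : Fin H) (s : S), 0 ≤ M.V π h s ∧ M.V π h s ≤ Vmax)
    {c₁ c₂ : ℕ → ℝ} (hc₂ : ∀ k, 1 ≤ k → 0 < c₂ k)
    (hc₁mono : ∀ k l, 1 ≤ k → k ≤ l → c₁ k ≤ c₁ l)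
    (hc₂mono : ∀ k l, 1 ≤ k → k ≤ l → c₂ k ≤ c₂ l) (hc₁ : ∀ k, 1 ≤ k → 0 < c₁ k)
    (hinit : ∀ k, 1 ≤ k → ∀ ω, I.s k 0 ω ∈ Sinit) (hE : I.FollowsEQO c₁ c₂ Vmax)
    {sig : Fin H → S → A → ℝ} {σ L l₀ : ℝ} (hL : 0 ≤ L) {lam l1 l2 : ℕ → ℝ} {ι : ℕ → ℕ}
    {κ κg : ℕ∞} {K : ℕ} (hK : 1 ≤ K) {eg : Fin H → S → A → ℝ} (heg : M.IsEffectiveGap Sinit eg)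
    {ω : Ω} (hl1 : ∀ k, 1 ≤ k → 0 ≤ l1 (ι k))
    (hb : ∀ k : ℕ, 1 ≤ k → k ≤ K → κ < k → LargeBonus (M.WDiffStar sig) σ (lam (ι k)) (l1 (ι k)) (l1 1)
      (l2 k) (c₁ k) (c₂ k))
    (hC : ∀ k, 1 ≤ k → k ≤ K → I.Concentrated M sig Vmax σ (lam (ι k)) (l1 (ι k)) (l1 1) (l2 k) L
      k ω)
    (hgap : ∀ k : ℕ, 1 ≤ k → κg < k → 36 * M.WStar sig * l1 (ι k) / M.vGap Sinit ≤ c₁ k)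
    (hpath : ∑ k ∈ Finset.Icc 1 K,
      (-(if κ < k then 1 / (12 * Vmax) * episodeCost M (c₁ k) (c₂ k) Vmax L eg (I.N k ω) (I.pol k ω)
          (I.path k ω) else 0) -
        Real.log (M.trajExp (I.pol k ω) 0 (I.s k 0 ω) fun x => Real.exp
          (-(if κ < k then 1 / (12 * Vmax) * episodeCost M (c₁ k) (c₂ k) Vmax L eg (I.N k ω)
            (I.pol k ω) x else 0)))) < l₀) :
    I.regret M K ω ≤ Vmax * ((min κ (K : ℕ∞)).toNat : ℝ) +
      ∑ k ∈ (Finset.Icc 1 K).filter (fun k : ℕ => κ < (k : ℕ∞) ∧ (k : ℕ∞) ≤ κg),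
        144 * M.WStar sig * l1 (ι k) / c₁ k +
      459 / 100 * (12 * Vmax * l₀ +
        ∑ s, ∑ a, (36 * Vmax * (1 + Real.log (K * H) / Real.log (5 / 4)) +
        (∑ n ∈ Finset.Icc 1 (K * H), max (15 / 4 * min (c₁ K / n) (c₂ K / √n)
          - minOverSteps eg s a / (108 / 25)) 0 +
          405 / 16 * Vmax * Fintype.card S * L * (1 + Real.log (K * H))))) := by
  set t : ℝ := 1 / (12 * Vmax) with ht
  have ht0 : 0 < t := by positivity
  set cost : ℕ → (Fin H → S) → ℝ := fun k => episodeCost M (c₁ k) (c₂ k) Vmax L eg (I.N k ω)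
    (I.pol k ω) with hcost
  set Z : ℕ → ℝ := fun k => -Real.log (M.trajExp (I.pol k ω) 0 (I.s k 0 ω) fun x =>
    Real.exp (-(t * cost k x))) with hZ
  set reg : ℕ → ℝ := fun k => M.Vstar 0 (I.s k 0 ω) - M.V (I.pol k ω) 0 (I.s k 0 ω) with hreg
  set e : ℕ → ℝ := fun k => if (k : ℕ∞) ≤ κg then 144 * M.WStar sig * l1 (ι k) / c₁ k else 0 with he
  have hterm0 : ∀ k, 1 ≤ k → 0 ≤ 144 * M.WStar sig * l1 (ι k) / c₁ k := fun k hk =>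
    div_nonneg (mul_nonneg (mul_nonneg (by norm_num) (M.WStar_nonneg sig)) (hl1 k hk)) (hc₁ k hk).le
  have hregV : ∀ k, reg k ≤ Vmax := fun k => by
    have h1 := (TabularMDP.Vstar_mem hV0.le hV 0 (I.s k 0 ω)).2
    have h2 := (TabularMDP.V_mem hV0.le hV (I.pol k ω) 0 (I.s k 0 ω)).1
    simp only [hreg]
    linarith
  have hregZ : ∀ k ∈ (Finset.Icc 1 K).filter (fun k : ℕ => κ < (k : ℕ∞)),
      reg k ≤ 459 / 100 * (12 * Vmax * Z k) + e k := fun k hk => by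
    rw [Finset.mem_filter, Finset.mem_Icc] at hk
    obtain ⟨⟨hk1, hkK⟩, hκ⟩ := hk
    have h1 := (hC k hk1 hkK).regret_le hH hV0 hV (hc₂ k hk1).le hL (hl1 k hk1) (hb k hk1 hkK hκ) hE
      hk1 heg (hinit k hk1 ω) (e := e k)
      (by simp only [he]; split_ifs; exacts [hterm0 k hk1, le_rfl])
      (by
        simp only [he]
        split_ifs with hg
        · exact Or.inr le_rfl
        · exact Or.inl (hgap k hk1 (not_le.1 hg)))
    have h2 := M.trajExp_saturate_le_neg_log (I.pol k ω) (I.s k 0 ω) ht0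
      (fun x => ∃ s a, I.N k ω s a < 4 * pathVisits (I.pol k ω) x s a)
      (M.suboptSum_nonneg (X := fun j s a => max (3 / 2 * widthOf (c₁ k) (c₂ k) Vmax
        (Fintype.card S) L (I.N k ω s a) - eg j s a / (108 / 25)) 0)
        (fun _ _ _ => le_max_right _ _) (I.pol k ω))
    have h3 : (-Real.log (M.trajExp (I.pol k ω) 0 (I.s k 0 ω) fun x => Real.exp (-(t *
        TabularMDP.truncCost (fun x => ∃ s a, I.N k ω s a < 4 * pathVisits (I.pol k ω) x s a) (3 / t)
        (M.suboptSum (fun j s a => max (3 / 2 * widthOf (c₁ k) (c₂ k) Vmax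
        (Fintype.card S) L (I.N k ω s a) - eg j s a / (108 / 25)) 0) (I.pol k ω)) x))) / t) =
        12 * Vmax * Z k := by
      change Z k / t = _
      rw [ht]
      field_simp
    rw [h3] at h2
    linarith
  have hsumZ : 12 * Vmax * ∑ k ∈ (Finset.Icc 1 K).filter (fun k : ℕ => κ < (k : ℕ∞)), Z k ≤
      12 * Vmax * l₀ + ∑ k ∈ Finset.Icc 1 K, cost k (I.path k ω) := by
    -- Episodes up to κ were given zero cost in the martingale, so they contribute −0 − log 1 = 0.
    have h1 : ∑ k ∈ (Finset.Icc 1 K).filter (fun k : ℕ => κ < (k : ℕ∞)),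
        (Z k - t * cost k (I.path k ω)) < l₀ := by
      rw [Finset.sum_filter]
      refine lt_of_le_of_lt (le_of_eq (Finset.sum_congr rfl fun k _ => ?_)) hpath
      split_ifs with hκ
      · simp only [hZ]; ring
      · simp only [neg_zero, Real.exp_zero, M.trajExp_const, Real.log_one, sub_zero]
    rw [Finset.sum_sub_distrib, ← Finset.mul_sum] at h1
    have h2 : ∑ k ∈ (Finset.Icc 1 K).filter (fun k : ℕ => κ < (k : ℕ∞)), cost k (I.path k ω) ≤
        ∑ k ∈ Finset.Icc 1 K, cost k (I.path k ω) :=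
      Finset.sum_le_sum_of_subset_of_nonneg (Finset.filter_subset _ _)
        fun k _ _ => episodeCost_nonneg M hV0.le eg _ _ _
    have h3 := mul_le_mul_of_nonneg_left h1.le (by positivity : 0 ≤ 12 * Vmax)
    have h4 : 12 * Vmax * t = 1 := by rw [ht]; field_simp
    rw [mul_sub, ← mul_assoc, h4, one_mul] at h3
    linarith
  have hcostsum := sum_episodeCost_le I M hH hK (hc₁ K hK).le (hc₂ K hK).le
    (fun k h1 h2 => hc₁mono k K h1 h2) (fun k h1 h2 => hc₂mono k K h1 h2) hV0.le hL eg ω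
  have hsplit : I.regret M K ω = ∑ k ∈ (Finset.Icc 1 K).filter (fun k : ℕ => κ < (k : ℕ∞)), reg k +
      ∑ k ∈ (Finset.Icc 1 K).filter (fun k : ℕ => ¬ κ < (k : ℕ∞)), reg k :=
    (Finset.sum_filter_add_sum_filter_not _ _ _).symm
  have hsmall : ∑ k ∈ (Finset.Icc 1 K).filter (fun k : ℕ => ¬ κ < (k : ℕ∞)), reg k ≤
      Vmax * ((min κ (K : ℕ∞)).toNat : ℝ) := by
    refine (Finset.sum_le_card_nsmul _ _ Vmax fun k _ => hregV k).trans ?_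
    rw [nsmul_eq_mul, mul_comm]
    gcongr
    exact card_filter_not_lt κ K
  have hlarge := Finset.sum_le_sum hregZ
  rw [Finset.sum_add_distrib, ← Finset.mul_sum, ← Finset.mul_sum] at hlarge
  have hesum : ∑ k ∈ (Finset.Icc 1 K).filter (fun k : ℕ => κ < (k : ℕ∞)), e k =
      ∑ k ∈ (Finset.Icc 1 K).filter (fun k : ℕ => κ < (k : ℕ∞) ∧ (k : ℕ∞) ≤ κg),
        144 * M.WStar sig * l1 (ι k) / c₁ k := by
    rw [← Finset.filter_filter, Finset.sum_filter (fun k : ℕ => (k : ℕ∞) ≤ κg)]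
  rw [hsplit]
  change ∑ k ∈ Finset.Icc 1 K, cost k (I.path k ω) ≤ _ at hcostsum
  linarith

end Interaction

/-! ### From the good event to the distributional regret -/

namespace Interaction

variable {S A Ω : Type*} [Fintype S] [Fintype A] [Nonempty A]

theorem distRegret_le_of_measure_le [MeasurableSpace Ω] {H : ℕ} {I : Interaction S A H Ω}
    {M : TabularMDP S A H} {μ : Measure Ω} {K : ℕ} {δ x : ℝ}
    (h : μ {ω | x < I.regret M K ω} ≤ ENNReal.ofReal δ) : I.distRegret M μ K δ ≤ (x : EReal) :=
  sInf_le ⟨x, h, rfl⟩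

theorem regret_le_mul {H : ℕ} {I : Interaction S A H Ω} {M : TabularMDP S A H} {Vmax : ℝ}
    (hV0 : 0 ≤ Vmax)
    (hV : ∀ (π : Policy S A H) (h : Fin H) (s : S), 0 ≤ M.V π h s ∧ M.V π h s ≤ Vmax) (K : ℕ)
    (ω : Ω) : I.regret M K ω ≤ Vmax * K := by
  refine (Finset.sum_le_card_nsmul _ _ Vmax fun k _ => ?_).trans ?_
  · have h1 := (TabularMDP.Vstar_mem hV0 hV 0 (I.s k 0 ω)).2
    have h2 := (TabularMDP.V_mem hV0 hV (I.pol k ω) 0 (I.s k 0 ω)).1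
    linarith
  · rw [nsmul_eq_mul, mul_comm, Nat.card_Icc, Nat.add_sub_cancel]

theorem log_div_le_ell2 {H nS nA : ℕ} (hH : 1 ≤ H) (hS : 1 ≤ nS) (hA : 1 ≤ nA) {δ : ℝ} (hδ : 0 < δ)
    {K : ℕ} (hK : 1 ≤ K) : Real.log (32 / δ) ≤ ell2 H nS nA K δ := by
  have h1 : (1 : ℝ) ≤ H := by exact_mod_cast hH
  have h2 : (1 : ℝ) ≤ nS := by exact_mod_cast hS
  have h3 : (1 : ℝ) ≤ nA := by exact_mod_cast hA
  have h6 := log_natCast_mul_nonneg hK hH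
  rw [ell2_eq, log_exp_two_mul hK hH]
  refine Real.log_le_log (by positivity) ?_
  have h7 : (1 : ℝ) ≤ (2 + Real.log (K * H)) ^ 2 := by nlinarith
  have h8 : (1 : ℝ) ≤ H * nS * nA := one_le_mul_of_one_le_of_one_le
    (one_le_mul_of_one_le_of_one_le h1 h2) h3
  calc 32 / δ = 32 / δ * 1 := (mul_one _).symm
    _ ≤ 32 / δ * (H * nS * nA * (2 + Real.log (K * H)) ^ 2) := by
        gcongr
        exact one_le_mul_of_one_le_of_one_le h8 h7
    _ = _ := by ring

/-- The regret bound for every gap term `G` that dominates the sums of the excess bonuses. -/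
theorem distRegret_le_regretBound [mΩ : MeasurableSpace Ω] {μ : Measure Ω} [IsProbabilityMeasure μ]
    {H : ℕ} (hH : 1 ≤ H) {M : TabularMDP S A H} {Sinit : Set S} {Vmax : ℝ}
    (hV : ∀ (π : Policy S A H) (h : Fin H) (s : S), 0 ≤ M.V π h s ∧ M.V π h s ≤ Vmax)
    {c₁ c₂ : ℕ → ℝ} (hc₁ : ∀ k, 1 ≤ k → 0 < c₁ k) (hc₂ : ∀ k, 1 ≤ k → 0 < c₂ k)
    (hc₁mono : ∀ k l, 1 ≤ k → k ≤ l → c₁ k ≤ c₁ l)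
    (hc₂mono : ∀ k l, 1 ≤ k → k ≤ l → c₂ k ≤ c₂ l)
    {ℱ : Filtration (ℕ ×ₗ ℕ) mΩ} {I : Interaction S A H Ω}
    (hI : I.InMDP M Sinit μ ℱ) (hEQO : I.FollowsEQO c₁ c₂ Vmax)
    {sig : Fin H → S → A → ℝ} (hsig : ∀ h s a, 0 ≤ sig h s a) {Valpha : ℝ} (hVα : 0 ≤ Valpha)
    (hsub : I.SubExp M μ ℱ sig Valpha) {δ : ℝ} (hδ : 0 < δ) (hδ1 : δ ≤ 1)
    {l1 l2 : ℕ → ℝ} (hl1 : l1 = fun i => ell1 H (Fintype.card S) (Fintype.card A) i δ)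
    (hl2 : l2 = fun k => ell2 H (Fintype.card S) (Fintype.card A) k δ)
    {lam : ℕ → ℝ} {ι : ℕ → ℕ} (haux : IsAuxSeq l1 (M.WDiffStar sig) Valpha c₁ lam ι)
    {K : ℕ} (hK : 1 ≤ K) {eg : Fin H → S → A → ℝ} (heg : M.IsEffectiveGap Sinit eg) {κg : ℕ∞}
    (hgap : ∀ k : ℕ, 1 ≤ k → κg < k → 36 * M.WStar sig * l1 (ι k) / M.vGap Sinit ≤ c₁ k)
    {G : S → A → ℝ}
    (hG : ∀ s a, ∑ n ∈ Finset.Icc 1 (K * H), 17 / 16 * max (18 * min (c₁ K / n) (c₂ K / √n)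
      - minOverSteps eg s a) 0 ≤ G s a + Vmax) :
    I.distRegret M μ K δ ≤
      (regretBound H (Fintype.card S) (Fintype.card A) K Vmax (M.WStar sig) l1 l2 c₁ ι
        (kappa l1 l2 (M.WDiffStar sig) Valpha (sigmaMax sig Valpha Vmax) c₁ c₂ ι) κg
        (∑ s, ∑ a, G s a) : ℝ) := by
  classical
  obtain ⟨ω₀⟩ : Nonempty Ω := nonempty_of_isProbabilityMeasure μ
  have : Nonempty S := ⟨I.s 1 0 ω₀⟩
  have hS : 1 ≤ Fintype.card S := Fintype.card_pos
  have hA : 1 ≤ Fintype.card A := Fintype.card_pos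
  have hV0 : 0 ≤ Vmax := TabularMDP.Vmax_nonneg hH hV
  refine distRegret_le_of_measure_le ?_
  set κ := kappa l1 l2 (M.WDiffStar sig) Valpha (sigmaMax sig Valpha Vmax) c₁ c₂ ι with hκ
  set nS : ℝ := (Fintype.card S : ℝ) with hnS
  set nA : ℝ := (Fintype.card A : ℝ) with hnA
  have hnS1 : 1 ≤ nS := Nat.one_le_cast.2 hS
  have hnA1 : 1 ≤ nA := Nat.one_le_cast.2 hA
  set p : ℝ := nS ^ 2 * nA with hp
  have hp1 : 1 ≤ p := one_le_mul_of_one_le_of_one_le (one_le_pow₀ hnS1) hnA1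
  have hqp : nS * nA ≤ p := by 
    rw [hp, sq]
    nlinarith [mul_nonneg (sub_nonneg.2 hnS1) (by positivity : 0 ≤ nS * nA)]
  have hl1pos : ∀ i, 1 ≤ i → 0 < l1 i := fun i hi => by
    rw [hl1]; exact ell1_pos hH hS hA hδ hδ1 hi
  have hl2ge : 97 / 20 + Real.log nS ≤ l2 K := by rw [hl2]; exact ell2_ge hH hS hA hδ hδ1 hK
  have hlogS : 0 ≤ Real.log nS := Real.log_nonneg hnS1
  have hl2pos : ∀ k, 1 ≤ k → 0 < l2 k := fun k hk => by
    rw [hl2]; have := ell2_pos hH hS hA hδ hδ1 hk; linarith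
  set Λ := Real.log (2 * K * H) with hΛ
  have hK1 : (1 : ℝ) ≤ K := by exact_mod_cast hK
  have hH1 : (1 : ℝ) ≤ H := by exact_mod_cast hH
  have hx : Real.log (K * H) = Λ - Real.log 2 := by
    rw [hΛ, mul_assoc, Real.log_mul two_ne_zero (by positivity), add_sub_cancel_left]
  have hKH0 : 0 ≤ Real.log (K * H) := log_natCast_mul_nonneg hK hH
  have hΛ1 : 69 / 100 ≤ Λ := by linarith [log_two_ge]
  have hsumG : -(nS * nA * Vmax) ≤ ∑ s, ∑ a, G s a := by
    have h1 : ∀ s a, -Vmax ≤ G s a := fun s a => by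
      have h2 : 0 ≤ ∑ n ∈ Finset.Icc 1 (K * H), 17 / 16 * max (18 * min (c₁ K / n) (c₂ K / √n)
        - minOverSteps eg s a) 0 := Finset.sum_nonneg fun n _ => by positivity
      linarith [hG s a]
    calc -(nS * nA * Vmax) = ∑ s : S, ∑ a : A, -Vmax := by
          simp only [Finset.sum_const, Finset.card_univ, nsmul_eq_mul]; rw [hnS, hnA]; ring
      _ ≤ _ := Finset.sum_le_sum fun s _ => Finset.sum_le_sum fun a _ => h1 s a
  have hslack : nS * nA * Vmax ≤ Vmax * p * l2 K * Λ := by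
    have h1 : 1 ≤ l2 K * Λ := by nlinarith
    have h2 : nS * nA * Vmax ≤ p * Vmax := by gcongr
    have h3 : 0 ≤ p * Vmax := by positivity
    nlinarith
  have hE0 : 0 ≤ ∑ k ∈ (Finset.Icc 1 K).filter (fun k : ℕ => κ < (k : ℕ∞) ∧ (k : ℕ∞) ≤ κg),
      144 * M.WStar sig * l1 (ι k) / c₁ k := Finset.sum_nonneg fun k hk => by
    have hk1 := (Finset.mem_Icc.1 (Finset.mem_filter.1 hk).1).1
    have h1 := hl1pos _ (haux.iota_pos k hk1)
    have h2 := hc₁ k hk1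
    have h3 := M.WStar_nonneg sig
    positivity
  have hbound : regretBound H (Fintype.card S) (Fintype.card A) K Vmax (M.WStar sig) l1 l2 c₁ ι
        κ κg (∑ s, ∑ a, G s a) = Vmax * ((min κ (K : ℕ∞)).toNat : ℝ) + ∑ s, ∑ a, G s a +
      ∑ k ∈ (Finset.Icc 1 K).filter (fun k : ℕ => κ < (k : ℕ∞) ∧ (k : ℕ∞) ≤ κg),
        144 * M.WStar sig * l1 (ι k) / c₁ k + 288 * (Vmax * p * l2 K * Λ) := by
    unfold regretBound
    rw [← hnS, ← hnA, hp]
    congr 1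
    · ring
  rw [hbound]
  -- If the lower-order term already covers Vmax K, nothing probabilistic is needed. Of its 288
  -- units one is kept for `hslack`, because the gap terms may be as low as −Vmax for each pair.
  by_cases htriv : Vmax * K ≤ 287 * (Vmax * p * l2 K * Λ)
  · have hempty : {ω | Vmax * ((min κ (K : ℕ∞)).toNat : ℝ) + ∑ s, ∑ a, G s a +
        ∑ k ∈ (Finset.Icc 1 K).filter (fun k : ℕ => κ < (k : ℕ∞) ∧ (k : ℕ∞) ≤ κg),
          144 * M.WStar sig * l1 (ι k) / c₁ k + 288 * (Vmax * p * l2 K * Λ) < I.regret M K ω} = ∅ := by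
      refine Set.eq_empty_of_forall_notMem fun ω hω => ?_
      rw [Set.mem_ofPred_eq] at hω
      refine absurd hω (not_lt.2 ?_)
      have h1 := regret_le_mul (I := I) hV0 hV K ω
      have h2 : 0 ≤ Vmax * ((min κ (K : ℕ∞)).toNat : ℝ) := by positivity
      linarith
    rw [hempty, measure_empty]
    exact zero_le
  have hVpos : 0 < Vmax := by
    rcases hV0.eq_or_lt with h | h
    · exact absurd (by rw [← h]; simp) htriv
    · exact h
  have hΛ97 : 97 / 10 ≤ Λ := by
    by_contra hcon
    refine htriv ?_
    have h1 := natCast_le_of_log_lt hK hH hp1 (by linarith : 97 / 20 ≤ l2 K) (not_le.1 hcon)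
    calc Vmax * K ≤ Vmax * (287 * p * l2 K * Λ) := by gcongr
      _ = _ := by ring
  obtain ⟨σ, hσ, hσ1, hσ2, hσ3⟩ := exists_scale M (sig := sig) (Valpha := Valpha) (Vmax := Vmax) hH
    hsig (K := K) (hc₂ 1 le_rfl) (fun k hk => hc₂mono 1 k le_rfl hk) (hl2pos K hK)
    (fun k h1 h2 => by rw [hl2]; exact ell2_mono hH hS hA hδ h1 h2)
  set L : ℝ := l2 K + Real.log nS with hLdef
  have hL0 : 0 ≤ L := by have := hl2pos K hK; positivity
  set l₀ := Real.log (32 / δ) with hl₀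
  let _ : MeasurableSpace S := ⊤
  let _ : MeasurableSpace A := ⊤
  have hmC := hI.measure_not_concentrated_le hH hsig hVα hsub hV0 hσ hσ1 hσ2 hδ hδ1 haux.lam_pos
    haux.lam_le haux.iota_pos K
  -- The cost of an episode depends on the past only through the policy and the visit counts, which
  -- form a countable type.
  have hmP := hI.measure_path_sum_ge_le hH (D := Policy S A H × (S → A → ℕ))
    (fun k ω => (I.pol k ω, I.N k ω))
    (fun k hk => (hI.measurable_pol hk).prodMk
      (@measurable_pi_lambda _ _ _ (ℱ (toLex (k, 0))) _ _ fun x =>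
        @measurable_pi_lambda _ _ _ (ℱ (toLex (k, 0))) _ _ fun b => hI.measurable_N x b))
    (fun k d x => if κ < k then 1 / (12 * Vmax) * episodeCost M (c₁ k) (c₂ k) Vmax L eg d.2 d.1 x
      else 0) l₀ K
  refine (measure_mono (t := _ ∪ _) ?_).trans ((measure_union_le _ _).trans
    ((add_le_add hmC hmP).trans ?_))
  · intro ω hω
    by_contra hcon
    rw [Set.mem_union, not_or] at hcon
    obtain ⟨h1, h2⟩ := hcon
    rw [Set.mem_ofPred_eq, not_not] at h1
    rw [Set.mem_ofPred_eq, not_le] at h2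
    rw [Set.mem_ofPred_eq] at hω
    refine absurd hω (not_lt.2 ?_)
    have h3 := regret_le_of_concentrated hH hVpos hV hc₂ hc₁mono hc₂mono hc₁ hI.init hEQO (σ := σ)
      (L := L) (l₀ := l₀) hL0 (lam := lam) (l1 := l1) (l2 := l2) (ι := ι) (κ := κ) (κg := κg) hK heg
      (ω := ω) (fun k hk => (hl1pos _ (haux.iota_pos k hk)).le)
      (fun k hk hkK hκk => by
        obtain ⟨g1, g2⟩ := le_of_kappa_lt hk hκk
        exact ⟨hc₁ k hk, haux.lam_pos _ (haux.iota_pos k hk), (hl1pos 1 le_rfl).le, (hl2pos k hk).le,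
          haux.lower k hk g1, haux.upper k hk g1, hσ3 k hk hkK _ _ g2⟩)
      (fun k hk hkK => by
        have := h1 k hk hkK
        rw [hl1, hLdef, hl2]
        exact this) hgap h2
    refine h3.trans ?_
    -- Here 459/100 = (108/25)(17/16), so the gap gets coefficient exactly 17/16, while
    -- (459/100)(15/4) is below (17/16)·18.
    have h4 : 459 / 100 * ∑ s, ∑ a, ∑ n ∈ Finset.Icc 1 (K * H), max (15 / 4 * min (c₁ K / n)
        (c₂ K / √n) - minOverSteps eg s a / (108 / 25)) 0 ≤ ∑ s, ∑ a, G s a + nS * nA * Vmax := by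
      have h5 : ∑ s, ∑ a, G s a + nS * nA * Vmax = ∑ s : S, ∑ a : A, (G s a + Vmax) := by
        simp only [Finset.sum_add_distrib, Finset.sum_const, Finset.card_univ, nsmul_eq_mul]
        rw [hnS, hnA]; ring
      rw [h5, Finset.mul_sum]
      refine Finset.sum_le_sum fun s _ => ?_
      rw [Finset.mul_sum]
      refine Finset.sum_le_sum fun a _ => le_trans ?_ (hG s a)
      rw [Finset.mul_sum]
      refine Finset.sum_le_sum fun n _ => ?_
      have h6 : 0 ≤ min (c₁ K / n) (c₂ K / √n) := by
        have := hc₁ K hK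
        have := hc₂ K hK
        positivity
      have h7 := le_max_left (18 * min (c₁ K / n) (c₂ K / √n) - minOverSteps eg s a) 0
      have h8 := le_max_right (18 * min (c₁ K / n) (c₂ K / √n) - minOverSteps eg s a) 0
      rcases le_total (15 / 4 * min (c₁ K / n) (c₂ K / √n) - minOverSteps eg s a / (108 / 25)) 0
        with h9 | h9
      · rw [max_eq_right h9]; linarith
      · rw [max_eq_left h9]; linarith
    have h5 := lower_order_le (q := nS * nA) hV0 hp1 hqp hx hΛ97 (by linarith : 97 / 20 ≤ l2 K)
      (by rw [hl2]; exact log_div_le_ell2 hH hS hA hδ hK : l₀ ≤ l2 K) (L := L) (by linarith)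
    have h6 : ∑ s : S, ∑ a : A, (36 * Vmax * (1 + Real.log (K * H) / Real.log (5 / 4)) +
        (∑ n ∈ Finset.Icc 1 (K * H), max (15 / 4 * min (c₁ K / n) (c₂ K / √n)
          - minOverSteps eg s a / (108 / 25)) 0 +
          405 / 16 * Vmax * nS * L * (1 + Real.log (K * H)))) =
        nS * nA * (36 * Vmax * (1 + Real.log (K * H) / Real.log (5 / 4))) +
        ∑ s, ∑ a, ∑ n ∈ Finset.Icc 1 (K * H), max (15 / 4 * min (c₁ K / n)
        (c₂ K / √n) - minOverSteps eg s a / (108 / 25)) 0 +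
        p * (405 / 16 * Vmax * L * (1 + Real.log (K * H))) := by
      simp only [Finset.sum_add_distrib, Finset.sum_const, Finset.card_univ, nsmul_eq_mul]
      rw [← hnS, ← hnA, hp]; ring
    rw [h6]
    linarith
  -- The two failures have total probability at most 18δ/32 + δ/32.
  · rw [Real.exp_neg, hl₀, Real.exp_log (by positivity), inv_div, ← ENNReal.ofReal_add (by positivity)
      (by positivity)]
    exact ENNReal.ofReal_le_ofReal (by linarith)

end Interaction

/-! ## Sums of excess bonuses -/

section ExcessSums

/-- Beyond b the excess vanishes; below b the gap is simply dropped. This leaves a harmonic or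
inverse-square-root sum up to (a/g) or (a/g)². -/
theorem sum_max_le_of_le_floor {u : ℕ → ℝ} {b g : ℝ} (hu : ∀ n, 0 ≤ u n) (hg : 0 ≤ g)
    (hlt : ∀ n : ℕ, 1 ≤ n → b < n → u n ≤ g) (N : ℕ) :
    ∑ n ∈ Finset.Icc 1 N, max (u n - g) 0 ≤ ∑ n ∈ Finset.Icc 1 ⌊b⌋₊, u n := by
  calc ∑ n ∈ Finset.Icc 1 N, max (u n - g) 0
      ≤ ∑ n ∈ Finset.Icc 1 N, if n ∈ Finset.Icc 1 ⌊b⌋₊ then u n else 0 := by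
        refine Finset.sum_le_sum fun n hn => ?_
        have hn1 := (Finset.mem_Icc.1 hn).1
        have hun := hu n
        split_ifs with h
        · exact max_le (by linarith) hun
        · refine max_le ?_ le_rfl
          have : b < n := by
            by_contra hcon
            exact h (Finset.mem_Icc.2 ⟨hn1, Nat.le_floor (not_lt.1 hcon)⟩)
          linarith [hlt n hn1 this]
    _ ≤ ∑ n ∈ Finset.Icc 1 ⌊b⌋₊, u n := by
        rw [Finset.sum_ite_mem]
        exact Finset.sum_le_sum_of_subset_of_nonneg Finset.inter_subset_right fun n _ _ => hu n

theorem sum_div_excess_le {a g : ℝ} (hg : 0 < g) (hag : g ≤ a) (N : ℕ) :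
    ∑ n ∈ Finset.Icc 1 N, max (a / n - g) 0 ≤ a * (1 + Real.log (a / g)) := by
  have ha : 0 < a := hg.trans_le hag
  refine (sum_max_le_of_le_floor (b := a / g) (fun n => by positivity) hg.le (fun n hn h => ?_)
    N).trans ?_
  · have : (0 : ℝ) < n := by exact_mod_cast hn
    rw [div_lt_iff₀ hg] at h
    rw [div_le_iff₀ this]
    linarith
  · have h1 : ∀ n : ℕ, a / n = a * (1 / n) := fun n => by ring
    simp only [h1]
    rw [← Finset.mul_sum]
    have h2 : 1 ≤ ⌊a / g⌋₊ := Nat.le_floor (by rw [Nat.cast_one, le_div_iff₀ hg]; linarith)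
    have h3 : (0 : ℝ) < ⌊a / g⌋₊ := by exact_mod_cast h2
    have h4 := Interaction.sum_one_div_le ⌊a / g⌋₊
    have h5 := Real.log_le_log h3 (Nat.floor_le (by positivity : 0 ≤ a / g))
    gcongr
    linarith

theorem sum_one_div_sqrt_le (n : ℕ) : ∑ i ∈ Finset.Icc 1 n, 1 / √(i : ℝ) ≤ 2 * √(n : ℝ) := by
  induction n with
  | zero => simp
  | succ n ih =>
    rw [Finset.sum_Icc_succ_top (by omega)]
    have h1 : 0 < √((n + 1 : ℕ) : ℝ) := Real.sqrt_pos.2 (by positivity)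
    have h2 : 0 ≤ √(n : ℝ) := Real.sqrt_nonneg _
    have h3 : √(n : ℝ) ^ 2 = n := Real.sq_sqrt (by positivity)
    have h4 : √((n + 1 : ℕ) : ℝ) ^ 2 = n + 1 := by rw [Real.sq_sqrt (by positivity)]; push_cast; ring
    have h5 : 1 / √((n + 1 : ℕ) : ℝ) ≤ 2 * √((n + 1 : ℕ) : ℝ) - 2 * √(n : ℝ) := by
      rw [div_le_iff₀ h1]
      nlinarith [sq_nonneg (√((n + 1 : ℕ) : ℝ) - √(n : ℝ))]
    linarith

theorem sum_div_sqrt_excess_le {a g : ℝ} (ha : 0 ≤ a) (hg : 0 < g) (N : ℕ) :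
    ∑ n ∈ Finset.Icc 1 N, max (a / √(n : ℝ) - g) 0 ≤ 2 * a ^ 2 / g := by
  refine (sum_max_le_of_le_floor (b := (a / g) ^ 2) (fun n => by positivity) hg.le
    (fun n hn h => ?_) N).trans ?_
  · have h1 : 0 < √(n : ℝ) := Real.sqrt_pos.2 (by exact_mod_cast hn)
    have h2 := Real.lt_sqrt_of_sq_lt h
    rw [div_lt_iff₀ hg] at h2
    rw [div_le_iff₀ h1]
    linarith
  · have h1 : ∀ n : ℕ, a / √(n : ℝ) = a * (1 / √(n : ℝ)) := fun n => by ring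
    simp only [h1]
    rw [← Finset.mul_sum]
    have h2 : √((⌊(a / g) ^ 2⌋₊ : ℕ) : ℝ) ≤ a / g :=
      Real.sqrt_le_iff.2 ⟨by positivity, Nat.floor_le (by positivity)⟩
    calc a * ∑ n ∈ Finset.Icc 1 ⌊(a / g) ^ 2⌋₊, 1 / √(n : ℝ)
        ≤ a * (2 * (a / g)) := by
          gcongr
          exact (sum_one_div_sqrt_le _).trans (by linarith)
      _ = _ := by ring

variable {c d g g' V : ℝ}

theorem sum_excess_le_sqrt (hd : 0 ≤ d) (hg : 0 < g) (hgg : g ≤ g') (N : ℕ) :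
    ∑ n ∈ Finset.Icc 1 N, 17 / 16 * max (18 * min (c / n) (d / √(n : ℝ)) - g') 0 ≤
      2048 * d ^ 2 / g := by
  rw [← Finset.mul_sum]
  have h1 := sum_div_sqrt_excess_le (a := 18 * d) (by positivity) hg N
  have h2 : ∑ n ∈ Finset.Icc 1 N, max (18 * min (c / n) (d / √(n : ℝ)) - g') 0 ≤
      ∑ n ∈ Finset.Icc 1 N, max (18 * d / √(n : ℝ) - g) 0 := by
    refine Finset.sum_le_sum fun n _ => max_le_max ?_ le_rfl
    have := min_le_right (c / n) (d / √(n : ℝ))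
    rw [mul_div_assoc]
    linarith
  calc _ ≤ 17 / 16 * (2 * (18 * d) ^ 2 / g) := by gcongr; exact h2.trans h1
    _ = 1377 / 2 * (d ^ 2 / g) := by ring
    _ ≤ 2048 * (d ^ 2 / g) := by gcongr; norm_num
    _ = _ := by ring

theorem sum_excess_le_log (hc : 0 < c) (hg : 0 < g) (hgg : g ≤ g') (hgc : g ≤ 32 * c) (N : ℕ) :
    ∑ n ∈ Finset.Icc 1 N, 17 / 16 * max (18 * min (c / n) (d / √(n : ℝ)) - g') 0 ≤
      64 * c * Real.log (32 * c / g) := by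
  rw [← Finset.mul_sum]
  have h2 : ∑ n ∈ Finset.Icc 1 N, max (18 * min (c / n) (d / √(n : ℝ)) - g') 0 ≤
      ∑ n ∈ Finset.Icc 1 N, max (18 * c / (n : ℝ) - g) 0 := by
    refine Finset.sum_le_sum fun n _ => max_le_max ?_ le_rfl
    have := min_le_left (c / n) (d / √(n : ℝ))
    rw [mul_div_assoc]
    linarith
  rcases le_total g (18 * c) with h | h
  · have h1 := sum_div_excess_le hg h N
    have h3 : Real.log (32 * c / g) = Real.log (16 / 9) + Real.log (18 * c / g) := by
      rw [← Real.log_mul (by norm_num) (by positivity)]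
      congr 1
      ring
    -- The surplus from 18 to 32 inside the logarithm pays for the 1 of the harmonic sum: 64 · 7/16
    -- = 28 exceeds 17/16 · 18 = 153/8.
    have h4 : (7 / 16 : ℝ) ≤ Real.log (16 / 9) := by
      have := Real.one_sub_inv_le_log_of_pos (by norm_num : (0 : ℝ) < 16 / 9)
      norm_num at this ⊢
      linarith
    have h5 : 0 ≤ Real.log (18 * c / g) := Real.log_nonneg (by rw [le_div_iff₀ hg]; linarith)
    calc _ ≤ 17 / 16 * (18 * c * (1 + Real.log (18 * c / g))) := by gcongr; exact h2.trans h1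
      _ = c * (153 / 8 * (1 + Real.log (18 * c / g))) := by ring
      _ ≤ c * (64 * Real.log (32 * c / g)) := mul_le_mul_of_nonneg_left (by linarith) hc.le
      _ = _ := by ring
  · have h1 : ∑ n ∈ Finset.Icc 1 N, max (18 * c / (n : ℝ) - g) 0 ≤ 0 := by
      refine Finset.sum_nonpos fun n hn => max_le ?_ le_rfl
      have hn1 : (1 : ℝ) ≤ n := by exact_mod_cast (Finset.mem_Icc.1 hn).1
      have : 18 * c / n ≤ 18 * c := div_le_self (by positivity) hn1
      linarith
    have h3 : 0 ≤ Real.log (32 * c / g) := Real.log_nonneg (by rw [le_div_iff₀ hg]; linarith)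
    have h4 : 0 ≤ 64 * c * Real.log (32 * c / g) := by positivity
    linarith

theorem sum_excess_eq_zero (hc : 0 ≤ c) (hgg : g ≤ g') (hgc : 18 * c ≤ g) (N : ℕ) :
    ∑ n ∈ Finset.Icc 1 N, 17 / 16 * max (18 * min (c / n) (d / √(n : ℝ)) - g') 0 = 0 := by
  refine Finset.sum_eq_zero fun n hn => ?_
  have hn1 : (1 : ℝ) ≤ n := by exact_mod_cast (Finset.mem_Icc.1 hn).1
  have h1 : c / n ≤ c := div_le_self hc hn1
  have h2 := min_le_left (c / n) (d / √(n : ℝ))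
  rw [max_eq_right (by linarith), mul_zero]

theorem sum_excess_le_min (hc : 0 < c) (hd : 0 ≤ d) (hg : 0 < g) (hgg : g ≤ g') (hV : 0 ≤ V)
    (N : ℕ) :
    ∑ n ∈ Finset.Icc 1 N, 17 / 16 * max (18 * min (c / n) (d / √(n : ℝ)) - g') 0 ≤
      min (2048 * d ^ 2 / g) (64 * c * Real.log (max 1 (32 * c / g))) + V := by
  refine le_add_of_le_of_nonneg (le_min (sum_excess_le_sqrt hd hg hgg N) ?_) hV
  rcases le_total g (32 * c) with h | h
  · rw [max_eq_right (by rw [le_div_iff₀ hg]; linarith)]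
    exact sum_excess_le_log hc hg hgg h N
  · rw [sum_excess_eq_zero hc.le hgg (by linarith)]
    exact mul_nonneg (by positivity) (Real.log_nonneg (le_max_left _ _))

/-- Without the truncation at 1 the logarithm is negative when g > 32c. Then the excess is zero, and
log(2x) ≥ 1 − 1/(2x) with x = 32c/g gives 64c log x ≥ −g, so the extra V compensates. -/
theorem sum_excess_le_min_of_le (hc : 0 < c) (hd : 0 ≤ d) (hg : 0 < g) (hgg : g ≤ g')
    (hV : g ≤ V) (N : ℕ) :
    ∑ n ∈ Finset.Icc 1 N, 17 / 16 * max (18 * min (c / n) (d / √(n : ℝ)) - g') 0 ≤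
      min (2048 * d ^ 2 / g) (64 * c * Real.log (32 * c / g)) + V := by
  rcases le_total g (32 * c) with h | h
  · exact le_add_of_le_of_nonneg (le_min (sum_excess_le_sqrt hd hg hgg N)
      (sum_excess_le_log hc hg hgg h N)) (hg.le.trans hV)
  · rw [sum_excess_eq_zero hc.le hgg (by linarith)]
    have h1 : -V ≤ 2048 * d ^ 2 / g := by
      have : 0 ≤ 2048 * d ^ 2 / g := by positivity
      linarith
    have h2 : -V ≤ 64 * c * Real.log (32 * c / g) := by
      have h3 := Real.one_sub_inv_le_log_of_pos (by positivity : 0 < 2 * (32 * c / g))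
      rw [Real.log_mul two_ne_zero (by positivity)] at h3
      have h4 := Real.log_two_lt_d9
      have h5 : 64 * c * (2 * (32 * c / g))⁻¹ = g := by field_simp; norm_num
      have h6 := mul_le_mul_of_nonneg_left h3 (by positivity : 0 ≤ 64 * c)
      rw [mul_sub, h5] at h6
      nlinarith
    linarith [le_min h1 h2]

end ExcessSums

/-! ## Auxiliary sequences -/

section Auxiliary

/-- The rank of `j k` among the values of a monotone sequence from `k₀` on. -/
def valueRank (j : ℕ → ℕ) (k₀ k : ℕ) : ℕ := ((Finset.Icc k₀ k).image j).card

variable {j : ℕ → ℕ} {k₀ : ℕ}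

theorem one_le_valueRank {k : ℕ} (hk : k₀ ≤ k) : 1 ≤ valueRank j k₀ k :=
  Finset.card_pos.2 ⟨j k, Finset.mem_image_of_mem _ (Finset.mem_Icc.2 ⟨hk, le_rfl⟩)⟩

theorem valueRank_le_self (hk₀ : 1 ≤ k₀) (k : ℕ) : valueRank j k₀ k ≤ k := by
  refine Finset.card_image_le.trans ?_
  rw [Nat.card_Icc]
  omega

theorem valueRank_le (hj : ∀ k l, k₀ ≤ k → k ≤ l → j k ≤ j l) (k : ℕ) :
    valueRank j k₀ k ≤ j k + 1 := by
  have : (Finset.Icc k₀ k).image j ⊆ Finset.range (j k + 1) := by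
    intro n hn
    obtain ⟨m, hm, rfl⟩ := Finset.mem_image.1 hn
    rw [Finset.mem_Icc] at hm
    exact Finset.mem_range.2 (Nat.lt_succ_of_le (hj m k hm.1 hm.2))
  exact (Finset.card_le_card this).trans (by simp)

theorem eq_of_valueRank_eq (hj : ∀ k l, k₀ ≤ k → k ≤ l → j k ≤ j l) {k l : ℕ} (hk : k₀ ≤ k)
    (hl : k₀ ≤ l) (h : valueRank j k₀ k = valueRank j k₀ l) : j k = j l := by
  wlog hkl : k ≤ l generalizing k l
  · exact (this hl hk h.symm (le_of_not_ge hkl)).symm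
  have hsub : (Finset.Icc k₀ k).image j ⊆ (Finset.Icc k₀ l).image j :=
    Finset.image_subset_image (Finset.Icc_subset_Icc_right hkl)
  have heq := Finset.eq_of_subset_of_card_le hsub h.ge
  have hmem : j l ∈ (Finset.Icc k₀ k).image j := by
    rw [heq]; exact Finset.mem_image_of_mem _ (Finset.mem_Icc.2 ⟨hl, le_rfl⟩)
  obtain ⟨m, hm, hml⟩ := Finset.mem_image.1 hmem
  rw [Finset.mem_Icc] at hm
  exact le_antisymm (hj k l hk hkl) (hml ▸ hj m k hm.1 hm.2)

/-- From the first k₀ with c₁ above the threshold, sort c₁(k)/c₁(k₀) into dyadic ranges and set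
l1(i)/λ_i to half the lower end of the range. The index ι_k is the rank of the range among those
actually met, not its exponent: this gives ι_k ≤ k even if c₁ jumps, and still at most exponent + 1.
-/
theorem exists_isAuxSeq {l1 : ℕ → ℝ} (hl1 : ∀ i, 1 ≤ i → 0 < l1 i)
    (hl1le : ∀ i, 1 ≤ i → l1 i ≤ 2 ^ (i - 1) * l1 1) {Wd Valpha : ℝ} (hWd : 0 ≤ Wd)
    (hVα : 0 ≤ Valpha) {c₁ : ℕ → ℝ} (hc₁ : ∀ k, 1 ≤ k → 0 < c₁ k)
    (hmono : ∀ k l, 1 ≤ k → k ≤ l → c₁ k ≤ c₁ l) :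
    ∃ (lam : ℕ → ℝ) (ι : ℕ → ℕ), IsAuxSeq l1 Wd Valpha c₁ lam ι ∧
      ∀ k, 1 ≤ k → ι k ≤ k ∧ (ι k : ℝ) ≤ 3 + Real.logb 2 (c₁ k / c₁ 1) := by
  classical
  set θ := c1Threshold Wd Valpha (l1 1) with hθ
  have hlog0 : ∀ k, 1 ≤ k → 0 ≤ Real.logb 2 (c₁ k / c₁ 1) := fun k hk => by
    refine Real.logb_nonneg one_lt_two ?_
    rw [le_div_iff₀ (hc₁ 1 le_rfl), one_mul]
    exact hmono 1 k le_rfl hk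
  have hdef : 0 < 1 / (Valpha + 1) ∧ 1 / (Valpha + 1) * Valpha ≤ 1 := by
    refine ⟨by positivity, ?_⟩
    rw [one_div, inv_mul_le_iff₀ (by positivity)]
    linarith
  by_cases hex : ∃ k, 1 ≤ k ∧ θ ≤ c₁ k
  swap
  · push Not at hex
    refine ⟨fun _ => 1 / (Valpha + 1), fun _ => 1, ⟨fun _ _ => hdef.1, fun _ _ => hdef.2,
      fun _ _ => le_rfl, fun k hk h => absurd h (not_le.2 (hex k hk)),
      fun k hk h => absurd h (not_le.2 (hex k hk)), fun _ _ _ => rfl⟩, fun k hk => ⟨hk, ?_⟩⟩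
    have := hlog0 k hk
    push_cast
    linarith
  set k₀ := Nat.find hex with hk₀
  obtain ⟨hk₀1, hk₀θ⟩ : 1 ≤ k₀ ∧ θ ≤ c₁ k₀ := Nat.find_spec hex
  have hge : ∀ k, 1 ≤ k → (θ ≤ c₁ k ↔ k₀ ≤ k) := fun k hk =>
    ⟨fun h => Nat.find_min' hex ⟨hk, h⟩, fun h => hk₀θ.trans (hmono k₀ k hk₀1 h)⟩
  set b := c₁ k₀ with hb
  have hb0 : 0 < b := hc₁ k₀ hk₀1
  have hfl : ∀ k, ∃ n : ℕ, k₀ ≤ k → b * 2 ^ n ≤ c₁ k ∧ c₁ k < b * 2 ^ (n + 1) := fun k => by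
    by_cases hk : k₀ ≤ k
    · obtain ⟨n, h1, h2⟩ := exists_nat_pow_near (x := c₁ k / b) (y := 2)
        (by rw [le_div_iff₀ hb0, one_mul]; exact hmono k₀ k hk₀1 hk) one_lt_two
      rw [le_div_iff₀ hb0] at h1
      rw [div_lt_iff₀ hb0] at h2
      exact ⟨n, fun _ => ⟨by linarith, by linarith⟩⟩
    · exact ⟨0, fun h => absurd h hk⟩
  choose j hj using hfl
  have hjmono : ∀ k l, k₀ ≤ k → k ≤ l → j k ≤ j l := fun k l hk hkl => by
    have h1 := (hj k hk).1.trans ((hmono k l (hk₀1.trans hk) hkl).trans (hj l (hk.trans hkl)).2.le)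
    have h2 := (hj k hk).1.trans_lt
      ((hmono k l (hk₀1.trans hk) hkl).trans_lt (hj l (hk.trans hkl)).2)
    have h3 : (2 : ℝ) ^ j k < 2 ^ (j l + 1) := lt_of_mul_lt_mul_left h2 hb0.le
    have := (pow_lt_pow_iff_right₀ one_lt_two).1 h3
    omega
  -- All episodes of equal rank lie in the same dyadic range, so half its lower end is a function of
  -- the rank. Ranks never attained get the harmless value 1.
  have hq : ∀ i, ∃ q : ℝ, 0 < q ∧ ∀ k, k₀ ≤ k → valueRank j k₀ k = i → q = b * 2 ^ j k / 2 := by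
    intro i
    by_cases hi : ∃ k, k₀ ≤ k ∧ valueRank j k₀ k = i
    · obtain ⟨k, hk, hki⟩ := hi
      refine ⟨b * 2 ^ j k / 2, by positivity, fun l hl hli => ?_⟩
      rw [eq_of_valueRank_eq hjmono hk hl (hki.trans hli.symm)]
    · exact ⟨1, one_pos, fun k hk hki => absurd ⟨k, hk, hki⟩ hi⟩
  choose q hq0 hq using hq
  have hl11 := hl1 1 le_rfl
  have hθ1 : 2 * √(13 * Wd) * l1 1 ≤ b :=
    le_trans (mul_le_mul_of_nonneg_right (le_max_left _ _) hl11.le) hk₀θ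
  have hθ2 : 2 * Valpha * l1 1 ≤ b :=
    le_trans (mul_le_mul_of_nonneg_right (le_max_right _ _) hl11.le) hk₀θ
  have hl1j : ∀ k, k₀ ≤ k → l1 (valueRank j k₀ k) ≤ 2 ^ j k * l1 1 := fun k hk => by
    refine (hl1le _ (one_le_valueRank hk)).trans ?_
    gcongr
    · exact one_le_two
    · have := valueRank_le hjmono k
      omega
  have hqk : ∀ k, k₀ ≤ k → q (valueRank j k₀ k) = b * 2 ^ j k / 2 := fun k hk => hq _ k hk rfl
  set lam : ℕ → ℝ := fun i => if ∃ k, k₀ ≤ k ∧ valueRank j k₀ k = i then l1 i / q i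
    else 1 / (Valpha + 1) with hlam
  have hlamk : ∀ k, k₀ ≤ k → lam (valueRank j k₀ k) =
      l1 (valueRank j k₀ k) / q (valueRank j k₀ k) := fun k hk => if_pos ⟨k, hk, rfl⟩
  set ι : ℕ → ℕ := fun k => if k₀ ≤ k then valueRank j k₀ k else 1 with hι
  have hιk : ∀ k, k₀ ≤ k → ι k = valueRank j k₀ k := fun k hk => if_pos hk
  refine ⟨lam, ι, ⟨fun i hi => ?_, fun i hi => ?_, fun k hk => ?_, fun k hk h => ?_,
    fun k hk h => ?_, fun k hk h => ?_⟩, fun k hk => ?_⟩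
  · simp only [hlam]
    split_ifs
    · exact div_pos (hl1 i hi) (hq0 i)
    · exact hdef.1
  · simp only [hlam]
    split_ifs with h
    · obtain ⟨k, hk, rfl⟩ := h
      rw [div_mul_eq_mul_div, div_le_one (hq0 _), hqk k hk]
      have h1 := hl1j k hk
      have h2 : (0 : ℝ) < 2 ^ j k := by positivity
      nlinarith [mul_le_mul_of_nonneg_right h1 hVα]
    · exact hdef.2
  · simp only [hι]
    split_ifs with h
    · exact one_le_valueRank h
    · exact le_rfl
  · have hk' := (hge k hk).1 h
    rw [hιk k hk', hlamk k hk']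
    set i := valueRank j k₀ k with hi
    have hli := hl1 i (one_le_valueRank hk')
    have hqi := hq0 i
    have h1 := (hj k hk').1
    have h2 := hl1j k hk'
    have h3 := hqk k hk'
    rw [← hi] at h2 h3
    have e1 : l1 i / (l1 i / q i) = q i := by field_simp
    -- Growth l1(i) ≤ 2^j l1(1) is matched by q ≥ √(13 Wd)·l1(1)·2^j, from the threshold at k₀. With
    -- `e1` the lower condition reads at most 2q, the bottom of the range.
    have e2 : 13 * (l1 i / q i) * Wd * l1 1 ≤ q i := by
      have e3 : 13 * (l1 i / q i) * Wd * l1 1 = 13 * Wd * l1 1 * l1 i / q i := by ring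
      rw [e3, div_le_iff₀ hqi]
      set x : ℝ := 2 ^ j k with hx
      have hx1 : 1 ≤ x := one_le_pow₀ one_le_two
      have hs := Real.sq_sqrt (by positivity : 0 ≤ 13 * Wd)
      have hs0 := Real.sqrt_nonneg (13 * Wd)
      have e4 : √(13 * Wd) * l1 1 * x ≤ q i := by rw [h3]; nlinarith
      calc 13 * Wd * l1 1 * l1 i ≤ 13 * Wd * l1 1 * (x * l1 1) := by gcongr
        _ = 13 * Wd * l1 1 ^ 2 * (x * 1) := by ring
        _ ≤ 13 * Wd * l1 1 ^ 2 * (x * x) := by gcongr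
        _ = (√(13 * Wd) * l1 1 * x) * (√(13 * Wd) * l1 1 * x) := by
            linear_combination (-(l1 1 ^ 2 * x ^ 2)) * hs
        _ ≤ q i * q i := by gcongr
    linarith
  · have hk' := (hge k hk).1 h
    rw [hιk k hk', hlamk k hk']
    set i := valueRank j k₀ k with hi
    have hli := hl1 i (one_le_valueRank hk')
    have hqi := hq0 i
    have e1 : 4 * l1 i / (l1 i / q i) = 4 * q i := by field_simp
    have h1 := (hj k hk').2
    rw [e1, hqk k hk']
    rw [pow_succ] at h1
    linarith
  · exact if_neg fun hk' => absurd ((hge k hk).2 hk') (not_le.2 h)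
  · have h0 := hlog0 k hk
    by_cases hk' : k₀ ≤ k
    · rw [hιk k hk']
      refine ⟨valueRank_le_self hk₀1 k, ?_⟩
      have h1 : (valueRank j k₀ k : ℝ) ≤ j k + 1 := by exact_mod_cast valueRank_le hjmono k
      have h2 : (j k : ℝ) ≤ Real.logb 2 (c₁ k / c₁ 1) := by
        rw [Real.le_logb_iff_rpow_le one_lt_two (div_pos (hc₁ k hk) (hc₁ 1 le_rfl)),
          Real.rpow_natCast, le_div_iff₀ (hc₁ 1 le_rfl)]
        have h3 := hmono 1 k₀ le_rfl hk₀1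
        have h4 : (0 : ℝ) < 2 ^ j k := by positivity
        nlinarith [(hj k hk').1]
      linarith
    · rw [show ι k = 1 from if_neg hk']
      refine ⟨hk, ?_⟩
      push_cast
      linarith

theorem ell1_le_two_pow_mul {H nS nA : ℕ} (hH : 1 ≤ H) (hS : 1 ≤ nS) (hA : 1 ≤ nA) {δ : ℝ}
    (hδ : 0 < δ) (hδ1 : δ ≤ 1) {i : ℕ} (hi : 1 ≤ i) :
    ell1 H nS nA i δ ≤ 2 ^ (i - 1) * ell1 H nS nA 1 δ := by
  have h1 := ell1_one_ge hH hS hA hδ hδ1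
  have hi0 : (0 : ℝ) < i := by exact_mod_cast hi
  have hi1 : (1 : ℝ) ≤ i := by exact_mod_cast hi
  rw [ell1_eq_add hH hS hA hδ hi]
  have h2 := Real.log_le_sub_one_of_pos hi0
  have h3 : (i : ℝ) ≤ 2 ^ (i - 1) := by
    have h4 : i - 1 < 2 ^ (i - 1) := Nat.lt_two_pow_self
    have h5 : i ≤ 2 ^ (i - 1) := by omega
    exact_mod_cast h5
  nlinarith [mul_le_mul_of_nonneg_right h3 (by linarith : 0 ≤ ell1 H nS nA 1 δ)]

end Auxiliary

/-! ## The gaps as effective gaps -/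

namespace TabularMDP

section Gaps

variable {S A : Type*} [Fintype S] [Fintype A] [Nonempty A] {H : ℕ} (M : TabularMDP S A H)

theorem gapMin_le {h : Fin H} {s : S} {a : A} (hg : 0 < M.gapAt h s a) :
    M.gapMin ≤ M.gapAt h s a :=
  csInf_le ⟨0, fun _ hx => hx.1.le⟩ ⟨hg, h, s, a, rfl⟩

theorem gapMin_pos (hex : ∃ (h : Fin H) (s : S) (a : A), 0 < M.gapAt h s a) : 0 < M.gapMin := by
  obtain ⟨h, s, a, hg⟩ := hex
  have hfin : {g | 0 < g ∧ ∃ (h : Fin H) (s : S) (a : A), g = M.gapAt h s a}.Finite := by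
    refine (Set.finite_range fun p : Fin H × S × A => M.gapAt p.1 p.2.1 p.2.2).subset ?_
    rintro g ⟨-, h, s, a, rfl⟩
    exact ⟨(h, s, a), rfl⟩
  have hne : {g | 0 < g ∧ ∃ (h : Fin H) (s : S) (a : A), g = M.gapAt h s a}.Nonempty :=
    ⟨_, hg, h, s, a, rfl⟩
  exact (hne.csInf_mem hfin).1

/-- Lets the threshold with `gapMin` replace the one with `vGap`. The value 0 covers the case where
no sub-optimal selection can occur. -/
theorem gapMin_le_vGap (Sinit : Set S) : M.vGap Sinit = 0 ∨ M.gapMin ≤ M.vGap Sinit := by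
  set G := {g | ∃ π : Policy S A H, ∃ s ∈ Sinit, ∃ x : Fin H → S, 0 < M.trajProb π 0 s x ∧
    ∃ hB : M.firstSubopt π x < H,
      g = M.gapAt (M.firstSubopt π x) (x ⟨_, hB⟩) (π ⟨_, hB⟩ (x ⟨_, hB⟩))} with hG
  change sInf G = 0 ∨ M.gapMin ≤ sInf G
  rcases G.eq_empty_or_nonempty with h | h
  · left; rw [h, Real.sInf_empty]
  · right
    refine le_csInf h ?_
    rintro g ⟨π, s, -, x, -, hB, rfl⟩
    exact M.gapMin_le (h := ⟨_, hB⟩) (M.gapAt_pos_of_firstSubopt_eq (h := ⟨_, hB⟩) rfl)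

theorem gapAt_le_Vmax {Vmax : ℝ} (hV0 : 0 ≤ Vmax)
    (hV : ∀ (π : Policy S A H) (h : Fin H) (s : S), 0 ≤ M.V π h s ∧ M.V π h s ≤ Vmax) (h : Fin H)
    (s : S) (a : A) : M.gapAt h s a ≤ Vmax := by
  have h1 := M.gapAt_le_regret (fun _ _ => a) h s
  have h2 := (Vstar_mem hV0 hV h s).2
  have h3 := (hV (fun _ _ => a) h s).1
  linarith

/-- A trajectory with a sub-optimal action loses in total at least `gapMin`. Half of its gaps may
therefore be kept in place, and the other half contains gapMin/2, which can be spread evenly as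
gapMin/(2H) per step. -/
theorem isEffectiveGap_gap (hex : ∃ (h : Fin H) (s : S) (a : A), 0 < M.gapAt h s a)
    (Sinit : Set S) :
    M.IsEffectiveGap Sinit fun h s a => max (M.gapAt h s a) (M.gapMin / H) / 2 := by
  have hmin := M.gapMin_pos hex
  have hH : (0 : ℝ) < H := by
    obtain ⟨h, -⟩ := hex
    exact_mod_cast h.pos
  refine ⟨fun h s a => by positivity, fun s _ π => ?_⟩
  rw [M.Vstar_sub_V_eq_cumulative]
  refine M.trajExp_mono π 0 s fun x _ => ?_
  have hnn : ∀ j : Fin H, 0 ≤ M.gapAt j (x j) (π j (x j)) := fun j => M.gapAt_nonneg _ _ _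
  have hle : ∑ h : Fin H, (if M.firstSubopt π x ≤ (h : ℕ) then
        max (M.gapAt h (x h) (π h (x h))) (M.gapMin / H) / 2 else 0) ≤
      ∑ h : Fin H, if 0 ≤ (h : ℕ) then M.gapAt h (x h) (π h (x h)) else 0 := by
    simp only [zero_le, if_true]
    by_cases hB : M.firstSubopt π x < H
    · have h1 : M.gapMin ≤ ∑ h : Fin H, M.gapAt h (x h) (π h (x h)) :=
        (M.gapMin_le (h := ⟨_, hB⟩) (M.gapAt_pos_of_firstSubopt_eq (h := ⟨_, hB⟩) rfl)).trans
          (Finset.single_le_sum (f := fun h : Fin H => M.gapAt h (x h) (π h (x h)))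
            (fun h _ => hnn h) (Finset.mem_univ (⟨_, hB⟩ : Fin H)))
      have h2 : ∑ h : Fin H, (if M.firstSubopt π x ≤ (h : ℕ) then
          max (M.gapAt h (x h) (π h (x h))) (M.gapMin / H) / 2 else 0) ≤
          ∑ h : Fin H, (M.gapAt h (x h) (π h (x h)) / 2 + M.gapMin / H / 2) := by
        refine Finset.sum_le_sum fun h _ => ?_
        have h3 := hnn h
        have h4 : 0 < M.gapMin / H := by positivity
        split_ifs
        · have : max (M.gapAt h (x h) (π h (x h))) (M.gapMin / H) ≤
              M.gapAt h (x h) (π h (x h)) + M.gapMin / H :=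
            max_le (by linarith) (by linarith)
          linarith
        · linarith
      refine h2.trans ?_
      rw [Finset.sum_add_distrib, ← Finset.sum_div, Finset.sum_const, Finset.card_univ,
        Fintype.card_fin, nsmul_eq_mul]
      have h5 : (H : ℝ) * (M.gapMin / H / 2) = M.gapMin / 2 := by field_simp
      rw [h5]
      linarith
    · have h1 : ∀ h : Fin H, ¬ M.firstSubopt π x ≤ (h : ℕ) := fun h hh =>
        hB (lt_of_le_of_lt hh h.2)
      simp only [h1, if_false, Finset.sum_const_zero]
      exact Finset.sum_nonneg fun h _ => hnn h
  exact hle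

end Gaps

end TabularMDP

/-! ## The main theorem -/

theorem theorem4 {S A Ω : Type*} [Fintype S] [Fintype A] [Nonempty A]
    [mΩ : MeasurableSpace Ω] (μ : Measure Ω) [IsProbabilityMeasure μ]
    -- the MDP, with values of all policies in `[0, Vmax]`
    (H : ℕ) (hH : 1 ≤ H) (M : TabularMDP S A H) (Sinit : Set S)
    (Vmax : ℝ)
    (hV : ∀ (π : Policy S A H) (h : Fin H) (s : S), 0 ≤ M.V π h s ∧ M.V π h s ≤ Vmax)
    -- positive, non-decreasing input sequences
    (c₁ c₂ : ℕ → ℝ) (hc₁ : ∀ k, 1 ≤ k → 0 < c₁ k) (hc₂ : ∀ k, 1 ≤ k → 0 < c₂ k)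
    (hc₁mono : ∀ k l, 1 ≤ k → k ≤ l → c₁ k ≤ c₁ l)
    (hc₂mono : ∀ k l, 1 ≤ k → k ≤ l → c₂ k ≤ c₂ l)
    -- a run of EQO+ in the MDP
    (ℱ : Filtration (ℕ ×ₗ ℕ) mΩ) (I : Interaction S A H Ω)
    (hI : I.InMDP M Sinit μ ℱ) (hEQO : I.FollowsEQO c₁ c₂ Vmax)
    -- conditional sub-exponentiality
    (sig : Fin H → S → A → ℝ) (hsig : ∀ h s a, 0 ≤ sig h s a) (Valpha : ℝ) (hVα : 0 ≤ Valpha)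
    (hsub : I.SubExp M μ ℱ sig Valpha)
    (δ : ℝ) (hδ : 0 < δ) (hδ1 : δ ≤ 1) :
    let l1 : ℕ → ℝ := fun i => ell1 H (Fintype.card S) (Fintype.card A) i δ
    let l2 : ℕ → ℝ := fun k => ell2 H (Fintype.card S) (Fintype.card A) k δ
    let Ws : ℝ := M.WStar sig
    let Wd : ℝ := M.WDiffStar sig
    -- auxiliary sequences exist
    (∃ (lam : ℕ → ℝ) (ι : ℕ → ℕ), IsAuxSeq l1 Wd Valpha c₁ lam ι ∧
      ∀ k, 1 ≤ k → ι k ≤ k ∧ (ι k : ℝ) ≤ 3 + Real.logb 2 (c₁ k / c₁ 1)) ∧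
    -- and any choice of them gives the bounds
    ∀ (lam : ℕ → ℝ) (ι : ℕ → ℕ), IsAuxSeq l1 Wd Valpha c₁ lam ι → ∀ K : ℕ, 1 ≤ K →
      let κ : ℕ∞ := kappa l1 l2 Wd Valpha (sigmaMax sig Valpha Vmax) c₁ c₂ ι
      let bound : ℝ → ℝ → ℝ := fun g G =>
        regretBound H (Fintype.card S) (Fintype.card A) K Vmax Ws l1 l2 c₁ ι κ
          (kappaGap l1 Ws c₁ ι g) G
      -- arbitrary effective gaps
      (∀ eg : Fin H → S → A → ℝ, M.IsEffectiveGap Sinit eg →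
        I.distRegret M μ K δ ≤
          (bound (M.vGap Sinit)
            (∑ s : S, ∑ a : A, min (2048 * c₂ K ^ 2 / minOverSteps eg s a)
              (64 * c₁ K * Real.log (max 1 (32 * c₁ K / minOverSteps eg s a)))) : ℝ) ∧
        ((∀ s a, minOverSteps eg s a ≤ Vmax) →
          I.distRegret M μ K δ ≤
            (bound (M.vGap Sinit)
              (∑ s : S, ∑ a : A, min (2048 * c₂ K ^ 2 / minOverSteps eg s a)
                (64 * c₁ K * Real.log (32 * c₁ K / minOverSteps eg s a))) : ℝ))) ∧
      -- the gaps themselves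
      ((∃ (h : Fin H) (s : S) (a : A), 0 < M.gapAt h s a) →
        I.distRegret M μ K δ ≤
          (bound M.gapMin
            (∑ s : S, ∑ a : A, min (4096 * c₂ K ^ 2 / max (M.gap s a) (M.gapMin / H))
              (64 * c₁ K * Real.log (64 * c₁ K / max (M.gap s a) (M.gapMin / H)))) : ℝ)) := by
  intro l1 l2 Ws Wd
  obtain ⟨ω₀⟩ : Nonempty Ω := nonempty_of_isProbabilityMeasure μ
  have : Nonempty S := ⟨I.s 1 0 ω₀⟩
  have : Nonempty (Fin H) := ⟨⟨0, hH⟩⟩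
  have hS : 1 ≤ Fintype.card S := Fintype.card_pos
  have hA : 1 ≤ Fintype.card A := Fintype.card_pos
  have hV0 : 0 ≤ Vmax := TabularMDP.Vmax_nonneg hH hV
  refine ⟨exists_isAuxSeq (fun i hi => ell1_pos hH hS hA hδ hδ1 hi)
    (fun i hi => ell1_le_two_pow_mul hH hS hA hδ hδ1 hi) (M.WDiffStar_nonneg sig) hVα hc₁ hc₁mono, ?_⟩
  intro lam ι haux K hK κ bound
  have hcore := fun {eg : Fin H → S → A → ℝ} (heg : M.IsEffectiveGap Sinit eg) {κg : ℕ∞} hgap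
    {G : S → A → ℝ} hG => I.distRegret_le_regretBound (mΩ := mΩ) (μ := μ) hH hV hc₁ hc₂ hc₁mono
      hc₂mono hI hEQO hsig hVα hsub hδ hδ1 (l1 := l1) (l2 := l2) rfl rfl haux hK heg (κg := κg) hgap
      (G := G) hG
  have hminpos : ∀ {eg : Fin H → S → A → ℝ}, M.IsEffectiveGap Sinit eg → ∀ s a,
      0 < minOverSteps eg s a := fun {eg} heg s a => by
    obtain ⟨h, hh⟩ := exists_eq_ciInf_of_finite (f := fun h => eg h s a)
    unfold minOverSteps
    rw [← hh]
    exact heg.1 h s a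
  refine ⟨fun eg heg => ⟨?_, fun hle => ?_⟩, fun hex => ?_⟩
  · exact hcore heg (fun k hk h => le_of_kappaGap_lt hk h) fun s a =>
      sum_excess_le_min (hc₁ K hK) (hc₂ K hK).le (hminpos heg s a) le_rfl hV0 _
  · exact hcore heg (fun k hk h => le_of_kappaGap_lt hk h) fun s a =>
      sum_excess_le_min_of_le (hc₁ K hK) (hc₂ K hK).le (hminpos heg s a) le_rfl (hle s a) _
  · have hmin := M.gapMin_pos hex
    have hH1 : (1 : ℝ) ≤ H := by exact_mod_cast hH
    refine hcore (M.isEffectiveGap_gap hex Sinit) (fun k hk h => ?_) fun s a => ?_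
    · have h1 := le_of_kappaGap_lt hk h
      have h2 : 0 ≤ 36 * M.WStar sig * l1 (ι k) :=
        mul_nonneg (mul_nonneg (by norm_num) (M.WStar_nonneg sig))
          (ell1_pos hH hS hA hδ hδ1 (haux.iota_pos k hk)).le
      -- For `vGap` equal to 0 the quotient is 0 by convention and the condition is just positivity
      -- of c₁.
      rcases M.gapMin_le_vGap Sinit with h3 | h3
      · rw [h3, div_zero]; exact (hc₁ k hk).le
      · exact (div_le_div_of_nonneg_left h2 hmin h3).trans h1
    · set g := max (M.gap s a) (M.gapMin / H) with hg
      have hg0 : 0 < g := lt_of_lt_of_le (by positivity) (le_max_right _ _)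
      have hgV : g ≤ Vmax := by
        obtain ⟨h, s', a', hpos⟩ := hex
        refine max_le ?_ ?_
        · exact (ciInf_le (Set.finite_range _).bddBelow (⟨0, hH⟩ : Fin H)).trans
            (M.gapAt_le_Vmax hV0 hV _ s a)
        · exact (div_le_self hmin.le hH1).trans ((M.gapMin_le hpos).trans
            (M.gapAt_le_Vmax hV0 hV _ _ _))
      have hle : g / 2 ≤ minOverSteps (fun h s a => max (M.gapAt (h : Fin H) s a) (M.gapMin / H) / 2)
          s a := by
        refine le_ciInf fun h => ?_
        have : M.gap s a ≤ M.gapAt h s a := ciInf_le (Set.finite_range _).bddBelow h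
        exact div_le_div_of_nonneg_right (max_le_max this le_rfl) zero_le_two
      have h1 := sum_excess_le_min_of_le (V := Vmax) (hc₁ K hK) (hc₂ K hK).le (half_pos hg0) hle
        (by linarith) (K * H)
      -- The half in the effective gaps doubles the constants 2048 and 32.
      have h2 : 2048 * c₂ K ^ 2 / (g / 2) = 4096 * c₂ K ^ 2 / g := by field_simp; ring
      have h3 : 32 * c₁ K / (g / 2) = 64 * c₁ K / g := by field_simp; ring
      rwa [h2, h3] at h1
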